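/- Let $k$ be a field and let $f\colon X\to S$ be a smooth $k$-morphism of smooth connected $k$-schemes. For a morphism $X\to T$ let $\mathrm{Diff}(X/T)\subset \mathcal{E}nd_{\mathcal O_T}(\mathcal O_X)$ be the sheaf of algebras of $\mathcal O_T$-linear differential operators, i.e. $\mathrm{Diff}(X/T)=\bigcup_m \mathrm{Diff}^m$, where $\mathrm{Diff}^0=\mathcal O_X$ acts by multiplication and $D\in\mathrm{Diff}^{m+1}$ iff $D_a\colon t\mapsto D(at)-aD(t)$ lies in $\mathrm{Diff}^m$ for all local sections $a$ of $\mathcal O_X$. A stratification over $X/T$ on an $\mathcal O_X$-module $E$ is a homomorphism of sheaves of algebras $\nabla\colon \mathrm{Diff}(X/T)\to \mathcal{E}nd_{\mathcal O_T}(E)$ such that, for every local section $a$ of $\mathcal O_X$, $\nabla(a)$ is multiplication by $a$; a stratified sheaf is a quasi-coherent $\mathcal O_X$-module with a stratification. A local section $e$ of $E$ is horizontal if $\nabla(D)(e)=0$ for all local operators $D$ with $D(1)=0$; the sheaf of horizontal sections is $E^{\nabla}$. Let $(E,\nabla)$ be a stratified sheaf on $X/k$ and let $\nabla_{X/S}$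 be the restriction of $\nabla$ to $\mathrm{Diff}(X/S)\subset\mathrm{Diff}(X/k)$. (i) The $\mathcal O_S$-module $f_*(E^{\nabla_{X/S}})$ carries a unique stratification $f_*\nabla$ over $S/k$ such that for every open $W\subset S$, every $D'\in\mathrm{Diff}(S/k)(W)$, every section $e$ of $f_*(E^{\nabla_{X/S}})$ over $W$, every open $U\subset f^{-1}(W)$ and every $D\in \mathrm{Diff}(X/k)(U)$ lifting $D'$ (that is, $D(f^*a)=f^*(D'(a))$ for all local sections $a$ of $\mathcal O_S$ over open subsets of $W$), one has $\big((f_*\nabla)(D')(e)\big)|_U=\nabla(D)(e|_U)$. (ii) Assume moreover that $f_*\mathcal O_X=\mathcal O_S$ (via the canonical map). If $E$ is coherent as an $\mathcal O_X$-module, then $f_*(E^{\nabla_{X/S}})$ is a locally free $\mathcal O_S$-module of finite rank. -/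

import Mathlib

open CategoryTheory AlgebraicGeometry TopologicalSpace Opposite

universe u

set_option linter.unusedVariables false

noncomputable section

namespace Strat

variable {X S T : Scheme.{u}}

/-- Restriction of functions. -/
def resO {U V : X.Opens} (h : V ≤ U) : Γ(X, U) →+* Γ(X, V) :=
  (X.presheaf.map (homOfLE h).op).hom

/-- Restriction of sections of a sheaf of modules. -/
def resM (M : X.Modules) {U V : X.Opens} (h : V ≤ U) : Γ(M, U) →+ Γ(M, V) :=
  (M.presheaf.map (homOfLE h).op).hom

lemma resO_resO {U V W : X.Opens} (h : V ≤ U) (h' : W ≤ V) (x : Γ(X, U)) :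
    resO h' (resO h x) = resO (h'.trans h) x := by
  simp only [resO]
  rw [← CommRingCat.comp_apply, ← Functor.map_comp]
  rfl

lemma resO_self {U : X.Opens} (h : U ≤ U) (x : Γ(X, U)) : resO h x = x := by
  have : (homOfLE h).op = 𝟙 (op U) := rfl
  simp only [resO, this, X.presheaf.map_id]
  rfl

lemma resM_resM (M : X.Modules) {U V W : X.Opens} (h : V ≤ U) (h' : W ≤ V) (x : Γ(M, U)) :
    resM M h' (resM M h x) = resM M (h'.trans h) x := by
  simp only [resM]
  rw [← AddCommGrpCat.comp_apply, ← Functor.map_comp]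
  rfl

lemma resM_self (M : X.Modules) {U : X.Opens} (h : U ≤ U) (x : Γ(M, U)) : resM M h x = x := by
  have : (homOfLE h).op = 𝟙 (op U) := rfl
  simp only [resM, this, M.presheaf.map_id]
  rfl

lemma resM_smul (M : X.Modules) {U V : X.Opens} (h : V ≤ U) (a : Γ(X, U)) (x : Γ(M, U)) :
    resM M h (a • x) = resO h a • resM M h x :=
  M.map_smul (homOfLE h) a x

lemma resO_appLE (g : X ⟶ T) {W : T.Opens} {U V : X.Opens} (h : V ≤ U) (e : U ≤ g ⁻¹ᵁ W)
    (a : Γ(T, W)) : resO h (g.appLE W U e a) = g.appLE W V (h.trans e) a := by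
  simp only [resO]
  rw [← CommRingCat.comp_apply, Scheme.Hom.appLE_map]

/-- The sections over `U` of the sheaf `End_{𝒪_T}(𝒪_X)`, for a scheme `g : X ⟶ T` over `T`:
additive endomorphisms of the sheaf `𝒪_X` restricted to `U` that are linear over the (pulled back)
functions of `T`. -/
@[ext]
structure EndO (g : X ⟶ T) (U : X.Opens) where
  /-- The endomorphism of the sections over `V`. -/
  app (V : X.Opens) (hV : V ≤ U) : Γ(X, V) →+ Γ(X, V)
  app_res (V W : X.Opens) (hV : V ≤ U) (h : W ≤ V) (x : Γ(X, V)) :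
    app W (h.trans hV) (resO h x) = resO h (app V hV x)
  app_linear (V : X.Opens) (hV : V ≤ U) (W : T.Opens) (h : V ≤ g ⁻¹ᵁ W) (a : Γ(T, W))
    (x : Γ(X, V)) : app V hV (g.appLE W V h a * x) = g.appLE W V h a * app V hV x

namespace EndO

variable {g : X ⟶ T} {U : X.Opens}

instance : Zero (EndO g U) where
  zero :=
    { app V hV := 0
      app_res V W hV h x := (map_zero (resO h)).symm
      app_linear V hV W h a x := (mul_zero _).symm }

instance : One (EndO g U) where
  one :=
    { app V hV := AddMonoidHom.id _
      app_res V W hV h x := rfl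
      app_linear V hV W h a x := rfl }

instance : Add (EndO g U) where
  add φ ψ :=
    { app V hV := φ.app V hV + ψ.app V hV
      app_res V W hV h x := by
        simp only [AddMonoidHom.add_apply, φ.app_res V W hV h, ψ.app_res V W hV h, map_add]
      app_linear V hV W h a x := by
        simp only [AddMonoidHom.add_apply, φ.app_linear, ψ.app_linear, mul_add] }

instance : Neg (EndO g U) where
  neg φ :=
    { app V hV := -φ.app V hV
      app_res V W hV h x := by
        simp only [AddMonoidHom.neg_apply, φ.app_res V W hV h, map_neg]
      app_linear V hV W h a x := by
        simp only [AddMonoidHom.neg_apply, φ.app_linear, mul_neg] }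

instance : Mul (EndO g U) where
  mul φ ψ :=
    { app V hV := (φ.app V hV).comp (ψ.app V hV)
      app_res V W hV h x := by
        simp only [AddMonoidHom.comp_apply, ψ.app_res V W hV h, φ.app_res V W hV h]
      app_linear V hV W h a x := by
        simp only [AddMonoidHom.comp_apply, ψ.app_linear, φ.app_linear] }

@[simp] lemma zero_app (V : X.Opens) (hV : V ≤ U) : (0 : EndO g U).app V hV = 0 := rfl

@[simp] lemma one_app (V : X.Opens) (hV : V ≤ U) :
    (1 : EndO g U).app V hV = AddMonoidHom.id _ := rfl

@[simp] lemma add_app (φ ψ : EndO g U) (V : X.Opens) (hV : V ≤ U) :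
    (φ + ψ).app V hV = φ.app V hV + ψ.app V hV := rfl

@[simp] lemma neg_app (φ : EndO g U) (V : X.Opens) (hV : V ≤ U) :
    (-φ).app V hV = -φ.app V hV := rfl

@[simp] lemma mul_app (φ ψ : EndO g U) (V : X.Opens) (hV : V ≤ U) :
    (φ * ψ).app V hV = (φ.app V hV).comp (ψ.app V hV) := rfl

/-- Endomorphisms form a ring under composition. -/
instance : Ring (EndO g U) where
  add_assoc _ _ _ := by ext; simp [add_assoc]
  zero_add _ := by ext; simp
  add_zero _ := by ext; simp
  add_comm _ _ := by ext; simp [add_comm]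
  neg_add_cancel _ := by ext; simp
  left_distrib _ _ _ := by ext; simp
  right_distrib _ _ _ := by ext; simp
  zero_mul _ := by ext; simp
  mul_zero _ := by ext; simp
  mul_assoc _ _ _ := by ext; simp
  one_mul _ := by ext; simp
  mul_one _ := by ext; simp
  nsmul := nsmulRec
  zsmul := zsmulRec

@[simp] lemma sub_app (φ ψ : EndO g U) (V : X.Opens) (hV : V ≤ U) :
    (φ - ψ).app V hV = φ.app V hV - ψ.app V hV := by
  rw [sub_eq_add_neg, sub_eq_add_neg, add_app, neg_app]

/-- Restriction of operators to a smaller open subset. -/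
def restr {V : X.Opens} (h : V ≤ U) : EndO g U →+* EndO g V where
  toFun φ :=
    { app W hW := φ.app W (hW.trans h)
      app_res W W' hW h' x := φ.app_res W W' (hW.trans h) h' x
      app_linear W hW W' h' a x := φ.app_linear W (hW.trans h) W' h' a x }
  map_one' := rfl
  map_mul' _ _ := rfl
  map_zero' := rfl
  map_add' _ _ := rfl

variable (g) in
/-- The multiplication operator `t_a` on `𝒪_X` restricted to `U`, for a function `a` on `U`. -/
def mul (U : X.Opens) : Γ(X, U) →+* EndO g U where
  toFun a :=
    { app V hV := AddMonoidHom.mulLeft (resO hV a)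
      app_res V W hV h x := by simp [resO_resO]
      app_linear V hV W h b x := mul_left_comm _ _ _ }
  map_one' := by
    ext V hV x
    change resO hV 1 * x = x
    rw [map_one, one_mul]
  map_mul' a b := by
    ext V hV x
    change resO hV (a * b) * x = resO hV a * (resO hV b * x)
    rw [map_mul, mul_assoc]
  map_zero' := by
    ext V hV x
    change resO hV 0 * x = 0
    rw [map_zero, zero_mul]
  map_add' a b := by
    ext V hV x
    change resO hV (a + b) * x = resO hV a * x + resO hV b * x
    rw [map_add, add_mul]

@[simp] lemma mul_apply (a : Γ(X, U)) (V : X.Opens) (hV : V ≤ U) (x : Γ(X, V)) :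
    (mul g U a).app V hV x = resO hV a * x := rfl

lemma restr_mul {V : X.Opens} (h : V ≤ U) (a : Γ(X, U)) :
    restr h (mul g U a) = mul g V (resO h a) := by
  ext W hW x
  change resO _ a * x = resO hW (resO h a) * x
  rw [resO_resO]

end EndO

/-- The sections over `U` of the sheaf `End_{𝒪_T}(M)`, for an `𝒪_X`-module `M`. -/
@[ext]
structure EndM (g : X ⟶ T) (M : X.Modules) (U : X.Opens) where
  /-- The endomorphism of the sections over `V`. -/
  app (V : X.Opens) (hV : V ≤ U) : Γ(M, V) →+ Γ(M, V)
  app_res (V W : X.Opens) (hV : V ≤ U) (h : W ≤ V) (x : Γ(M, V)) :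
    app W (h.trans hV) (resM M h x) = resM M h (app V hV x)
  app_linear (V : X.Opens) (hV : V ≤ U) (W : T.Opens) (h : V ≤ g ⁻¹ᵁ W) (a : Γ(T, W))
    (x : Γ(M, V)) : app V hV (g.appLE W V h a • x) = g.appLE W V h a • app V hV x

namespace EndM

variable {g : X ⟶ T} {M : X.Modules} {U : X.Opens}

instance : Zero (EndM g M U) where
  zero :=
    { app V hV := 0
      app_res V W hV h x := (map_zero (resM M h)).symm
      app_linear V hV W h a x := (smul_zero _).symm }

instance : One (EndM g M U) where
  one :=
    { app V hV := AddMonoidHom.id _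
      app_res V W hV h x := rfl
      app_linear V hV W h a x := rfl }

instance : Add (EndM g M U) where
  add φ ψ :=
    { app V hV := φ.app V hV + ψ.app V hV
      app_res V W hV h x := by
        simp only [AddMonoidHom.add_apply, φ.app_res V W hV h, ψ.app_res V W hV h, map_add]
      app_linear V hV W h a x := by
        simp only [AddMonoidHom.add_apply, φ.app_linear, ψ.app_linear, smul_add] }

instance : Neg (EndM g M U) where
  neg φ :=
    { app V hV := -φ.app V hV
      app_res V W hV h x := by
        simp only [AddMonoidHom.neg_apply, φ.app_res V W hV h, map_neg]
      app_linear V hV W h a x := by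
        simp only [AddMonoidHom.neg_apply, φ.app_linear, smul_neg] }

instance : Mul (EndM g M U) where
  mul φ ψ :=
    { app V hV := (φ.app V hV).comp (ψ.app V hV)
      app_res V W hV h x := by
        simp only [AddMonoidHom.comp_apply, ψ.app_res V W hV h, φ.app_res V W hV h]
      app_linear V hV W h a x := by
        simp only [AddMonoidHom.comp_apply, ψ.app_linear, φ.app_linear] }

@[simp] lemma zero_app (V : X.Opens) (hV : V ≤ U) : (0 : EndM g M U).app V hV = 0 := rfl

@[simp] lemma one_app (V : X.Opens) (hV : V ≤ U) :
    (1 : EndM g M U).app V hV = AddMonoidHom.id _ := rfl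

@[simp] lemma add_app (φ ψ : EndM g M U) (V : X.Opens) (hV : V ≤ U) :
    (φ + ψ).app V hV = φ.app V hV + ψ.app V hV := rfl

@[simp] lemma neg_app (φ : EndM g M U) (V : X.Opens) (hV : V ≤ U) :
    (-φ).app V hV = -φ.app V hV := rfl

@[simp] lemma mul_app (φ ψ : EndM g M U) (V : X.Opens) (hV : V ≤ U) :
    (φ * ψ).app V hV = (φ.app V hV).comp (ψ.app V hV) := rfl

/-- Endomorphisms form a ring under composition. -/
instance : Ring (EndM g M U) where
  add_assoc _ _ _ := by ext; simp [add_assoc]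
  zero_add _ := by ext; simp
  add_zero _ := by ext; simp
  add_comm _ _ := by ext; simp [add_comm]
  neg_add_cancel _ := by ext; simp
  left_distrib _ _ _ := by ext; simp
  right_distrib _ _ _ := by ext; simp
  zero_mul _ := by ext; simp
  mul_zero _ := by ext; simp
  mul_assoc _ _ _ := by ext; simp
  one_mul _ := by ext; simp
  mul_one _ := by ext; simp
  nsmul := nsmulRec
  zsmul := zsmulRec

@[simp] lemma sub_app (φ ψ : EndM g M U) (V : X.Opens) (hV : V ≤ U) :
    (φ - ψ).app V hV = φ.app V hV - ψ.app V hV := by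
  rw [sub_eq_add_neg, sub_eq_add_neg, add_app, neg_app]

/-- Restriction of operators to a smaller open subset. -/
def restr {V : X.Opens} (h : V ≤ U) : EndM g M U →+* EndM g M V where
  toFun φ :=
    { app W hW := φ.app W (hW.trans h)
      app_res W W' hW h' x := φ.app_res W W' (hW.trans h) h' x
      app_linear W hW W' h' a x := φ.app_linear W (hW.trans h) W' h' a x }
  map_one' := rfl
  map_mul' _ _ := rfl
  map_zero' := rfl
  map_add' _ _ := rfl

variable (g M) in
/-- The multiplication operator `t_a` on `M` restricted to `U`, for a function `a` on `U`. -/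
def mul (U : X.Opens) : Γ(X, U) →+* EndM g M U where
  toFun a :=
    { app V hV := DistribSMul.toAddMonoidHom Γ(M, V) (resO hV a)
      app_res V W hV h x := by simp [resM_smul, resO_resO]
      app_linear V hV W h b x := smul_comm (resO hV a) (g.appLE W V h b) x }
  map_one' := by ext; simp
  map_mul' a b := by ext; simp [mul_smul]
  map_zero' := by ext; simp
  map_add' a b := by ext; simp [add_smul]

@[simp] lemma mul_apply (a : Γ(X, U)) (V : X.Opens) (hV : V ≤ U) (x : Γ(M, V)) :
    (mul g M U a).app V hV x = resO hV a • x := rfl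

end EndM

/-- `D` is a differential operator of order at most `n` on `U`. The operators of order at most `0`
are the multiplications by functions; `D` has order at most `n + 1` if for every local
function `a` the operator `D_a = D t_a - t_a D` has order at most `n`. -/
def HasOrder (g : X ⟶ T) : ℕ → ∀ U : X.Opens, EndO g U → Prop
  | 0, U, D => ∃ a : Γ(X, U), D = EndO.mul g U a
  | n + 1, U, D => ∀ (V : X.Opens) (h : V ≤ U) (a : Γ(X, V)),
      HasOrder g n V (EndO.restr h D * EndO.mul g V a - EndO.mul g V a * EndO.restr h D)

lemma HasOrder.restr {g : X ⟶ T} {n : ℕ} {U V : X.Opens} (h : V ≤ U) {D : EndO g U}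
    (hD : HasOrder g n U D) : HasOrder g n V (EndO.restr h D) := by
  cases n with
  | zero =>
    obtain ⟨a, rfl⟩ := hD
    exact ⟨_, EndO.restr_mul h a⟩
  | succ n => exact fun W h' a ↦ hD W (h'.trans h) a

lemma hasOrder_mul (g : X ⟶ T) (n : ℕ) (U : X.Opens) (a : Γ(X, U)) :
    HasOrder g n U (EndO.mul g U a) := by
  induction n generalizing U with
  | zero => exact ⟨a, rfl⟩
  | succ n ih =>
    intro V h b
    rw [EndO.restr_mul, ← map_mul, ← map_mul, mul_comm, sub_self, ← map_zero (EndO.mul g V)]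
    exact ih V 0

lemma HasOrder.succ {g : X ⟶ T} {n : ℕ} {U : X.Opens} {D : EndO g U}
    (hD : HasOrder g n U D) : HasOrder g (n + 1) U D := by
  induction n generalizing U with
  | zero => obtain ⟨a, rfl⟩ := hD; exact hasOrder_mul g 1 U a
  | succ n ih => exact fun V h a ↦ ih (hD V h a)

lemma HasOrder.mono {g : X ⟶ T} {m n : ℕ} (hmn : m ≤ n) {U : X.Opens} {D : EndO g U}
    (hD : HasOrder g m U D) : HasOrder g n U D := by
  induction hmn with
  | refl => exact hD
  | step _ ih => exact ih.succ

lemma HasOrder.add {g : X ⟶ T} {n : ℕ} {U : X.Opens} {D D' : EndO g U}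
    (hD : HasOrder g n U D) (hD' : HasOrder g n U D') : HasOrder g n U (D + D') := by
  induction n generalizing U with
  | zero =>
    obtain ⟨a, rfl⟩ := hD
    obtain ⟨b, rfl⟩ := hD'
    exact ⟨a + b, (map_add _ a b).symm⟩
  | succ n ih =>
    intro V h a
    have := ih (hD V h a) (hD' V h a)
    convert this using 1
    rw [map_add]
    noncomm_ring

lemma HasOrder.neg {g : X ⟶ T} {n : ℕ} {U : X.Opens} {D : EndO g U}
    (hD : HasOrder g n U D) : HasOrder g n U (-D) := by
  induction n generalizing U with
  | zero =>
    obtain ⟨a, rfl⟩ := hD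
    exact ⟨-a, (map_neg _ a).symm⟩
  | succ n ih =>
    intro V h a
    have := ih (hD V h a)
    convert this using 1
    rw [map_neg, neg_mul, mul_neg]
    abel

lemma HasOrder.mul {g : X ⟶ T} {m n : ℕ} {U : X.Opens} {D D' : EndO g U}
    (hD : HasOrder g m U D) (hD' : HasOrder g n U D') : HasOrder g (m + n) U (D * D') := by
  obtain ⟨N, hN⟩ : ∃ N, m + n = N := ⟨_, rfl⟩
  induction N generalizing m n U with
  | zero =>
    obtain ⟨rfl, rfl⟩ : m = 0 ∧ n = 0 := by omega
    obtain ⟨a, rfl⟩ := hD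
    obtain ⟨b, rfl⟩ := hD'
    exact ⟨a * b, (map_mul _ a b).symm⟩
  | succ N ih =>
    rw [hN]
    intro V h a
    have key : EndO.restr h (D * D') * EndO.mul g V a - EndO.mul g V a * EndO.restr h (D * D') =
        EndO.restr h D * (EndO.restr h D' * EndO.mul g V a - EndO.mul g V a * EndO.restr h D') +
        (EndO.restr h D * EndO.mul g V a - EndO.mul g V a * EndO.restr h D) * EndO.restr h D' := by
      rw [map_mul, mul_sub, sub_mul, mul_assoc, mul_assoc, mul_assoc]
      abel
    rw [key]
    apply HasOrder.add
    · cases n with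
      | zero =>
        obtain ⟨b, rfl⟩ := hD'
        rw [EndO.restr_mul, ← map_mul, ← map_mul, mul_comm, sub_self, mul_zero, ← map_zero (EndO.mul g V)]
        exact hasOrder_mul g N V 0
      | succ n =>
        have := ih (hD.restr h) (hD' V h a) (by omega)
        rwa [show m + n = N by omega] at this
    · cases m with
      | zero =>
        obtain ⟨b, rfl⟩ := hD
        rw [EndO.restr_mul, ← map_mul, ← map_mul, mul_comm, sub_self, zero_mul, ← map_zero (EndO.mul g V)]
        exact hasOrder_mul g N V 0
      | succ m =>
        have := ih (hD V h a) (hD'.restr h) (by omega)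
        rwa [show m + n = N by omega] at this

/-- The sections over `U` of the sheaf of algebras `Diff(X/T)`, the union of the subsheaves of
operators of order at most `n`: operators which are locally of finite order. -/
def diffOp (g : X ⟶ T) (U : X.Opens) : Subring (EndO g U) where
  carrier := {D | ∀ x ∈ U, ∃ (V : X.Opens) (h : V ≤ U) (n : ℕ), x ∈ V ∧
    HasOrder g n V (EndO.restr h D)}
  mul_mem' {D D'} hD hD' x hx := by
    obtain ⟨V, h, n, hxV, H⟩ := hD x hx
    obtain ⟨V', h', n', hxV', H'⟩ := hD' x hx
    refine ⟨V ⊓ V', inf_le_left.trans h, n + n', ⟨hxV, hxV'⟩, ?_⟩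
    exact HasOrder.mul (H.restr (inf_le_left : V ⊓ V' ≤ V)) (H'.restr (inf_le_right : V ⊓ V' ≤ V'))
  one_mem' x hx := by
    refine ⟨U, le_rfl, 0, hx, 1, ?_⟩
    simp
  add_mem' {D D'} hD hD' x hx := by
    obtain ⟨V, h, n, hxV, H⟩ := hD x hx
    obtain ⟨V', h', n', hxV', H'⟩ := hD' x hx
    refine ⟨V ⊓ V', inf_le_left.trans h, max n n', ⟨hxV, hxV'⟩, ?_⟩
    exact HasOrder.add ((H.restr (inf_le_left : V ⊓ V' ≤ V)).mono (le_max_left _ _))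
      ((H'.restr (inf_le_right : V ⊓ V' ≤ V')).mono (le_max_right _ _))
  zero_mem' x hx := by
    refine ⟨U, le_rfl, 0, hx, 0, ?_⟩
    simp
  neg_mem' {D} hD x hx := by
    obtain ⟨V, h, n, hxV, H⟩ := hD x hx
    exact ⟨V, h, n, hxV, by rw [map_neg]; exact H.neg⟩

lemma restr_mem_diffOp (g : X ⟶ T) {U V : X.Opens} (h : V ≤ U) {D : EndO g U}
    (hD : D ∈ diffOp g U) : EndO.restr h D ∈ diffOp g V := by
  intro x hx
  obtain ⟨W, h', n, hxW, H⟩ := hD x (h hx)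
  exact ⟨W ⊓ V, inf_le_right, n, ⟨hxW, hx⟩, H.restr (inf_le_left : W ⊓ V ≤ W)⟩

/-- Restriction of differential operators to a smaller open subset. -/
def diffRestr (g : X ⟶ T) {U V : X.Opens} (h : V ≤ U) : diffOp g U →+* diffOp g V :=
  (EndO.restr h).restrict _ _ fun _ hD ↦ restr_mem_diffOp g h hD

/-- Functions as differential operators of order `0`. -/
def diffMul (g : X ⟶ T) (U : X.Opens) : Γ(X, U) →+* diffOp g U :=
  (EndO.mul g U).codRestrict _ fun a _ hx ↦ ⟨U, le_rfl, 0, hx, (hasOrder_mul g 0 U a).restr le_rfl⟩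

/-- The value `D(a)` of a differential operator `D` on `U` at a function `a` on `V ≤ U`. -/
def diffApply {g : X ⟶ T} {U : X.Opens} (D : diffOp g U) {V : X.Opens} (h : V ≤ U)
    (a : Γ(X, V)) : Γ(X, V) :=
  D.1.app V h a

/-- A stratification relative to `g : X ⟶ T` on an `𝒪_X`-module `M`: an action of the sheaf of
algebras `Diff(X/T)` on `M`, that is, a homomorphism of sheaves of algebras from `Diff(X/T)` to
`End_{𝒪_T}(M)` under which a function acts by multiplication. -/
@[ext]
structure Stratification (g : X ⟶ T) (M : X.Modules) where
  /-- The action over the open subset `U`. -/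
  act (U : X.Opens) : diffOp g U →+* EndM g M U
  act_restr {U V : X.Opens} (h : V ≤ U) (D : diffOp g U) :
    act V (diffRestr g h D) = EndM.restr h (act U D)
  act_mul (U : X.Opens) (a : Γ(X, U)) : act U (diffMul g U a) = EndM.mul g M U a

/-- The section `∇(D)(e)` over `U`. -/
def Stratification.apply {g : X ⟶ T} {M : X.Modules} (N : Stratification g M) {U : X.Opens}
    (D : diffOp g U) (e : Γ(M, U)) : Γ(M, U) :=
  (N.act U D).app U le_rfl e

lemma Stratification.resM_apply {g : X ⟶ T} {M : X.Modules} (N : Stratification g M)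
    {U V : X.Opens} (h : V ≤ U) (D : diffOp g U) (e : Γ(M, U)) :
    resM M h (N.apply D e) = N.apply (diffRestr g h D) (resM M h e) := by
  have := (N.act U D).app_res U V le_rfl h e
  rw [Stratification.apply, ← this, Stratification.apply, N.act_restr]
  rfl

lemma Stratification.act_apply {g : X ⟶ T} {M : X.Modules} (N : Stratification g M)
    {U : X.Opens} (D : diffOp g U) (V : X.Opens) (hV : V ≤ U) (e : Γ(M, V)) :
    (N.act U D).app V hV e = N.apply (diffRestr g hV D) e := by
  rw [Stratification.apply, N.act_restr]
  rfl

section relative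

variable (f : X ⟶ S) (q : S ⟶ T)

/-- An `𝒪_S`-linear operator on `𝒪_X` is `𝒪_T`-linear. -/
def endIncl (U : X.Opens) : EndO f U →+* EndO (f ≫ q) U where
  toFun φ :=
    { app := φ.app
      app_res := φ.app_res
      app_linear V hV W h a x := by
        rw [Scheme.Hom.comp_appLE]
        exact φ.app_linear V hV (q ⁻¹ᵁ W) h (q.app W a) x }
  map_one' := rfl
  map_mul' _ _ := rfl
  map_zero' := rfl
  map_add' _ _ := rfl

lemma HasOrder.endIncl {n : ℕ} {U : X.Opens} {D : EndO f U} (hD : HasOrder f n U D) :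
    HasOrder (f ≫ q) n U (endIncl f q U D) := by
  induction n generalizing U with
  | zero => obtain ⟨a, rfl⟩ := hD; exact ⟨a, rfl⟩
  | succ n ih => exact fun V h a ↦ ih (hD V h a)

/-- The inclusion of `Diff(X/S)` in `Diff(X/T)`. -/
def diffIncl (U : X.Opens) : diffOp f U →+* diffOp (f ≫ q) U :=
  (endIncl f q U).restrict _ _ fun D hD x hx ↦ by
    obtain ⟨V, h, n, hxV, H⟩ := hD x hx
    exact ⟨V, h, n, hxV, H.endIncl f q⟩

variable {f q} in
lemma Stratification.linear {M : X.Modules} (N : Stratification (f ≫ q) M) {U : X.Opens}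
    (D : diffOp f U) (V : X.Opens) (hV : V ≤ U) (W : S.Opens) (h : V ≤ f ⁻¹ᵁ W) (a : Γ(S, W))
    (x : Γ(M, V)) :
    (N.act U (diffIncl f q U D)).app V hV (f.appLE W V h a • x) =
      f.appLE W V h a • (N.act U (diffIncl f q U D)).app V hV x := by
  have comm : diffRestr (f ≫ q) hV (diffIncl f q U D) *
        diffMul (f ≫ q) V (f.appLE W V h a) =
      diffMul (f ≫ q) V (f.appLE W V h a) *
        diffRestr (f ≫ q) hV (diffIncl f q U D) := by
    apply Subtype.ext
    apply EndO.ext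
    ext V' hV' y
    change D.1.app V' (hV'.trans hV) (resO hV' (f.appLE W V h a) * y) =
      resO hV' (f.appLE W V h a) * D.1.app V' (hV'.trans hV) y
    rw [resO_appLE]
    exact D.1.app_linear V' (hV'.trans hV) W _ a y
  have key := congrArg (N.act V) comm
  rw [map_mul, map_mul, N.act_mul, N.act_restr] at key
  have key' := DFunLike.congr_fun (congrArg (fun φ ↦ φ.app V le_rfl) key) x
  change (N.act U (diffIncl f q U D)).app V hV (resO (le_refl V) (f.appLE W V h a) • x) =
    resO (le_refl V) (f.appLE W V h a) • (N.act U (diffIncl f q U D)).app V hV x at key'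
  rwa [resO_self] at key'

variable {f q} in
/-- The action of `Diff(X/S)` on `M` over `U`, induced by an action of `Diff(X/T)`. -/
def Stratification.relativeAct {M : X.Modules} (N : Stratification (f ≫ q) M) (U : X.Opens) :
    diffOp f U →+* EndM f M U where
  toFun D :=
    { app := (N.act U (diffIncl f q U D)).app
      app_res := (N.act U (diffIncl f q U D)).app_res
      app_linear := N.linear D }
  map_one' := EndM.ext <| by simp only [map_one]; rfl
  map_mul' D D' := EndM.ext <| by simp only [map_mul]; rfl
  map_zero' := EndM.ext <| by simp only [map_zero]; rfl
  map_add' D D' := EndM.ext <| by simp only [map_add]; rfl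

variable {f q} in
/-- The relative stratification `∇_{X/S}`, the restriction to `Diff(X/S)` of a stratification
relative to `X/T`. -/
def Stratification.relative {M : X.Modules} (N : Stratification (f ≫ q) M) :
    Stratification f M where
  act := N.relativeAct
  act_restr {U V} h D := by
    have := congrArg EndM.app (N.act_restr h (diffIncl f q U D))
    exact EndM.ext this
  act_mul U a := by
    have := congrArg EndM.app (N.act_mul U a)
    exact EndM.ext this

end relative

/-- A section `e` of `M` over `U` is horizontal if it is annihilated by all local differential
operators `D` with `D(1) = 0`. -/
def Stratification.IsHorizontal {g : X ⟶ T} {M : X.Modules} (N : Stratification g M)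
    {U : X.Opens} (e : Γ(M, U)) : Prop :=
  ∀ (V : X.Opens) (h : V ≤ U) (D : diffOp g V), diffApply D le_rfl 1 = 0 →
    N.apply D (resM M h e) = 0

section pushforward

variable {f : X ⟶ S} {M : X.Modules} (N : Stratification f M)

lemma Stratification.IsHorizontal.res {U V : X.Opens} (h : V ≤ U) {e : Γ(M, U)}
    (he : N.IsHorizontal e) : N.IsHorizontal (resM M h e) := by
  intro W h' D hD
  rw [resM_resM]
  exact he W (h'.trans h) D hD

lemma Stratification.IsHorizontal.add {U : X.Opens} {e e' : Γ(M, U)}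
    (he : N.IsHorizontal e) (he' : N.IsHorizontal e') : N.IsHorizontal (e + e') := by
  intro V h D hD
  have h1 := he V h D hD
  have h2 := he' V h D hD
  rw [Stratification.apply] at h1 h2 ⊢
  rw [map_add, map_add, h1, h2, add_zero]

lemma Stratification.isHorizontal_zero (U : X.Opens) : N.IsHorizontal (0 : Γ(M, U)) := by
  intro V h D hD
  rw [Stratification.apply, map_zero, map_zero]

lemma Stratification.IsHorizontal.smul {W : S.Opens} {e : Γ(M, f ⁻¹ᵁ W)}
    (he : N.IsHorizontal e) (a : Γ(S, W)) : N.IsHorizontal (f.app W a • e) := by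
  intro V h D hD
  have h1 := he V h D hD
  rw [Stratification.apply] at h1 ⊢
  rw [resM_smul, show resO h (f.app W a) = f.appLE W V h a by
    rw [Scheme.Hom.app_eq_appLE, resO_appLE], EndM.app_linear, h1, smul_zero]

lemma Stratification.isHorizontal_of_cover {ι : Type*} {U : X.Opens} (V : ι → X.Opens)
    (hV : ∀ i, V i ≤ U) (hU : U ≤ iSup V) {e : Γ(M, U)}
    (he : ∀ i, N.IsHorizontal (resM M (hV i) e)) : N.IsHorizontal e := by
  intro W h D hD
  refine TopCat.Sheaf.eq_of_locally_eq' ⟨M.presheaf, M.isSheaf⟩ (fun i ↦ W ⊓ V i) W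
    (fun i ↦ homOfLE inf_le_left) ?_ _ _ fun i ↦ ?_
  · intro x hx
    obtain ⟨i, hi⟩ := Opens.mem_iSup.mp (hU (h hx))
    exact Opens.mem_iSup.mpr ⟨i, hx, hi⟩
  · change resM M (inf_le_left : W ⊓ V i ≤ W) (N.apply D (resM M h e)) =
      resM M (inf_le_left : W ⊓ V i ≤ W) 0
    rw [N.resM_apply, map_zero, resM_resM,
      ← resM_resM M (hV i) (inf_le_right : W ⊓ V i ≤ V i) e]
    apply he i
    have : diffApply (diffRestr f (inf_le_left : W ⊓ V i ≤ W) D) le_rfl 1 =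
        resO (inf_le_left : W ⊓ V i ≤ W) (diffApply D le_rfl 1) := by
      have := D.1.app_res W (W ⊓ V i) le_rfl inf_le_left 1
      rw [map_one] at this
      exact this
    rw [this, hD, map_zero]

/-- The horizontal sections, as a family of `𝒪_S`-submodules of the pushforward `f_* M`. -/
def Stratification.horizontalSubmodule :
    PresheafOfModules.Submodule ((Scheme.Modules.pushforward f).obj M).val where
  obj W :=
    { carrier := {e | N.IsHorizontal (U := f ⁻¹ᵁ W.unop) e}
      add_mem' := fun ha hb ↦ ha.add N hb
      zero_mem' := N.isHorizontal_zero _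
      smul_mem' := fun c _ he ↦ he.smul N c }
  map i e he := he.res N _

lemma Stratification.isSheaf_horizontal :
    TopCat.Presheaf.IsSheaf N.horizontalSubmodule.toPresheafOfModules.presheaf := by
  rw [TopCat.Presheaf.isSheaf_iff_isSheafUniqueGluing]
  intro ι W sf hsf
  have hG : TopCat.Presheaf.IsSheaf ((Scheme.Modules.pushforward f).obj M).presheaf :=
    ((Scheme.Modules.pushforward f).obj M).isSheaf
  obtain ⟨s, hs, hs'⟩ := hG.isSheafUniqueGluing W (fun i ↦ (sf i).1)
    fun i j ↦ congrArg Subtype.val (hsf i j)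
  refine ⟨⟨s, ?_⟩, fun i ↦ Subtype.ext (hs i), fun t ht ↦ Subtype.ext ?_⟩
  · refine N.isHorizontal_of_cover (fun i ↦ f ⁻¹ᵁ W i) (fun i ↦ ?_) ?_ fun i ↦ ?_
    · exact fun x hx ↦ Opens.mem_iSup.mpr ⟨i, hx⟩
    · intro x hx
      obtain ⟨i, hi⟩ := Opens.mem_iSup.mp hx
      exact Opens.mem_iSup.mpr ⟨i, hi⟩
    · have h1 : ((Scheme.Modules.pushforward f).obj M).presheaf.map (Opens.leSupr W i).op s =
          (sf i).1 := hs i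
      have h2 := (sf i).2
      rw [← h1] at h2
      exact h2
  · exact hs' t.1 fun i ↦ congrArg Subtype.val (ht i)

/-- The `𝒪_S`-module `f_*(M^∇)`: its sections over `W` are the horizontal sections of `M`
over `f⁻¹(W)`. -/
def Stratification.pushforwardHorizontal : S.Modules :=
  (⟨N.horizontalSubmodule.toPresheafOfModules, N.isSheaf_horizontal⟩ :
    SheafOfModules S.ringCatSheaf)

/-- A section of `f_*(M^∇)` over `W`, as a section of `M` over `f⁻¹(W)`. -/
def Stratification.toSection {W : S.Opens} (e : Γ(N.pushforwardHorizontal, W)) :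
    Γ(M, f ⁻¹ᵁ W) :=
  Subtype.val (p := fun e ↦ N.IsHorizontal (U := f ⁻¹ᵁ W) e) e

end pushforward

section GaussManin

variable {f : X ⟶ S} {q : S ⟶ T}

/-- A differential operator `D` of `X/T` on `U` lifts a differential operator `D'` of `S/T` on `W`,
where `U` is contained in `f⁻¹(W)`, if `D(f^* a) = f^*(D'(a))` for all local functions `a` of `W`. -/
def IsLift {W : S.Opens} (D' : diffOp q W) {U : X.Opens} (D : diffOp (f ≫ q) U) : Prop :=
  ∀ (W' : S.Opens) (hW : W' ≤ W) (V : X.Opens) (hV : V ≤ U) (h : V ≤ f ⁻¹ᵁ W') (a : Γ(S, W')),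
    diffApply D hV (f.appLE W' V h a) = f.appLE W' V h (diffApply D' hW a)

/-- A stratification `N'` of `f_*(M^{∇_{X/S}})` relative to `S/T` is induced by the stratification
`N = ∇` of `M` relative to `X/T` if a differential operator of `S/T` acts on a horizontal section,
locally on `X`, through any of its lifts to a differential operator of `X/T`. -/
def IsInduced {M : X.Modules} (N : Stratification (f ≫ q) M)
    (N' : Stratification q N.relative.pushforwardHorizontal) : Prop :=
  ∀ (W : S.Opens) (D' : diffOp q W) (e : Γ(N.relative.pushforwardHorizontal, W))
    (U : X.Opens) (h : U ≤ f ⁻¹ᵁ W) (D : diffOp (f ≫ q) U), IsLift D' D →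
      resM M h (N.relative.toSection (N'.apply D' e)) =
        N.apply D (resM M h (N.relative.toSection e))

end GaussManin

end Strat

end

/-! Everything rests on étale coordinates. If a ring `A` is étale over a polynomial ring `C[x]`,
there is a Taylor homomorphism `A → A⟦ε⟧` with `x_i ↦ x_i + ε_i`, whose coefficients are the divided
power derivations `D^(β)` (`hasse`). A differential operator that vanishes on the image of a
formally unramified map is zero (`IsDiff.eq_zero_of_comp`), so operators are determined by their
values on monomials, and each one of finite order is a combination of the `D^(β)`
(`Coord.exists_expansion`). For `X → S → T`, joint coordinates give `D^(α,β) = D^(0,β) D^(α,0)`,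
where `D^(α,0)` is relative to `S` and `D^(0,β)` lifts `D^(β)` on `S`.

Part (i): operators on `S` lift locally. The difference of two lifts lifts zero; its expansion has
no terms with `α = 0`, so it annihilates relatively horizontal sections
(`apply_eq_zero_of_isLift_zero`). The action through a lift is therefore independent of the lift and
glues. Sums and products of lifts are lifts, which gives the stratification, and local existence of
lifts gives uniqueness.

Part (ii): over a field, the derivations `D^(β)` of a domain with étale coordinates have no
nontrivial stable ideals (`IsTaylor.isSimple`). Conductors between stable submodules are stable
ideals, so a finite module with a Leibniz action is torsion-free, and it is free at every prime
(`IsLeibniz.free_localization`). In particular sections of `E` obey an identity theorem. What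
remains is finiteness over the base and compatibility with localization, although `f` need be
neither proper nor quasi-compact.

For finiteness, functions killed by the relative derivations are algebraic over the base; normality
of `X` and `f_* O_X = O_S` make them fractions of functions on the base. Hence horizontal sections
independent over the base stay independent over `X` (`eq_zero_of_sum_smul_eq_zero`), which bounds
the rank. Denominators are bounded by stable ideals, which contain base functions, and divisibility
over the base is tested, by flatness, on finitely many open subsets of `X` meeting every fibre
(`FibreCover.dvd`, `FibreCover.finite_hor`). The action of the derivations of `S` then extends
horizontal sections from the union of these subsets to the full preimage (`exists_extend_preimage`),
which also yields the compatibility with localization. -/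

set_option linter.unusedSectionVars false

noncomputable section

namespace Strat

section

/-! ### Differential operators along a ring homomorphism -/

section IsDiff

variable {B A : Type*} [CommRing B] [CommRing A]

/-- The commutator `x ↦ D (b * x) - ψ b * D x`. -/
def comm (ψ : B →+* A) (D : B →+ A) (b : B) : B →+ A :=
  D.comp (AddMonoidHom.mulLeft b) - (AddMonoidHom.mulLeft (ψ b)).comp D

@[simp] lemma comm_apply (ψ : B →+* A) (D : B →+ A) (b x : B) :
    comm ψ D b x = D (b * x) - ψ b * D x := rfl

/-- An additive map `D : B → A` is a differential operator of order at most `n` along a ring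
homomorphism `ψ : B → A`. -/
def IsDiff (ψ : B →+* A) : ℕ → (B →+ A) → Prop
  | 0, D => ∀ b x, D (b * x) = ψ b * D x
  | n + 1, D => ∀ b, IsDiff ψ n (comm ψ D b)

variable {ψ : B →+* A}

lemma IsDiff.zero (n : ℕ) : IsDiff ψ n (0 : B →+ A) := by
  induction n with
  | zero => intro b x; simp
  | succ n ih => intro b; convert ih; ext; simp

lemma IsDiff.succ {n : ℕ} {D : B →+ A} (h : IsDiff ψ n D) : IsDiff ψ (n + 1) D := by
  induction n generalizing D with
  | zero =>
    intro b
    convert IsDiff.zero (ψ := ψ) 0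
    ext x
    simp [h b x]
  | succ n ih => exact fun b ↦ ih (h b)

lemma IsDiff.mono {m n : ℕ} (hmn : m ≤ n) {D : B →+ A} (h : IsDiff ψ m D) : IsDiff ψ n D := by
  induction hmn with
  | refl => exact h
  | step _ ih => exact ih.succ

lemma IsDiff.add {n : ℕ} {D D' : B →+ A} (h : IsDiff ψ n D) (h' : IsDiff ψ n D') :
    IsDiff ψ n (D + D') := by
  induction n generalizing D D' with
  | zero => intro b x; simp [h b x, h' b x, mul_add]
  | succ n ih =>
    intro b
    convert ih (h b) (h' b) using 1
    ext x
    simp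
    ring

lemma IsDiff.mulLeft {n : ℕ} {D : B →+ A} (h : IsDiff ψ n D) (a : A) :
    IsDiff ψ n ((AddMonoidHom.mulLeft a).comp D) := by
  induction n generalizing D with
  | zero => intro b x; simp [h b x]; ring
  | succ n ih =>
    intro b
    convert ih (h b) using 1
    ext x
    simp
    ring

lemma IsDiff.sub {n : ℕ} {D D' : B →+ A} (h : IsDiff ψ n D) (h' : IsDiff ψ n D') :
    IsDiff ψ n (D - D') := by
  convert h.add (h'.mulLeft (-1)) using 1
  ext x
  simp [sub_eq_add_neg]

lemma IsDiff.sum {n : ℕ} {ι : Type*} (s : Finset ι) (D : ι → B →+ A)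
    (h : ∀ i ∈ s, IsDiff ψ n (D i)) : IsDiff ψ n (∑ i ∈ s, D i) := by
  classical
  induction s using Finset.induction_on with
  | empty => exact IsDiff.zero n
  | insert i s his ih =>
    rw [Finset.sum_insert his]
    exact (h i (Finset.mem_insert_self _ _)).add
      (ih fun j hj ↦ h j (Finset.mem_insert_of_mem hj))

lemma isDiff_smul_hom (n : ℕ) (a : A) :
    IsDiff ψ n ((AddMonoidHom.mulLeft a).comp ψ.toAddMonoidHom) :=
  IsDiff.mono n.zero_le (by intro b x; simp; ring)

lemma IsDiff.comp_ringHom {B' : Type*} [CommRing B'] {n : ℕ} {D : B →+ A} (h : IsDiff ψ n D)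
    (θ : B' →+* B) : IsDiff (ψ.comp θ) n (D.comp θ.toAddMonoidHom) := by
  induction n generalizing D with
  | zero => intro b x; simp [h (θ b) (θ x)]
  | succ n ih =>
    intro b
    convert ih (h (θ b)) using 1
    ext x
    simp

lemma IsDiff.ringHom_comp {A' : Type*} [CommRing A'] {n : ℕ} {D : B →+ A} (h : IsDiff ψ n D)
    (θ : A →+* A') : IsDiff (θ.comp ψ) n (θ.toAddMonoidHom.comp D) := by
  induction n generalizing D with
  | zero => intro b x; simp [h b x]
  | succ n ih =>
    intro b
    convert ih (h b) using 1
    ext x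
    simp

/-- Induction on the total order through `[DD', b] = D[D', b] + [D, ψ b]D'`; a factor of order zero
has zero commutator, which settles `m = 0` and `n = 0`. -/
lemma IsDiff.comp {m n : ℕ} {D : A →+ A} {D' : B →+ A} (h : IsDiff (RingHom.id A) m D)
    (h' : IsDiff ψ n D') : IsDiff ψ (m + n) (D.comp D') := by
  obtain ⟨N, hN⟩ : ∃ N, m + n = N := ⟨_, rfl⟩
  induction N generalizing m n D D' with
  | zero =>
    obtain ⟨rfl, rfl⟩ : m = 0 ∧ n = 0 := by omega
    intro b x
    simp [h' b x, h (ψ b) (D' x)]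
  | succ N ih =>
    rw [hN]
    intro b
    have key : comm ψ (D.comp D') b =
        D.comp (comm ψ D' b) + (comm (RingHom.id A) D (ψ b)).comp D' := by
      ext x
      simp
    rw [key]
    apply IsDiff.add
    · cases n with
      | zero =>
        convert IsDiff.zero (ψ := ψ) N
        ext x
        simp [h' b x]
      | succ n =>
        have := ih h (h' b) (by omega)
        rwa [show m + n = N by omega] at this
    · cases m with
      | zero =>
        convert IsDiff.zero (ψ := ψ) N
        ext x
        have := h (ψ b) (D' x)
        simp only [RingHom.id_apply] at this
        simp [this]
      | succ m =>
        have := ih (h (ψ b)) h' (by omega)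
        rwa [show m + n = N by omega] at this

/-- The operator `[D, b] - D(b)ψ` has lower order, is linear and kills `1`, so it vanishes by
induction. Thus `D` is a derivation over `R`, and formal unramifiedness makes the Kähler
differentials zero. -/
lemma IsDiff.eq_zero_of_linear {R : Type*} [CommRing R] (j : R →+* B)
    (hj : j.FormallyUnramified) {n : ℕ} {D : B →+ A} (h : IsDiff ψ n D)
    (hlin : ∀ r x, D (j r * x) = ψ (j r) * D x) (h1 : D 1 = 0) : D = 0 := by
  induction n generalizing D with
  | zero =>
    ext x
    have := h x 1
    rw [mul_one, h1, mul_zero] at this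
    exact this
  | succ n ih =>
    have key : ∀ b x, D (b * x) = ψ b * D x + ψ x * D b := by
      intro b x
      have hz := ih (D := comm ψ D b - (AddMonoidHom.mulLeft (D b)).comp ψ.toAddMonoidHom)
        ((h b).sub (isDiff_smul_hom n (D b))) (fun r x ↦ by
          simp only [AddMonoidHom.sub_apply, comm_apply, AddMonoidHom.comp_apply,
            AddMonoidHom.coe_mulLeft, RingHom.toAddMonoidHom_eq_coe, AddMonoidHom.coe_coe,
            map_mul]
          rw [mul_left_comm, hlin, hlin]
          ring) (by simp [h1])
      have := DFunLike.congr_fun hz x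
      simp only [AddMonoidHom.sub_apply, comm_apply, AddMonoidHom.comp_apply,
            AddMonoidHom.coe_mulLeft, RingHom.toAddMonoidHom_eq_coe, AddMonoidHom.coe_coe,
            AddMonoidHom.zero_apply] at this
      linear_combination this
    algebraize [j, ψ, ψ.comp j]
    have : Algebra.FormallyUnramified R B := hj
    let δ : Derivation R B A := Derivation.mk'
      { toFun := D
        map_add' := map_add D
        map_smul' := fun r x ↦ by
          simp only [Algebra.smul_def]
          exact hlin r x } (fun a b ↦ by
          simp only [Algebra.smul_def]
          exact key a b)
    ext x
    have hx := δ.liftKaehlerDifferential_comp_D x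
    rw [Subsingleton.elim (KaehlerDifferential.D R B x) 0, map_zero] at hx
    exact hx.symm

/-- A differential operator vanishing on the image of a formally unramified homomorphism is
zero. -/
lemma IsDiff.eq_zero_of_comp {R : Type*} [CommRing R] (j : R →+* B)
    (hj : j.FormallyUnramified) {n : ℕ} {D : B →+ A} (h : IsDiff ψ n D)
    (hD : ∀ r, D (j r) = 0) : D = 0 := by
  induction n generalizing D with
  | zero =>
    ext x
    have := h x 1
    rw [mul_one, ← map_one j, hD, mul_zero] at this
    exact this
  | succ n ih =>
    refine IsDiff.eq_zero_of_linear j hj h (fun r x ↦ ?_) (by rw [← map_one j, hD])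
    -- The commutator with `j r` has smaller order and still vanishes on the image of `j`, hence is
    -- zero: this is linearity over `R`.
    have := DFunLike.congr_fun (ih (h (j r)) (fun r' ↦ by simp [← map_mul, hD])) x
    simpa [sub_eq_zero] using this

end IsDiff

end

section

/-! ### Taylor expansion and divided power derivations in étale coordinates -/

section Taylor

variable {C A σ : Type*} [CommRing C] [CommRing A]

/-- A Taylor homomorphism for the coordinates `x : σ → A` of the `C`-algebra `A`: a section of the
augmentation of `A⟦ε⟧` which is constant on `C` and sends `x i` to `x i + ε i`. -/
structure IsTaylor (ι : C →+* A) (x : σ → A) (τ : A →+* MvPowerSeries σ A) : Prop where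
  constantCoeff (a : A) : MvPowerSeries.constantCoeff (τ a) = a
  const (c : C) : τ (ι c) = MvPowerSeries.C (ι c)
  coord (i : σ) : τ (x i) = MvPowerSeries.C (x i) + MvPowerSeries.X i

/-- The polynomial homomorphism given by a base ring and coordinates. -/
abbrev polyHom (ι : C →+* A) (x : σ → A) : MvPolynomial σ C →+* A := MvPolynomial.eval₂Hom ι x

lemma exists_lift_of_formallyEtale {P B : Type*} [CommRing P] [CommRing B] (φ : P →+* A)
    (h : φ.FormallyEtale) (θ : P →+* B) (I : Ideal B) [IsAdicComplete I B] (F : A →+* B ⧸ I)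
    (hF : F.comp φ = (Ideal.Quotient.mk I).comp θ) :
    ∃ g : A →+* B, (∀ p, g (φ p) = θ p) ∧ ∀ a, Ideal.Quotient.mk I (g a) = F a := by
  algebraize [φ, θ]
  have h' : Algebra.FormallyEtale P A := h
  let F' : A →ₐ[P] B ⧸ I :=
    { toRingHom := F
      commutes' := fun p ↦ DFunLike.congr_fun hF p }
  obtain ⟨g, hg⟩ := Algebra.FormallySmooth.exists_mkₐ_comp_eq_of_isAdicComplete F'
  exact ⟨g, fun p ↦ g.commutes p, fun a ↦ DFunLike.congr_fun hg a⟩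

/-- Modulo the ideal `(ε)` the constant embedding of `A` agrees on polynomials with `x_i ↦ x_i +
ε_i`. Since `A⟦ε⟧` is `(ε)`-adically complete, it lifts through the formally étale map. -/
lemma exists_isTaylor [Finite σ] (ι : C →+* A) (x : σ → A) (h : (polyHom ι x).FormallyEtale) :
    ∃ τ : A →+* MvPowerSeries σ A, IsTaylor ι x τ := by
  let θ : MvPolynomial σ C →+* MvPowerSeries σ A :=
    MvPolynomial.eval₂Hom (MvPowerSeries.C.comp ι) fun i ↦ MvPowerSeries.C (x i) + MvPowerSeries.X i
  let I : Ideal (MvPowerSeries σ A) := .span (.range MvPowerSeries.X)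
  have hθ : (Ideal.Quotient.mk I).comp (MvPowerSeries.C.comp (polyHom ι x)) =
      (Ideal.Quotient.mk I).comp θ := by
    apply MvPolynomial.ringHom_ext
    · intro r; simp [θ, polyHom]
    · intro i
      simp only [θ, polyHom, RingHom.comp_apply, MvPolynomial.coe_eval₂Hom, MvPolynomial.eval₂_X,
        map_add, left_eq_add]
      exact Ideal.Quotient.eq_zero_iff_mem.mpr (Ideal.subset_span ⟨i, rfl⟩)
  obtain ⟨g, hgp, hg⟩ := exists_lift_of_formallyEtale (polyHom ι x) h θ I
    ((Ideal.Quotient.mk I).comp MvPowerSeries.C) hθ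
  refine ⟨g, ?_, ?_, ?_⟩
  · intro a
    have h1 : Ideal.Quotient.mk I (g a) = Ideal.Quotient.mk I (MvPowerSeries.C a) :=
      hg a
    rw [Ideal.Quotient.eq] at h1
    have h2 : I ≤ RingHom.ker (MvPowerSeries.constantCoeff (σ := σ) (R := A)) := by
      rw [Ideal.span_le]
      rintro _ ⟨i, rfl⟩
      simp
    have h3 := h2 h1
    rw [RingHom.mem_ker, map_sub, sub_eq_zero] at h3
    simpa using h3
  · intro c
    simpa [polyHom, θ] using hgp (MvPolynomial.C c)
  · intro i
    simpa [polyHom, θ] using hgp (MvPolynomial.X i)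

/-- The divided power derivations attached to a Taylor homomorphism. -/
def hasse (τ : A →+* MvPowerSeries σ A) (β : σ →₀ ℕ) : A →+ A :=
  (MvPowerSeries.coeff β).toAddMonoidHom.comp τ.toAddMonoidHom

lemma hasse_apply (τ : A →+* MvPowerSeries σ A) (β : σ →₀ ℕ) (a : A) :
    hasse τ β a = MvPowerSeries.coeff β (τ a) := rfl

lemma hasse_mul [DecidableEq σ] (τ : A →+* MvPowerSeries σ A) (β : σ →₀ ℕ) (a b : A) :
    hasse τ β (a * b) = ∑ p ∈ Finset.HasAntidiagonal.antidiagonal β, hasse τ p.1 a * hasse τ p.2 b := by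
  simp only [hasse_apply, map_mul, MvPowerSeries.coeff_mul]

namespace IsTaylor

variable {ι : C →+* A} {x : σ → A} {τ : A →+* MvPowerSeries σ A}

lemma hasse_zero (h : IsTaylor ι x τ) (a : A) : hasse τ 0 a = a := by
  rw [hasse_apply, MvPowerSeries.coeff_zero_eq_constantCoeff_apply, h.constantCoeff]

lemma hasse_const_mul (h : IsTaylor ι x τ) (β : σ →₀ ℕ) (c : C) (a : A) :
    hasse τ β (ι c * a) = ι c * hasse τ β a := by
  simp [hasse_apply, h.const]

lemma hasse_one (h : IsTaylor ι x τ) {β : σ →₀ ℕ} (hβ : β ≠ 0) : hasse τ β 1 = 0 := by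
  classical
  rw [hasse_apply, map_one, MvPowerSeries.coeff_one, if_neg hβ]

/-- The Leibniz rule, with the leading terms separated. -/
lemma hasse_mul_sub (h : IsTaylor ι x τ) [DecidableEq σ] (β : σ →₀ ℕ) (a b : A) :
    hasse τ β (a * b) - a * hasse τ β b =
      ∑ p ∈ (Finset.HasAntidiagonal.antidiagonal β).erase (0, β), hasse τ p.1 a * hasse τ p.2 b := by
  rw [hasse_mul, ← Finset.add_sum_erase _ _ (show (0, β) ∈ Finset.HasAntidiagonal.antidiagonal β by simp),
    h.hasse_zero, add_sub_cancel_left]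

/-- By the Leibniz rule the commutator of `D^(β)` with a function is a combination of `D^(γ)` with
`γ` of strictly smaller degree. -/
lemma isDiff_hasse (h : IsTaylor ι x τ) (β : σ →₀ ℕ) :
    IsDiff (RingHom.id A) β.degree (hasse τ β) := by
  classical
  obtain ⟨n, hn⟩ : ∃ n, β.degree ≤ n := ⟨_, le_rfl⟩
  obtain ⟨m, hm⟩ : ∃ m, β.degree = m := ⟨_, rfl⟩
  rw [hm]
  induction n generalizing β m with
  | zero =>
    have hβ : β = 0 := by
      rw [← Finsupp.degree_eq_zero_iff]; omega
    subst hβ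
    exact IsDiff.mono (Nat.zero_le _) (fun b y ↦ by simp [h.hasse_zero])
  | succ n ih =>
    cases m with
    | zero =>
      have hβ : β = 0 := by
        rw [← Finsupp.degree_eq_zero_iff]; omega
      subst hβ
      exact fun b y ↦ by simp [h.hasse_zero]
    | succ m =>
      intro b
      have key : comm (RingHom.id A) (hasse τ β) b =
          ∑ p ∈ (Finset.HasAntidiagonal.antidiagonal β).erase (0, β),
            (AddMonoidHom.mulLeft (hasse τ p.1 b)).comp (hasse τ p.2) := by
        ext y
        rw [AddMonoidHom.finsetSum_apply]
        exact h.hasse_mul_sub β b y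
      rw [key]
      refine IsDiff.sum _ _ fun p hp ↦ IsDiff.mulLeft ?_ _
      rw [Finset.mem_erase, Finset.HasAntidiagonal.mem_antidiagonal] at hp
      have h1 : p.1.degree + p.2.degree = m + 1 := by rw [← hm, ← hp.2, map_add]
      have h2 : p.1.degree ≠ 0 := by
        intro h0
        rw [Finsupp.degree_eq_zero_iff] at h0
        apply hp.1
        ext1
        · exact h0
        · rw [← hp.2, h0, zero_add]
      exact IsDiff.mono (by omega) (ih p.2 (by omega) _ rfl)

/-- Comes from `τ (x i) = x i + ε i`; it is the recursion that becomes Pascal's rule on monomials.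
-/
lemma hasse_mul_coord (h : IsTaylor ι x τ) (β : σ →₀ ℕ) (a : A) (i : σ) :
    hasse τ β (a * x i) = hasse τ β a * x i +
      if Finsupp.single i 1 ≤ β then hasse τ (β - Finsupp.single i 1) a else 0 := by
  classical
  rw [hasse_apply, map_mul, h.coord, mul_add, map_add, MvPowerSeries.coeff_mul_C,
    MvPowerSeries.X, MvPowerSeries.coeff_mul_monomial]
  simp only [mul_one, hasse_apply]

variable [Fintype σ]

/-- The values of the divided power derivations on monomials. -/
lemma hasse_monomial (h : IsTaylor ι x τ) (β b : σ →₀ ℕ) :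
    hasse τ β (∏ i, x i ^ b i) =
      ((∏ i, (b i).choose (β i) : ℕ) : A) * ∏ i, x i ^ (b i - β i) := by
  classical
  obtain ⟨n, hn⟩ : ∃ n, b.degree = n := ⟨_, rfl⟩
  induction n generalizing b β with
  | zero =>
    rw [Finsupp.degree_eq_zero_iff] at hn
    subst hn
    by_cases hβ : β = 0
    · subst hβ; simp [h.hasse_zero]
    · obtain ⟨i, hi⟩ := Finsupp.ne_iff.mp hβ
      obtain ⟨k, hk⟩ := Nat.exists_eq_succ_of_ne_zero hi
      have h0 : ∏ i, ((0 : σ →₀ ℕ) i).choose (β i) = 0 :=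
        Finset.prod_eq_zero (i := i) (Finset.mem_univ _) (by simp [hk])
      rw [h0]
      simpa using h.hasse_one hβ
  | succ n ih =>
    obtain ⟨j, hj⟩ : ∃ j, b j ≠ 0 := by
      by_contra! hb
      have : b = 0 := Finsupp.ext hb
      simp [this] at hn
    obtain ⟨b', rfl⟩ : ∃ b', b = b' + Finsupp.single j 1 :=
      ⟨b - Finsupp.single j 1, (tsub_add_cancel_of_le (by
        rw [Finsupp.single_le_iff]; omega)).symm⟩
    have hb' : b'.degree = n := by simpa [map_add] using hn
    have hmono : ∏ i, x i ^ (b' + (Finsupp.single j 1 : σ →₀ ℕ)) i = (∏ i, x i ^ b' i) * x j := by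
      simp only [Finsupp.add_apply, pow_add, Finset.prod_mul_distrib, Finsupp.single_apply]
      congr 1
      rw [Finset.prod_eq_single j]
      · simp
      · intro i _ hij; simp [hij.symm]
      · simp
    have e1 (f : σ → A) : ∏ i, f i = f j * ∏ i ∈ Finset.univ.erase j, f i :=
      (Finset.mul_prod_erase _ _ (Finset.mem_univ j)).symm
    have e2 (f : σ → ℕ) : ∏ i, f i = f j * ∏ i ∈ Finset.univ.erase j, f i :=
      (Finset.mul_prod_erase _ _ (Finset.mem_univ j)).symm
    have hne : ∀ i ∈ Finset.univ.erase j, (Finsupp.single j 1 : σ →₀ ℕ) i = 0 := by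
      intro i hi
      rw [Finset.mem_erase] at hi
      simp [hi.1.symm]
    have c1 : ∏ i ∈ Finset.univ.erase j, ((b' + (Finsupp.single j 1 : σ →₀ ℕ)) i).choose (β i) =
        ∏ i ∈ Finset.univ.erase j, (b' i).choose (β i) :=
      Finset.prod_congr rfl fun i hi ↦ by simp [hne i hi]
    have c2 : ∏ i ∈ Finset.univ.erase j, x i ^ ((b' + (Finsupp.single j 1 : σ →₀ ℕ)) i - β i) =
        ∏ i ∈ Finset.univ.erase j, x i ^ (b' i - β i) :=
      Finset.prod_congr rfl fun i hi ↦ by simp [hne i hi]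
    have c3 : ∏ i ∈ Finset.univ.erase j, (b' i).choose ((β - (Finsupp.single j 1 : σ →₀ ℕ)) i) =
        ∏ i ∈ Finset.univ.erase j, (b' i).choose (β i) :=
      Finset.prod_congr rfl fun i hi ↦ by simp [hne i hi]
    have c4 : ∏ i ∈ Finset.univ.erase j, x i ^ (b' i - (β - (Finsupp.single j 1 : σ →₀ ℕ)) i) =
        ∏ i ∈ Finset.univ.erase j, x i ^ (b' i - β i) :=
      Finset.prod_congr rfl fun i hi ↦ by simp [hne i hi]
    rw [hmono, h.hasse_mul_coord, ih β b' hb', ih _ b' hb', e1, e2,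
      e1 (fun i ↦ x i ^ (b' i - (β - (Finsupp.single j 1 : σ →₀ ℕ)) i)),
      e2 (fun i ↦ (b' i).choose ((β - (Finsupp.single j 1 : σ →₀ ℕ)) i)),
      e1 (fun i ↦ x i ^ ((b' + (Finsupp.single j 1 : σ →₀ ℕ)) i - β i)),
      e2 (fun i ↦ ((b' + (Finsupp.single j 1 : σ →₀ ℕ)) i).choose (β i)), c1, c2, c3, c4]
    generalize ∏ i ∈ Finset.univ.erase j, (b' i).choose (β i) = P
    generalize ∏ i ∈ Finset.univ.erase j, x i ^ (b' i - β i) = Q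
    simp only [Finsupp.add_apply, Finsupp.single_eq_same, Finsupp.coe_tsub, Pi.sub_apply,
      Finsupp.single_le_iff, Nat.cast_mul]
    generalize b' j = p
    generalize β j = r
    cases r with
    | zero => simp; ring
    | succ r =>
      simp only [le_add_iff_nonneg_left, zero_le, if_true, Nat.choose_succ_succ, Nat.cast_add,
        Nat.add_sub_add_right, add_tsub_cancel_right]
      -- The exponent `p - (r + 1)` is truncated. When `p < r + 1` its term has a zero binomial
      -- coefficient; otherwise the two powers differ by exactly one factor.
      rcases lt_or_ge p (r + 1) with hpr | hpr
      · rw [Nat.choose_eq_zero_of_lt hpr]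
        simp
      · obtain ⟨d, rfl⟩ := Nat.exists_eq_add_of_le hpr
        rw [show r + 1 + d - (r + 1) = d by omega, show r + 1 + d - r = d + 1 by omega]
        ring

lemma hasse_monomial_self (h : IsTaylor ι x τ) (β : σ →₀ ℕ) :
    hasse τ β (∏ i, x i ^ β i) = 1 := by
  simp [h.hasse_monomial]

lemma hasse_monomial_of_not_le (h : IsTaylor ι x τ) {β b : σ →₀ ℕ} (hb : ¬ β ≤ b) :
    hasse τ β (∏ i, x i ^ b i) = 0 := by
  rw [Finsupp.le_def] at hb
  push Not at hb
  obtain ⟨i, hi⟩ := hb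
  rw [h.hasse_monomial, Finset.prod_eq_zero (i := i) (Finset.mem_univ _)
    (Nat.choose_eq_zero_of_lt hi)]
  simp

/-- The triangularity by which coefficients of operators and of polynomials are read off in top
degree: `β ≤ b` together with `|b| ≤ |β|` forces `b = β`. -/
lemma hasse_monomial_of_degree_le (h : IsTaylor ι x τ) {β b : σ →₀ ℕ}
    (hb : b.degree ≤ β.degree) (hne : β ≠ b) : hasse τ β (∏ i, x i ^ b i) = 0 := by
  refine h.hasse_monomial_of_not_le fun hle ↦ hne ?_
  obtain ⟨c, rfl⟩ := exists_add_of_le hle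
  have : c = 0 := by
    rw [← Finsupp.degree_eq_zero_iff]
    rw [map_add] at hb
    omega
  simp [this]

end IsTaylor

end Taylor

end

section

/-! ### Expansion of differential operators through their values on monomials -/

section Expansion

variable {C B A σ : Type*} [CommRing C] [CommRing B] [CommRing A] [Fintype σ]

lemma polyHom_monomial (ι : C →+* B) (x : σ → B) (b : σ →₀ ℕ) (c : C) :
    polyHom ι x (MvPolynomial.monomial b c) = ι c * ∏ i, x i ^ b i := by
  simp [polyHom, MvPolynomial.eval₂_monomial, Finsupp.prod_fintype]

/-- A differential operator vanishing on all monomials in étale coordinates is zero. -/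
lemma IsDiff.eq_zero_of_monomial {ψ : B →+* A} (ι : C →+* B) (x : σ → B)
    (hx : (polyHom ι x).FormallyUnramified) {n : ℕ} {D : B →+ A} (h : IsDiff ψ n D)
    (hD : ∀ (c : C) (b : σ →₀ ℕ), D (ι c * ∏ i, x i ^ b i) = 0) : D = 0 := by
  refine h.eq_zero_of_comp _ hx fun r ↦ ?_
  induction r using MvPolynomial.induction_on' with
  | monomial b c => rw [polyHom_monomial, hD]
  | add p q hp hq => rw [map_add, map_add, hp, hq, add_zero]

/-- A differential operator of order at most `n` vanishing on the monomials of degree at most `n`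
vanishes on all monomials. -/
lemma IsDiff.monomial_eq_zero {ψ : B →+* A} (x : σ → B) {n : ℕ} {D : B →+ A} (h : IsDiff ψ n D)
    (hD : ∀ b : σ →₀ ℕ, b.degree ≤ n → D (∏ i, x i ^ b i) = 0) (b : σ →₀ ℕ) :
    D (∏ i, x i ^ b i) = 0 := by
  classical
  induction n generalizing D b with
  | zero =>
    have h0 : D 1 = 0 := by simpa using hD 0 (by simp)
    have := h (∏ i, x i ^ b i) 1
    rwa [mul_one, h0, mul_zero] at this
  | succ n ih =>
    have hx (j : σ) (b : σ →₀ ℕ) :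
        x j * ∏ i, x i ^ b i = ∏ i, x i ^ (b + (Finsupp.single j 1 : σ →₀ ℕ)) i := by
      simp only [Finsupp.add_apply, pow_add, Finset.prod_mul_distrib, Finsupp.single_apply]
      rw [mul_comm]
      congr 1
      rw [Finset.prod_eq_single j]
      · simp
      · intro i _ hij; simp [hij.symm]
      · simp
    -- The commutator with `x j` has order at most `n` and vanishes on monomials of degree at most
    -- `n`, hence on all of them. So `D` commutes with `x j` on monomials and variables can be
    -- peeled off one at a time.
    have key (j : σ) (b : σ →₀ ℕ) : D (x j * ∏ i, x i ^ b i) = ψ (x j) * D (∏ i, x i ^ b i) := by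
      have := ih (h (x j)) (fun b hb ↦ by
        rw [comm_apply, hx, hD _ (by simp; omega), hD _ (by omega), mul_zero, sub_zero]) b
      rwa [comm_apply, sub_eq_zero] at this
    obtain ⟨m, hm⟩ : ∃ m, b.degree = m := ⟨_, rfl⟩
    induction m generalizing b with
    | zero => exact hD b (by omega)
    | succ m ihm =>
      obtain ⟨j, hj⟩ : ∃ j, b j ≠ 0 := by
        by_contra! hb
        have : b = 0 := Finsupp.ext hb
        simp [this] at hm
      obtain ⟨b', rfl⟩ : ∃ b', b = b' + Finsupp.single j 1 :=
        ⟨b - Finsupp.single j 1, (tsub_add_cancel_of_le (by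
          rw [Finsupp.single_le_iff]; omega)).symm⟩
      rw [← hx, key, ihm b' (by simpa [map_add] using hm), mul_zero]

lemma finite_degree_le (n : ℕ) : {b : σ →₀ ℕ | b.degree ≤ n}.Finite :=
  Finsupp.finite_of_degree_le n

variable (σ) in
/-- The multi-indices of degree at most `n`. -/
def indices (n : ℕ) : Finset (σ →₀ ℕ) := (finite_degree_le n).toFinset

@[simp] lemma mem_indices {n : ℕ} {b : σ →₀ ℕ} : b ∈ indices σ n ↔ b.degree ≤ n := by
  simp [indices]

variable {ι : C →+* A} {x : σ → A} {τ : A →+* MvPowerSeries σ A}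

/-- Approximation of an additive map on monomials of bounded degree by a combination of divided
power derivations. -/
lemma IsTaylor.exists_approx (h : IsTaylor ι x τ) (D : A →+ A) (P : (σ →₀ ℕ) → Prop)
    (hP : ∀ b b', b ≤ b' → P b' → P b) (hDP : ∀ b, P b → D (∏ i, x i ^ b i) = 0) (n : ℕ) :
    ∃ c : (σ →₀ ℕ) → A, (∀ b, P b → c b = 0) ∧ ∀ b : σ →₀ ℕ, b.degree ≤ n →
      D (∏ i, x i ^ b i) = ∑ β ∈ indices σ n, c β * hasse τ β (∏ i, x i ^ b i) := by
  classical
  induction n with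
  | zero =>
    refine ⟨fun β ↦ D (∏ i, x i ^ β i), hDP, fun b hb ↦ ?_⟩
    have hb0 : b = 0 := by rw [← Finsupp.degree_eq_zero_iff]; omega
    subst hb0
    rw [Finset.sum_eq_single 0]
    · simp [h.hasse_zero]
    · intro β hβ hne
      rw [mem_indices, Nat.le_zero, Finsupp.degree_eq_zero_iff] at hβ
      exact absurd hβ hne
    · simp
  | succ n ih =>
    obtain ⟨c, hcP, hc⟩ := ih
    -- In degree `n + 1` the matrix of the `D^(β)` on monomials is the identity, so the new
    -- coefficient at `β` is the defect of the previous approximation on `x^β`. The defect is zero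
    -- on `P` because `P` is closed downwards.
    let c' : (σ →₀ ℕ) → A := fun β ↦ if β.degree ≤ n then c β else
      D (∏ i, x i ^ β i) - ∑ γ ∈ indices σ n, c γ * hasse τ γ (∏ i, x i ^ β i)
    refine ⟨c', fun b hb ↦ ?_, fun b hb ↦ ?_⟩
    · simp only [c']
      split_ifs with hd
      · exact hcP b hb
      · rw [hDP b hb, zero_sub, neg_eq_zero]
        refine Finset.sum_eq_zero fun γ _ ↦ ?_
        by_cases hγ : γ ≤ b
        · rw [hcP γ (hP _ _ hγ hb), zero_mul]
        · rw [h.hasse_monomial_of_not_le hγ, mul_zero]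
    · have hsub : indices σ n ⊆ indices σ (n + 1) := by
        intro γ hγ
        rw [mem_indices] at hγ ⊢
        omega
      rw [← Finset.sum_sdiff hsub]
      have h1 : ∑ β ∈ indices σ n, c' β * hasse τ β (∏ i, x i ^ b i) =
          ∑ β ∈ indices σ n, c β * hasse τ β (∏ i, x i ^ b i) :=
        Finset.sum_congr rfl fun β hβ ↦ by
          simp only [c', if_pos (mem_indices.mp hβ)]
      rw [h1]
      have h2 : ∑ β ∈ indices σ (n + 1) \ indices σ n, c' β * hasse τ β (∏ i, x i ^ b i) =
          if b.degree = n + 1 then c' b else 0 := by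
        split_ifs with hbd
        · rw [Finset.sum_eq_single b]
          · rw [h.hasse_monomial_self, mul_one]
          · intro β hβ hne
            simp only [Finset.mem_sdiff, mem_indices] at hβ
            rw [h.hasse_monomial_of_degree_le (by omega) hne, mul_zero]
          · intro hb'
            simp only [Finset.mem_sdiff, mem_indices] at hb'
            omega
        · refine Finset.sum_eq_zero fun β hβ ↦ ?_
          simp only [Finset.mem_sdiff, mem_indices] at hβ
          rw [h.hasse_monomial_of_degree_le (by omega) (by rintro rfl; omega), mul_zero]
      rw [h2]
      split_ifs with hbd
      · simp only [c', if_neg (show ¬ b.degree ≤ n by omega)]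
        ring
      · rw [zero_add]
        exact hc b (by omega)

end Expansion

end

section

/-! ### Stable ideals and modules with a Leibniz action -/

section Algebraic

variable {P A : Type*} [CommRing P] [IsDomain P] [CommRing A]

lemma injective_of_flat [Nontrivial A] {φ : P →+* A} (h : φ.Flat) : Function.Injective φ := by
  algebraize [φ]
  have := Module.Flat.isTorsionFree (R := P) (M := A)
  exact FaithfulSMul.algebraMap_injective P A

/-- The étale algebra `Frac P ⊗ A` is finite over `Frac P`, and `A` embeds in it by flatness. -/
lemma isAlgebraic_of_etale {φ : P →+* A} (h : φ.Etale) (a : A) :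
    ∃ p : Polynomial P, p ≠ 0 ∧ p.eval₂ φ a = 0 := by
  algebraize [φ]
  have : Module.Finite (FractionRing P) (TensorProduct P (FractionRing P) A) :=
    Algebra.FormallyUnramified.finite_of_free _ _
  have h1 : IsAlgebraic (FractionRing P) ((1 : FractionRing P) ⊗ₜ[P] a) :=
    (Algebra.IsIntegral.isIntegral _).isAlgebraic
  rw [← IsFractionRing.isAlgebraic_iff P] at h1
  have h2 : Function.Injective
      (Algebra.TensorProduct.includeRight : A →ₐ[P] TensorProduct P (FractionRing P) A) :=
    Algebra.TensorProduct.includeRight_injective (IsFractionRing.injective _ _)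
  obtain ⟨p, hp, hp'⟩ := (isAlgebraic_algHom_iff _ h2).mp h1
  exact ⟨p, hp, hp'⟩

end Algebraic

section Simple

variable {C A σ : Type*} [CommRing C] [CommRing A] [Fintype σ]
  {ι : C →+* A} {x : σ → A} {τ : A →+* MvPowerSeries σ A}

namespace IsTaylor

/-- The leading coefficients of a polynomial in the coordinates are obtained by derivation. -/
lemma hasse_polyHom (h : IsTaylor ι x τ) {β : σ →₀ ℕ} {p : MvPolynomial σ C}
    (hp : p.totalDegree ≤ β.degree) : hasse τ β (polyHom ι x p) = ι (p.coeff β) := by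
  classical
  conv_lhs => rw [← p.support_sum_monomial_coeff]
  rw [map_sum, map_sum, Finset.sum_eq_single β]
  · rw [polyHom_monomial, h.hasse_const_mul, h.hasse_monomial_self, mul_one]
  · intro b hb hne
    rw [polyHom_monomial, h.hasse_const_mul, h.hasse_monomial_of_degree_le _ hne.symm, mul_zero]
    refine le_trans ?_ hp
    exact MvPolynomial.le_totalDegree hb
  · intro hb
    rw [MvPolynomial.notMem_support_iff.mp hb]
    simp

lemma exists_coeff_ne_zero {p : MvPolynomial σ C} (hp : p ≠ 0) :
    ∃ β : σ →₀ ℕ, β.degree = p.totalDegree ∧ p.coeff β ≠ 0 := by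
  obtain ⟨β, hβ, h⟩ := Finset.exists_mem_eq_sup p.support
    (MvPolynomial.support_nonempty.mpr hp) (fun b ↦ b.degree)
  refine ⟨β, ?_, MvPolynomial.mem_support_iff.mp hβ⟩
  rw [← h]
  rfl

/-- A nonzero ideal stable under the derivations in the coordinates contains a nonzero constant. -/
lemma exists_const_mem [IsDomain C] [IsDomain A] (h : IsTaylor ι x τ) (he : (polyHom ι x).Etale)
    {I : Ideal A} (hI : I ≠ ⊥) (hs : ∀ β, ∀ a ∈ I, hasse τ β a ∈ I) :
    ∃ c : C, c ≠ 0 ∧ ι c ∈ I := by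
  obtain ⟨a, ha, ha0⟩ := Submodule.exists_mem_ne_zero_of_ne_bot hI
  have halg := isAlgebraic_of_etale he a
  -- By algebraicity `I` contains the image of a nonzero polynomial in the coordinates. The
  -- derivation `D^(β)`, for an exponent `β` of top degree, turns it into its coefficient at `β`.
  have : I.comap (polyHom ι x) ≠ ⊥ := by
    algebraize [polyHom ι x]
    exact Ideal.comap_ne_bot_of_algebraic_mem ha0 ha halg
  obtain ⟨p, hp, hp0⟩ := Submodule.exists_mem_ne_zero_of_ne_bot this
  obtain ⟨β, hβ, hβ0⟩ := exists_coeff_ne_zero hp0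
  exact ⟨_, hβ0, h.hasse_polyHom hβ.ge ▸ hs β _ hp⟩

lemma hasse_mul_of_const {b : A} (h : IsTaylor ι x τ) (hb : ∀ β, β ≠ 0 → hasse τ β b = 0)
    (β : σ →₀ ℕ) (a : A) : hasse τ β (a * b) = hasse τ β a * b := by
  classical
  rw [hasse_mul, Finset.sum_eq_single (β, 0)]
  · rw [h.hasse_zero]
  · rintro ⟨γ, δ⟩ hγ hne
    rw [Finset.HasAntidiagonal.mem_antidiagonal] at hγ
    rw [hb, mul_zero]
    rintro rfl
    exact hne (by simpa using hγ)
  · simp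

lemma hasse_mul_pow_of_const {b : A} (h : IsTaylor ι x τ) (hb : ∀ β, β ≠ 0 → hasse τ β b = 0)
    (β : σ →₀ ℕ) (a : A) (n : ℕ) : hasse τ β (a * b ^ n) = hasse τ β a * b ^ n := by
  induction n with
  | zero => simp
  | succ n ih => rw [pow_succ, ← mul_assoc, h.hasse_mul_of_const hb, ih, mul_assoc]

/-- An element annihilated by all derivations in the coordinates is algebraic over the constants. -/
lemma isAlgebraic_of_const [IsDomain C] [IsDomain A] (h : IsTaylor ι x τ)
    (he : (polyHom ι x).Etale) {b : A} (hb : ∀ β, β ≠ 0 → hasse τ β b = 0) :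
    ∃ p : Polynomial C, p ≠ 0 ∧ p.eval₂ ι b = 0 := by
  classical
  obtain ⟨Q, hQ, hQb⟩ := isAlgebraic_of_etale he b
  -- `β` is a top exponent of a coefficient of `Q` of largest total degree. Powers of `b` pass
  -- through `D^(β)`, which replaces every coefficient of the relation by its `β`-coefficient; the
  -- result is a relation over `C`, nontrivial at `i`.
  obtain ⟨i, hi, hmax⟩ := Finset.exists_max_image Q.support (fun i ↦ (Q.coeff i).totalDegree)
    (Polynomial.support_nonempty.mpr hQ)
  obtain ⟨β, hβ, hβ0⟩ := exists_coeff_ne_zero (Polynomial.mem_support_iff.mp hi)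
  refine ⟨∑ j ∈ Q.support, Polynomial.monomial j ((Q.coeff j).coeff β), fun h0 ↦ hβ0 ?_, ?_⟩
  · have := congrArg (fun p ↦ p.coeff i) h0
    simp only [Polynomial.finsetSum_coeff, Polynomial.coeff_monomial, Polynomial.coeff_zero] at this
    rwa [Finset.sum_ite_eq' Q.support i, if_pos hi] at this
  · rw [Polynomial.eval₂_finsetSum]
    rw [Polynomial.eval₂_eq_sum, Polynomial.sum] at hQb
    have := congrArg (hasse τ β) hQb
    rw [map_zero, map_sum] at this
    rw [← this]
    refine Finset.sum_congr rfl fun j hj ↦ ?_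
    rw [h.hasse_mul_pow_of_const hb, h.hasse_polyHom (hβ ▸ hmax j hj), Polynomial.eval₂_monomial]

/-- Both sides are differential operators, so monomials suffice; there it is the identity `(b choose
γ)(b - γ choose β) = (β + γ choose γ)(b choose β + γ)`. -/
lemma hasse_hasse (h : IsTaylor ι x τ) (he : (polyHom ι x).FormallyUnramified) (β γ : σ →₀ ℕ)
    (a : A) : hasse τ β (hasse τ γ a) =
      ((∏ i, (β i + γ i).choose (γ i) : ℕ) : A) * hasse τ (β + γ) a := by
  classical
  have hd : IsDiff (RingHom.id A) (β.degree + γ.degree) ((hasse τ β).comp (hasse τ γ) -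
      (AddMonoidHom.mulLeft ((∏ i, (β i + γ i).choose (γ i) : ℕ) : A)).comp (hasse τ (β + γ))) := by
    refine ((h.isDiff_hasse β).comp (h.isDiff_hasse γ)).sub ?_
    have := (h.isDiff_hasse (β + γ)).mulLeft (((∏ i, (β i + γ i).choose (γ i) : ℕ) : A))
    rwa [map_add] at this
  have := hd.eq_zero_of_monomial ι x he fun c b ↦ ?_
  · have := DFunLike.congr_fun this a
    simpa [sub_eq_zero] using this
  · have h1 : hasse τ β (hasse τ γ (∏ i, x i ^ b i)) =
        ((∏ i, (b i).choose (γ i) : ℕ) : A) *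
          (((∏ i, (b i - γ i).choose (β i) : ℕ) : A) * ∏ i, x i ^ (b i - (β i + γ i))) := by
      rw [h.hasse_monomial γ b, ← nsmul_eq_mul, map_nsmul, nsmul_eq_mul]
      have := h.hasse_monomial β (b - γ)
      simp only [Finsupp.tsub_apply] at this
      rw [this]
      simp only [Nat.sub_sub, add_comm (γ _)]
    have h2 := h.hasse_monomial (β + γ) b
    simp only [Finsupp.add_apply] at h2
    simp only [AddMonoidHom.sub_apply, AddMonoidHom.comp_apply, AddMonoidHom.coe_mulLeft, h.hasse_const_mul]
    rw [h1, h2, sub_eq_zero, mul_left_comm _ (ι c)]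
    congr 1
    rw [← mul_assoc, ← mul_assoc, ← Nat.cast_mul, ← Nat.cast_mul, ← Finset.prod_mul_distrib,
      ← Finset.prod_mul_distrib]
    congr 3 with i
    rcases le_or_gt (β i + γ i) (b i) with hle | hlt
    · have := Nat.choose_mul (n := b i) (Nat.le_add_left (γ i) (β i))
      rw [Nat.add_sub_cancel] at this
      rw [← this, mul_comm]
    · rw [Nat.choose_eq_zero_of_lt hlt, mul_zero]
      rcases le_or_gt (γ i) (b i) with hle' | hlt'
      · rw [Nat.choose_eq_zero_of_lt (show b i - γ i < β i by omega), mul_zero]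
      · rw [Nat.choose_eq_zero_of_lt hlt', zero_mul]

end IsTaylor

/-- The divided power derivations of `τ` have no nontrivial stable ideals. -/
def IsSimple (τ : A →+* MvPowerSeries σ A) : Prop :=
  ∀ I : Ideal A, (∀ β, ∀ a ∈ I, hasse τ β a ∈ I) → I = ⊥ ∨ I = ⊤

/-- A nonzero stable ideal contains a nonzero constant, which is a unit because the constants form a
field. -/
lemma IsTaylor.isSimple {k : Type*} [Field k] {ι : k →+* A} [IsDomain A] (h : IsTaylor ι x τ)
    (he : (polyHom ι x).Etale) : IsSimple τ := by
  intro I hs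
  by_cases hI : I = ⊥
  · exact Or.inl hI
  · obtain ⟨c, hc, hcI⟩ := h.exists_const_mem he hI hs
    exact Or.inr (I.eq_top_of_isUnit_mem hcI ((IsUnit.mk0 c hc).map ι))

/-- A system of additive operators on a module, satisfying the Leibniz rule with respect to the
divided power derivations of the ring. -/
structure IsLeibniz (τ : A →+* MvPowerSeries σ A) {M : Type*} [AddCommGroup M] [Module A M]
    (δ : (σ →₀ ℕ) → M →+ M) : Prop where
  zero (m : M) : δ 0 m = m
  smul [DecidableEq σ] (β : σ →₀ ℕ) (a : A) (m : M) : δ β (a • m) =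
    ∑ p ∈ Finset.HasAntidiagonal.antidiagonal β, hasse τ p.1 a • δ p.2 m

variable {M : Type*} [AddCommGroup M] [Module A M] {δ : (σ →₀ ℕ) → M →+ M}

/-- The conductor of a stable submodule into another is a stable ideal. -/
lemma IsLeibniz.colon_stable (hδ : IsLeibniz τ δ) (M₁ M₂ : Submodule A M)
    (h₁ : ∀ β, ∀ m ∈ M₁, δ β m ∈ M₁) (h₂ : ∀ β, ∀ m ∈ M₂, δ β m ∈ M₂) (β : σ →₀ ℕ) (a : A)
    (ha : ∀ m ∈ M₁, a • m ∈ M₂) : ∀ m ∈ M₁, hasse τ β a • m ∈ M₂ := by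
  classical
  obtain ⟨n, hn⟩ : ∃ n, β.degree = n := ⟨_, rfl⟩
  induction n using Nat.strong_induction_on generalizing β with
  | _ n ih =>
    intro m hm
    have h := h₂ β _ (ha m hm)
    rw [hδ.smul, ← Finset.add_sum_erase _ _ (show (β, 0) ∈
      Finset.HasAntidiagonal.antidiagonal β by simp), hδ.zero] at h
    -- The other Leibniz terms of `δ β (a • m)` are `D^(γ)(a)` times elements of `M₁` with `|γ| <
    -- |β|`, so they lie in `M₂` by induction.
    refine (Submodule.add_mem_iff_left _ (Submodule.sum_mem _ fun p hp ↦ ?_)).mp h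
    obtain ⟨γ, ε⟩ := p
    rw [Finset.mem_erase, Finset.HasAntidiagonal.mem_antidiagonal] at hp
    obtain ⟨hne, rfl⟩ := hp
    refine ih γ.degree ?_ γ rfl _ (h₁ _ _ hm)
    have : ε ≠ 0 := by rintro rfl; simp at hne
    have : ε.degree ≠ 0 := by rwa [Ne, Finsupp.degree_eq_zero_iff]
    simp only [map_add] at hn
    omega

/-- The torsion of a module is stable. -/
lemma IsLeibniz.exists_smul_eq_zero [IsDomain A] (hδ : IsLeibniz τ δ)
    (hτ : ∀ a, hasse τ 0 a = a) (β : σ →₀ ℕ)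
    {a : A} (ha : a ≠ 0) {m : M} (hm : a • m = 0) : ∃ b : A, b ≠ 0 ∧ b • δ β m = 0 := by
  classical
  obtain ⟨n, hn⟩ : ∃ n, β.degree = n := ⟨_, rfl⟩
  suffices h : ∀ γ ≤ β, ∃ b : A, b ≠ 0 ∧ b • δ γ m = 0 from h β le_rfl
  clear hn
  intro γ hγ
  obtain ⟨n, hn⟩ : ∃ n, γ.degree = n := ⟨_, rfl⟩
  induction n using Nat.strong_induction_on generalizing γ with
  | _ n ih =>
    have h := congrArg (δ γ) hm
    rw [hδ.smul, ← Finset.add_sum_erase _ _ (show (0, γ) ∈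
      Finset.HasAntidiagonal.antidiagonal γ by simp), map_zero] at h
    have key : ∀ p ∈ (Finset.HasAntidiagonal.antidiagonal γ).erase (0, γ),
        ∃ b : A, b ≠ 0 ∧ b • δ p.2 m = 0 := by
      rintro ⟨ε, ζ⟩ hp
      rw [Finset.mem_erase, Finset.HasAntidiagonal.mem_antidiagonal] at hp
      obtain ⟨hne, rfl⟩ := hp
      have : ε ≠ 0 := by rintro rfl; simp at hne
      have : ε.degree ≠ 0 := by rwa [Ne, Finsupp.degree_eq_zero_iff]
      simp only [map_add] at hn
      exact ih ζ.degree (by omega) ζ (le_trans le_add_self hγ) rfl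
    choose! b hb0 hb using key
    rw [hτ] at h
    -- The product of the annihilators of the lower Leibniz terms leaves only `a • δ γ m` in the
    -- relation `δ γ (a • m) = 0`.
    refine ⟨(∏ p ∈ (Finset.HasAntidiagonal.antidiagonal γ).erase (0, γ), b p) * a,
      mul_ne_zero (Finset.prod_ne_zero_iff.mpr hb0) ha, ?_⟩
    rw [mul_smul, eq_neg_of_add_eq_zero_left h, smul_neg, neg_eq_zero, Finset.smul_sum]
    refine Finset.sum_eq_zero fun p hp ↦ ?_
    rw [← Finset.mul_prod_erase _ _ hp, smul_comm, mul_comm, mul_smul, hb p hp, smul_zero,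
      smul_zero]

/-- A finite module with a Leibniz action of the derivations of a simple ring is torsion-free. -/
lemma IsLeibniz.smul_eq_zero [IsDomain A] [IsNoetherianRing A] [Module.Finite A M]
    (hδ : IsLeibniz τ δ) (hτ : ∀ a, hasse τ 0 a = a) (hs : IsSimple τ) {a : A} (ha : a ≠ 0) {m : M}
    (hm : a • m = 0) : m = 0 := by
  classical
  have hT (m : M) : m ∈ Submodule.torsion A M ↔ ∃ a : A, a ≠ 0 ∧ a • m = 0 := by
    rw [Submodule.mem_torsion_iff]
    refine ⟨fun ⟨a, h⟩ ↦ ⟨a, nonZeroDivisors.ne_zero a.2, h⟩,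
      fun ⟨a, h, h'⟩ ↦ ⟨⟨a, mem_nonZeroDivisors_of_ne_zero h⟩, h'⟩⟩
  obtain ⟨s, hs'⟩ := IsNoetherian.noetherian (Submodule.torsion A M)
  have h0 : ∀ m ∈ s, ∃ a : A, a ≠ 0 ∧ a • m = 0 := fun m hm ↦
    (hT m).mp (hs' ▸ Submodule.subset_span hm)
  choose! b hb0 hb using h0
  -- The annihilator of the torsion is nonzero because the torsion is finitely generated, and stable
  -- as the conductor of the torsion into zero. Hence it contains `1`.
  let I : Ideal A :=
    { carrier := {a | ∀ m ∈ Submodule.torsion A M, a • m ∈ (⊥ : Submodule A M)}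
      add_mem' := fun {a b} ha hb m hm ↦ by
        rw [add_smul]; exact add_mem (ha m hm) (hb m hm)
      zero_mem' := fun m _ ↦ by simp
      smul_mem' := fun c a ha m hm ↦ by
        rw [smul_eq_mul, mul_smul]; exact Submodule.smul_mem _ c (ha m hm) }
  have hI : (∏ m ∈ s, b m) ∈ I := by
    intro m hm
    rw [← hs'] at hm
    induction hm using Submodule.span_induction with
    | mem m hm =>
      rw [← Finset.mul_prod_erase _ _ hm, mul_comm, mul_smul, hb m hm, smul_zero]
      exact zero_mem _
    | zero => simp
    | add x y _ _ hx hy => rw [smul_add]; exact add_mem hx hy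
    | smul c x _ hx => rw [smul_comm]; exact Submodule.smul_mem _ c hx
  have := hs I fun β a ha ↦ hδ.colon_stable (Submodule.torsion A M) ⊥ (fun β m hm ↦ by
    obtain ⟨a, ha, ham⟩ := (hT m).mp hm
    exact (hT _).mpr (hδ.exists_smul_eq_zero hτ β ha ham)) (fun β m hm ↦ by
    rw [Submodule.mem_bot] at hm ⊢; rw [hm, map_zero]) β a ha
  rcases this with h | h
  · rw [h, Submodule.mem_bot] at hI
    exact absurd hI (Finset.prod_ne_zero_iff.mpr hb0)
  · have h1 : (1 : A) ∈ I := h ▸ Submodule.mem_top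
    simpa using h1 m ((hT m).mpr ⟨a, ha, hm⟩)

/-- A finite module with a Leibniz action of the derivations of a simple ring is free over the
local rings. -/
lemma IsLeibniz.free_localization [IsDomain A] [IsNoetherianRing A] [Module.Finite A M]
    (hδ : IsLeibniz τ δ) (hτ : ∀ a, hasse τ 0 a = a) (hs : IsSimple τ)
    (hh : ∀ β γ a, ∃ n : A, hasse τ β (hasse τ γ a) = n * hasse τ (β + γ) a)
    (p : Ideal A) [p.IsPrime] :
    Module.Free (Localization.AtPrime p) (LocalizedModule p.primeCompl M) := by
  classical
  let R := Localization.AtPrime p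
  let k := IsLocalRing.ResidueField R
  let M' := LocalizedModule p.primeCompl M
  let w := Module.finBasis k (TensorProduct R k M')
  -- A basis of the fibre at `p` is lifted to elements of `M`; the denominators are units in the
  -- residue field and merely rescale the basis to `w'`.
  obtain ⟨v, hv⟩ := (TensorProduct.mk_surjective R M' k Ideal.Quotient.mk_surjective).comp_left w
  have hmk (i) : ∃ (m : M) (s : p.primeCompl), LocalizedModule.mk m s = v i := by
    induction' hi : v i using LocalizedModule.induction_on with m s
    exact ⟨m, s, rfl⟩
  choose m s hms using hmk
  have hunit (s : p.primeCompl) : IsUnit (algebraMap R k (algebraMap A R s)) :=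
    (IsLocalization.map_units R s).map _
  let w' := w.unitsSMul fun i ↦ (hunit (s i)).unit
  have hadd (m n : M) : (LocalizedModule.mk (m + n) 1 : M') =
      LocalizedModule.mk m 1 + LocalizedModule.mk n 1 :=
    (LocalizedModule.mkLinearMap p.primeCompl M).map_add m n
  have hsmul (a : A) (m : M) : (LocalizedModule.mk (a • m) 1 : M') =
      algebraMap A R a • (LocalizedModule.mk m 1 : M') := by
    rw [algebraMap_smul]
    exact (LocalizedModule.mkLinearMap p.primeCompl M).map_smul a m
  let Λ : M →+ TensorProduct R k M' :=
    (TensorProduct.mk R k M' 1).toAddMonoidHom.comp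
      (LocalizedModule.mkLinearMap p.primeCompl M).toAddMonoidHom
  have hΛ' (r : R) (y : M') : (1 : k) ⊗ₜ[R] (r • y) = algebraMap R k r • ((1 : k) ⊗ₜ[R] y) := by
    rw [TensorProduct.tmul_smul, algebraMap_smul]
  have hΛ (a : A) (m : M) : Λ (a • m) = algebraMap R k (algebraMap A R a) • Λ m := by
    change (1 : k) ⊗ₜ[R] (LocalizedModule.mk (a • m) 1 : M') = _
    rw [hsmul, hΛ']
    rfl
  have hker (a : A) (ha : algebraMap R k (algebraMap A R a) = 0) : a ∈ p := by
    rw [IsLocalRing.ResidueField.algebraMap_eq, IsLocalRing.residue_eq_zero_iff] at ha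
    exact (IsLocalization.AtPrime.to_map_mem_maximal_iff R p a).mp ha
  have hker' (a : A) (ha : a ∈ p) : algebraMap R k (algebraMap A R a) = 0 := by
    rw [IsLocalRing.ResidueField.algebraMap_eq, IsLocalRing.residue_eq_zero_iff]
    exact (IsLocalization.AtPrime.to_map_mem_maximal_iff R p a).mpr ha
  have hw' (i) : (1 : k) ⊗ₜ[R] (LocalizedModule.mk (m i) 1 : M') = w' i := by
    rw [Module.Basis.unitsSMul_apply, ← congrFun hv i, Units.smul_def, IsUnit.unit_spec]
    change _ = _ • ((1 : k) ⊗ₜ[R] v i)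
    rw [← hΛ', ← hms i, algebraMap_smul, LocalizedModule.smul'_mk]
    congr 1
    exact (LocalizedModule.mk_cancel (s i) (m i)).symm
  -- The core of the argument. Differentiating the relation shows, by induction on `|β|`, that every
  -- `D^(β)(a i)` lies in `p`. The elements all of whose derivatives lie in `p` form an ideal,
  -- stable by `hh` and proper, hence zero.
  have hli : ∀ a : Fin _ → A, ∑ i, a i • m i = 0 → ∀ i, a i = 0 := by
    intro a ha
    let J : Ideal A :=
      { carrier := {a | ∀ β, hasse τ β a ∈ p}
        add_mem' := fun {a b} ha hb β ↦ by rw [map_add]; exact add_mem (ha β) (hb β)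
        zero_mem' := fun β ↦ by rw [map_zero]; exact zero_mem _
        smul_mem' := fun c a ha β ↦ by
          rw [smul_eq_mul, hasse_mul]
          exact Submodule.sum_mem _ fun _ _ ↦ Ideal.mul_mem_left _ _ (ha _) }
    have hJ : J = ⊥ := by
      refine (hs J fun β a ha γ ↦ ?_).resolve_right fun h ↦ ?_
      · obtain ⟨n, hn⟩ := hh γ β a
        rw [hn]
        exact Ideal.mul_mem_left _ _ (ha _)
      · have : (1 : A) ∈ J := h ▸ Submodule.mem_top
        have := this 0
        rw [hτ] at this
        exact (Ideal.ne_top_iff_one p).mp ‹p.IsPrime›.ne_top this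
    suffices h : ∀ n, ∀ β : σ →₀ ℕ, β.degree = n → ∀ i, hasse τ β (a i) ∈ p by
      intro i
      have : a i ∈ J := fun β ↦ h _ β rfl i
      rwa [hJ, Submodule.mem_bot] at this
    intro n
    induction n using Nat.strong_induction_on with
    | _ n ih =>
      intro β hβ
      have h1 := congrArg (δ β) ha
      rw [map_zero, map_sum] at h1
      have h2 : ∑ i, hasse τ β (a i) • m i ∈ p • (⊤ : Submodule A M) := by
        have h3 : ∑ i, hasse τ β (a i) • m i = - ∑ i, ∑ q ∈
            (Finset.HasAntidiagonal.antidiagonal β).erase (β, 0), hasse τ q.1 (a i) • δ q.2 (m i) := by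
          rw [eq_neg_iff_add_eq_zero, ← Finset.sum_add_distrib, ← h1]
          refine Finset.sum_congr rfl fun i _ ↦ ?_
          rw [hδ.smul, ← Finset.add_sum_erase _ _ (show (β, 0) ∈
            Finset.HasAntidiagonal.antidiagonal β by simp), hδ.zero]
        rw [h3]
        refine neg_mem (Submodule.sum_mem _ fun i _ ↦ Submodule.sum_mem _ fun q hq ↦ ?_)
        refine Submodule.smul_mem_smul ?_ Submodule.mem_top
        obtain ⟨γ, ε⟩ := q
        rw [Finset.mem_erase, Finset.HasAntidiagonal.mem_antidiagonal] at hq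
        obtain ⟨hne, rfl⟩ := hq
        have : ε ≠ 0 := by rintro rfl; simp at hne
        have : ε.degree ≠ 0 := by rwa [Ne, Finsupp.degree_eq_zero_iff]
        simp only [map_add] at hβ
        exact ih γ.degree (by omega) γ rfl i
      have h4 : ∀ m ∈ p • (⊤ : Submodule A M), Λ m = 0 := by
        intro m hm
        induction hm using Submodule.smul_induction_on' with
        | smul r hr n hn => rw [hΛ, hker' r hr, zero_smul]
        | add x hx y hy hx' hy' => rw [map_add, hx', hy', add_zero]
      have h5 := h4 _ h2
      have h6 : ∑ i, algebraMap R k (algebraMap A R (hasse τ β (a i))) • w' i = 0 := by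
        rw [← h5, map_sum]
        refine Finset.sum_congr rfl fun i _ ↦ ?_
        rw [hΛ, ← hw']
        rfl
      intro i
      exact hker _ (Fintype.linearIndependent_iff.mp w'.linearIndependent _ h6 i)
  -- Generation is Nakayama's lemma; independence over the local ring reduces to `hli` by clearing
  -- denominators.
  refine Module.Free.of_basis (Module.Basis.mk (v := fun i ↦ LocalizedModule.mk (m i) 1) ?_
    (IsLocalRing.span_eq_top_of_tmul_eq_basis _ w' hw').ge)
  rw [Fintype.linearIndependent_iff]
  intro g hg i
  obtain ⟨b, hb⟩ := IsLocalization.exist_integer_multiples_of_finite p.primeCompl g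
  choose a ha using hb
  have h1 : (LocalizedModule.mk (∑ i, a i • m i) 1 : M') = 0 := by
    have : (LocalizedModule.mk (∑ i, a i • m i) 1 : M') = ∑ i, LocalizedModule.mk (a i • m i) 1 :=
      map_sum (LocalizedModule.mkLinearMap p.primeCompl M) _ _
    rw [this, ← smul_zero (b : A), ← hg, Finset.smul_sum]
    refine Finset.sum_congr rfl fun i _ ↦ ?_
    rw [hsmul, ha, smul_assoc]
  rw [← LocalizedModule.zero_mk 1, LocalizedModule.mk_eq] at h1
  obtain ⟨u, hu⟩ := h1
  simp only [one_smul, smul_zero] at hu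
  have h2 := hli (fun i ↦ u * a i) (by
    simp only [mul_smul, ← Finset.smul_sum]
    exact hu) i
  have hne (s : p.primeCompl) : (s : A) ≠ 0 := fun h ↦ s.2 (h ▸ zero_mem p)
  have h3 : a i = 0 := (mul_eq_zero.mp h2).resolve_left (hne u)
  have h4 := ha i
  rw [h3, map_zero, Algebra.smul_def] at h4
  exact ((IsLocalization.map_units R b).mul_right_eq_zero).mp h4.symm

end Simple

end

section

variable {X S T : Scheme.{u}}

/-! ### Gluing sections and operators from a basis of open subsets -/

section Gluing

lemma eqO_of_local {V : X.Opens} (s t : Γ(X, V))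
    (H : ∀ x ∈ V, ∃ (V' : X.Opens) (h : V' ≤ V), x ∈ V' ∧ resO h s = resO h t) : s = t := by
  choose! V' h hx hst using H
  refine TopCat.Sheaf.eq_of_locally_eq' X.sheaf (fun x : V ↦ V' x) V
    (fun x ↦ homOfLE (h x x.2)) (fun x hx' ↦ Opens.mem_iSup.mpr ⟨⟨x, hx'⟩, hx x hx'⟩) _ _
    fun x ↦ hst x x.2

lemma eqM_of_local (M : X.Modules) {V : X.Opens} (s t : Γ(M, V))
    (H : ∀ x ∈ V, ∃ (V' : X.Opens) (h : V' ≤ V), x ∈ V' ∧ resM M h s = resM M h t) : s = t := by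
  choose! V' h hx hst using H
  refine TopCat.Sheaf.eq_of_locally_eq' ⟨M.presheaf, M.isSheaf⟩ (fun x : V ↦ V' x) V
    (fun x ↦ homOfLE (h x x.2)) (fun x hx' ↦ Opens.mem_iSup.mpr ⟨⟨x, hx'⟩, hx x hx'⟩) _ _
    fun x ↦ hst x x.2

/-- Compatibility is asked only for nested members of the family: an overlap of two members is
itself covered by members. -/
lemma exists_glueO {V : X.Opens} (P : X.Opens → Prop)
    (hP : ∀ V' ≤ V, ∀ x ∈ V', ∃ V'' ≤ V', x ∈ V'' ∧ P V'')
    (s : ∀ V', V' ≤ V → P V' → Γ(X, V'))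
    (hs : ∀ V' V'' (h' : V' ≤ V) (p' : P V') (h : V'' ≤ V') (p'' : P V''),
      resO h (s V' h' p') = s V'' (h.trans h') p'') :
    ∃ t : Γ(X, V), ∀ V' (h : V' ≤ V) (p : P V'), resO h t = s V' h p := by
  obtain ⟨t, ht, -⟩ := TopCat.Sheaf.existsUnique_gluing' X.sheaf
    (fun i : {V' : X.Opens // V' ≤ V ∧ P V'} ↦ i.1) V (fun i ↦ homOfLE i.2.1)
    (fun x hx ↦ by
      obtain ⟨V'', h, hx', p⟩ := hP V le_rfl x hx
      exact Opens.mem_iSup.mpr ⟨⟨V'', h, p⟩, hx'⟩)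
    (fun i ↦ s i.1 i.2.1 i.2.2) (fun i j ↦ by
      change resO inf_le_left _ = resO inf_le_right _
      refine eqO_of_local _ _ fun x hx ↦ ?_
      obtain ⟨V'', h, hx', p⟩ := hP (i.1 ⊓ j.1) (inf_le_left.trans i.2.1) x hx
      refine ⟨V'', h, hx', ?_⟩
      rw [resO_resO, resO_resO, hs _ _ _ _ _ p, hs _ _ _ _ _ p])
  exact ⟨t, fun V' h p ↦ ht ⟨V', h, p⟩⟩

lemma exists_glueM (M : X.Modules) {V : X.Opens} (P : X.Opens → Prop)
    (hP : ∀ V' ≤ V, ∀ x ∈ V', ∃ V'' ≤ V', x ∈ V'' ∧ P V'')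
    (s : ∀ V', V' ≤ V → P V' → Γ(M, V'))
    (hs : ∀ V' V'' (h' : V' ≤ V) (p' : P V') (h : V'' ≤ V') (p'' : P V''),
      resM M h (s V' h' p') = s V'' (h.trans h') p'') :
    ∃ t : Γ(M, V), ∀ V' (h : V' ≤ V) (p : P V'), resM M h t = s V' h p := by
  obtain ⟨t, ht, -⟩ := TopCat.Sheaf.existsUnique_gluing' ⟨M.presheaf, M.isSheaf⟩
    (fun i : {V' : X.Opens // V' ≤ V ∧ P V'} ↦ i.1) V (fun i ↦ homOfLE i.2.1)
    (fun x hx ↦ by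
      obtain ⟨V'', h, hx', p⟩ := hP V le_rfl x hx
      exact Opens.mem_iSup.mpr ⟨⟨V'', h, p⟩, hx'⟩)
    (fun i ↦ s i.1 i.2.1 i.2.2) (fun i j ↦ by
      change resM M inf_le_left _ = resM M inf_le_right _
      refine eqM_of_local M _ _ fun x hx ↦ ?_
      obtain ⟨V'', h, hx', p⟩ := hP (i.1 ⊓ j.1) (inf_le_left.trans i.2.1) x hx
      refine ⟨V'', h, hx', ?_⟩
      rw [resM_resM, resM_resM, hs _ _ _ _ _ p, hs _ _ _ _ _ p])
  exact ⟨t, fun V' h p ↦ ht ⟨V', h, p⟩⟩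

lemma exists_affine {V : X.Opens} {x : X} (hx : x ∈ V) :
    ∃ V' : X.Opens, V' ≤ V ∧ x ∈ V' ∧ IsAffineOpen V' := by
  obtain ⟨U, hU, hxU, hUV⟩ := exists_isAffineOpen_mem_and_subset hx
  exact ⟨U, hUV, hxU, hU⟩

/-- Operators agreeing on affine open subsets are equal. -/
lemma EndO.ext_affine {g : X ⟶ T} {U : X.Opens} {D D' : EndO g U}
    (h : ∀ V (hV : V ≤ U), IsAffineOpen V → ∀ x, D.app V hV x = D'.app V hV x) : D = D' := by
  ext V hV x
  refine eqO_of_local _ _ fun y hy ↦ ?_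
  obtain ⟨V', hV', hy', haff⟩ := exists_affine hy
  refine ⟨V', hV', hy', ?_⟩
  rw [← D.app_res, ← D'.app_res, h _ _ haff]

/-- An additive endomorphism of the functions on affine open subsets extends to all open subsets. -/
lemma exists_extend {U : X.Opens}
    (φ : ∀ V, V ≤ U → IsAffineOpen V → (Γ(X, V) →+ Γ(X, V)))
    (hφ : ∀ V W (hV : V ≤ U) (h : W ≤ V) (aV : IsAffineOpen V) (aW : IsAffineOpen W) x,
      φ W (h.trans hV) aW (resO h x) = resO h (φ V hV aV x)) :
    ∃ ψ : ∀ V, V ≤ U → (Γ(X, V) →+ Γ(X, V)),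
      (∀ V W (hV : V ≤ U) (h : W ≤ V) x, ψ W (h.trans hV) (resO h x) = resO h (ψ V hV x)) ∧
      ∀ V (hV : V ≤ U) (aV : IsAffineOpen V), ψ V hV = φ V hV aV := by
  have H (V : X.Opens) (hV : V ≤ U) (x : Γ(X, V)) : ∃ t : Γ(X, V), ∀ V' (h : V' ≤ V)
      (a : IsAffineOpen V'), resO h t = φ V' (h.trans hV) a (resO h x) := by
    refine exists_glueO IsAffineOpen (fun V' _ y hy ↦ exists_affine hy)
      (fun V' h a ↦ φ V' (h.trans hV) a (resO h x)) fun V' V'' h' a' h a'' ↦ ?_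
    rw [← hφ, resO_resO]
  choose t ht using H
  have huniq {V : X.Opens} {s s' : Γ(X, V)}
      (h : ∀ V' (h : V' ≤ V), IsAffineOpen V' → resO h s = resO h s') : s = s' := by
    refine eqO_of_local _ _ fun y hy ↦ ?_
    obtain ⟨V', hV', hy', haff⟩ := exists_affine hy
    exact ⟨V', hV', hy', h _ _ haff⟩
  refine ⟨fun V hV ↦
    { toFun := t V hV
      map_zero' := huniq fun V' h a ↦ by rw [ht _ _ _ _ _ a, map_zero, map_zero]
      map_add' := fun x y ↦ huniq fun V' h a ↦ by
        rw [ht _ _ _ _ _ a, map_add, map_add, map_add, ht _ _ _ _ _ a, ht _ _ _ _ _ a] }, ?_, ?_⟩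
  · intro V W hV h x
    refine huniq fun V' h' a ↦ ?_
    change resO h' (t W _ (resO h x)) = resO h' (resO h (t V hV x))
    rw [ht _ _ _ _ _ a, resO_resO, resO_resO, ht _ _ _ _ _ a]
  · intro V hV a
    ext x
    have := ht V hV x V le_rfl a
    rwa [resO_self, resO_self] at this

end Gluing

/-! ### Order of operators on sheaves and on rings of sections -/

section Order

variable {g : X ⟶ T}

lemma comm_app {U V : X.Opens} (h : V ≤ U) (D : EndO g U) (a : Γ(X, V)) (V' : X.Opens)
    (h' : V' ≤ V) :
    (EndO.restr h D * EndO.mul g V a - EndO.mul g V a * EndO.restr h D).app V' h' =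
      comm (RingHom.id _) (D.app V' (h'.trans h)) (resO h' a) := by
  ext x
  rw [EndO.sub_app]
  rfl

lemma HasOrder.isDiff {n : ℕ} {U : X.Opens} {D : EndO g U} (hD : HasOrder g n U D)
    {V : X.Opens} (hV : V ≤ U) : IsDiff (RingHom.id _) n (D.app V hV) := by
  induction n generalizing U V with
  | zero =>
    obtain ⟨a, rfl⟩ := hD
    intro b x
    simp only [EndO.mul_apply, RingHom.id_apply]
    ring
  | succ n ih =>
    intro b
    have := ih (hD V hV b) le_rfl
    rwa [comm_app, resO_self] at this

/-- In order zero the multiplier is `D(1)`, and equality of operators may be tested on affine open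
subsets; commutators carry the induction. -/
lemma hasOrder_of_isDiff {n : ℕ} {U : X.Opens} {D : EndO g U}
    (hD : ∀ V (hV : V ≤ U), IsAffineOpen V → IsDiff (RingHom.id _) n (D.app V hV)) :
    HasOrder g n U D := by
  induction n generalizing U with
  | zero =>
    refine ⟨D.app U le_rfl 1, EndO.ext_affine fun V hV aV x ↦ ?_⟩
    have := hD V hV aV x 1
    rw [mul_one, RingHom.id_apply, mul_comm] at this
    rw [this, EndO.mul_apply, ← D.app_res, map_one (resO hV)]
  | succ n ih =>
    intro V h a
    refine ih fun V' h' aV' ↦ ?_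
    rw [comm_app]
    exact hD V' _ aV' _

lemma HasOrder.mem_diffOp {n : ℕ} {U : X.Opens} {D : EndO g U} (hD : HasOrder g n U D) :
    D ∈ diffOp g U := fun x hx ↦ ⟨U, le_rfl, n, hx, hD.restr le_rfl⟩

end Order

/-! ### Étale coordinates on schemes and their operators -/

section Coord

lemma etale_resO {U V : X.Opens} (hU : IsAffineOpen U) (hV : IsAffineOpen V) (h : V ≤ U) :
    (resO h).Etale := by
  have := Scheme.Hom.etale_appLE (𝟙 X) hU hV h
  have e : (𝟙 X : X ⟶ X).appLE U V h = X.presheaf.map (homOfLE h).op := by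
    simp [Scheme.Hom.appLE]
    rfl
  rwa [e] at this

/-- Étale coordinates on an affine open subset `U`, relative to an affine open subset `W` of the
base. -/
@[ext]
structure Coord (g : X ⟶ T) (W : T.Opens) (U : X.Opens) (σ : Type) where
  /-- The base is affine. -/
  affine_base : IsAffineOpen W
  affine : IsAffineOpen U
  le : U ≤ g ⁻¹ᵁ W
  /-- The coordinate functions. -/
  x : σ → Γ(X, U)
  etale : (polyHom (g.appLE W U le).hom x).Etale

variable {g : X ⟶ T} {W : T.Opens} {U : X.Opens} {σ : Type}

/-- Restriction of coordinates. -/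
def Coord.restr (c : Coord g W U σ) {V : X.Opens} (hV : IsAffineOpen V) (h : V ≤ U) :
    Coord g W V σ where
  affine_base := c.affine_base
  affine := hV
  le := h.trans c.le
  x i := resO h (c.x i)
  etale := by
    have := RingHom.Etale.stableUnderComposition _ _ c.etale (etale_resO c.affine hV h)
    convert this using 1
    refine MvPolynomial.ringHom_ext (fun r ↦ ?_) fun i ↦ ?_
    · simp only [polyHom, MvPolynomial.coe_eval₂Hom, MvPolynomial.eval₂_C, RingHom.comp_apply]
      exact (resO_appLE g h c.le r).symm
    · simp [polyHom]

lemma Coord.restr_restr (c : Coord g W U σ) {V V' : X.Opens} (hV : IsAffineOpen V) (h : V ≤ U)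
    (hV' : IsAffineOpen V') (h' : V' ≤ V) :
    (c.restr hV h).restr hV' h' = c.restr hV' (h'.trans h) := by
  ext i
  exact resO_resO h h' (c.x i)

variable [Fintype σ]

lemma Coord.exists_taylor (c : Coord g W U σ) :
    ∃ τ, IsTaylor (g.appLE W U c.le).hom c.x τ :=
  exists_isTaylor _ _ c.etale.formallyEtale

/-- The Taylor expansion in the coordinates. -/
def Coord.taylor (c : Coord g W U σ) : Γ(X, U) →+* MvPowerSeries σ Γ(X, U) :=
  c.exists_taylor.choose

lemma Coord.isTaylor (c : Coord g W U σ) : IsTaylor (g.appLE W U c.le).hom c.x c.taylor :=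
  c.exists_taylor.choose_spec

/-- Both composites are differential operators along the restriction map with the same values on
monomials. So the chosen Taylor homomorphisms are compatible and the `D^(β)` glue to an operator on
the sheaf. -/
lemma Coord.hasse_res (c : Coord g W U σ) {V : X.Opens} (hV : IsAffineOpen V) (h : V ≤ U)
    (β : σ →₀ ℕ) (a : Γ(X, U)) :
    hasse (c.restr hV h).taylor β (resO h a) = resO h (hasse c.taylor β a) := by
  have h1 : IsDiff (resO h) β.degree
      ((hasse (c.restr hV h).taylor β).comp (resO h).toAddMonoidHom -
        (resO h).toAddMonoidHom.comp (hasse c.taylor β)) := by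
    refine IsDiff.sub ?_ ?_
    · exact ((c.restr hV h).isTaylor.isDiff_hasse β).comp_ringHom (resO h)
    · exact (c.isTaylor.isDiff_hasse β).ringHom_comp (resO h)
  have h2 := h1.eq_zero_of_monomial _ _ c.etale.formallyUnramified fun b m ↦ ?_
  · have := DFunLike.congr_fun h2 a
    simpa [sub_eq_zero] using this
  · simp only [AddMonoidHom.sub_apply, AddMonoidHom.comp_apply, RingHom.toAddMonoidHom_eq_coe,
      AddMonoidHom.coe_coe, c.isTaylor.hasse_const_mul, map_mul, map_prod, map_pow,
      c.isTaylor.hasse_monomial, map_natCast, sub_eq_zero]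
    have h3 : resO h ((g.appLE W U c.le).hom b) = (g.appLE W V (c.restr hV h).le).hom b :=
      resO_appLE g h c.le b
    rw [h3, (c.restr hV h).isTaylor.hasse_const_mul]
    congr 1
    exact (c.restr hV h).isTaylor.hasse_monomial β m

/-- Linearity is built in only over `Γ(T, W)`. For fixed `a` the defect is, as a function of `b`, a
differential operator along the pullback from `Γ(T, W')`, and it vanishes on the image of the étale
map from `Γ(T, W)`. -/
lemma Coord.hasse_linear (c : Coord g W U σ) {W' : T.Opens} (hW' : IsAffineOpen W')
    (hW : W' ≤ W) (h : U ≤ g ⁻¹ᵁ W') (β : σ →₀ ℕ) (b : Γ(T, W')) (a : Γ(X, U)) :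
    hasse c.taylor β (g.appLE W' U h b * a) = g.appLE W' U h b * hasse c.taylor β a := by
  let ψ := (g.appLE W' U h).hom
  have h0 : IsDiff (RingHom.id Γ(X, U)) 0 (AddMonoidHom.mulLeft a) := by
    intro x y
    simp only [AddMonoidHom.coe_mulLeft, RingHom.id_apply]
    ring
  have h1 : IsDiff ψ β.degree (((hasse c.taylor β).comp (AddMonoidHom.mulLeft a)).comp
      ψ.toAddMonoidHom - (AddMonoidHom.mulLeft (hasse c.taylor β a)).comp ψ.toAddMonoidHom) :=
    (((c.isTaylor.isDiff_hasse β).comp h0).comp_ringHom ψ).sub (isDiff_smul_hom _ _)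
  have h2 := h1.eq_zero_of_comp (resO hW)
    (etale_resO c.affine_base hW' hW).formallyUnramified fun r ↦ ?_
  · have := DFunLike.congr_fun h2 b
    simp only [AddMonoidHom.sub_apply, AddMonoidHom.comp_apply, AddMonoidHom.coe_mulLeft,
      AddMonoidHom.zero_apply, sub_eq_zero] at this
    rw [mul_comm, mul_comm (g.appLE W' U h b)]
    exact this
  · have h3 : ψ (resO hW r) = (g.appLE W U c.le).hom r := by
      simp only [resO, ψ, ← RingHom.comp_apply, ← CommRingCat.hom_comp, Scheme.Hom.map_appLE]
    simp only [AddMonoidHom.sub_apply, AddMonoidHom.comp_apply, AddMonoidHom.coe_mulLeft,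
      RingHom.toAddMonoidHom_eq_coe, AddMonoidHom.coe_coe, h3]
    rw [mul_comm, c.isTaylor.hasse_const_mul, mul_comm, sub_self]

lemma Coord.exists_op (c : Coord g W U σ) (β : σ →₀ ℕ) : ∃ D : EndO g U,
    ∀ V (hV : V ≤ U) (aV : IsAffineOpen V), D.app V hV = hasse (c.restr aV hV).taylor β := by
  obtain ⟨ψ, hψ, hψ'⟩ := exists_extend (fun V hV aV ↦ hasse (c.restr aV hV).taylor β)
    fun V V' hV h aV aV' x ↦ by
      have := (c.restr aV hV).hasse_res aV' h β x
      rwa [c.restr_restr] at this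
  refine ⟨⟨ψ, hψ, fun V hV W' h b x ↦ ?_⟩, hψ'⟩
  refine eqO_of_local _ _ fun y hy ↦ ?_
  -- Linearity over an arbitrary `W'` is checked near each point, over an affine open subset inside
  -- both `W'` and the base of the coordinates.
  have hyW : g y ∈ W' ⊓ W := ⟨h hy, c.le (hV hy)⟩
  obtain ⟨W'', hW'', hyW'', aW''⟩ := exists_affine hyW
  have hyV : y ∈ V ⊓ g ⁻¹ᵁ W'' := ⟨hy, hyW''⟩
  obtain ⟨V', hV', hyV', aV'⟩ := exists_affine hyV
  refine ⟨V', hV'.trans inf_le_left, hyV', ?_⟩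
  have h1 : resO (hV'.trans inf_le_left) (g.appLE W' V h b) =
      g.appLE W'' V' (hV'.trans inf_le_right) (resO (hW''.trans inf_le_left) b) := by
    rw [resO_appLE]
    simp only [resO, ← RingHom.comp_apply, ← CommRingCat.hom_comp, Scheme.Hom.map_appLE]
  rw [← hψ, map_mul (resO _), map_mul (resO _), ← hψ, h1, hψ' _ _ aV']
  exact (c.restr aV' _).hasse_linear aW'' (hW''.trans inf_le_right) _ β _ _

/-- The divided power derivations in the coordinates, as operators on the structure sheaf. -/
def Coord.opE (c : Coord g W U σ) (β : σ →₀ ℕ) : EndO g U := (c.exists_op β).choose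

lemma Coord.opE_app (c : Coord g W U σ) (β : σ →₀ ℕ) {V : X.Opens} (hV : V ≤ U)
    (aV : IsAffineOpen V) : (c.opE β).app V hV = hasse (c.restr aV hV).taylor β :=
  (c.exists_op β).choose_spec V hV aV

lemma Coord.hasOrder_opE (c : Coord g W U σ) (β : σ →₀ ℕ) : HasOrder g β.degree U (c.opE β) :=
  hasOrder_of_isDiff fun V hV aV ↦ by
    rw [c.opE_app β hV aV]
    exact (c.restr aV hV).isTaylor.isDiff_hasse β

/-- The divided power derivations in the coordinates, as differential operators. -/
def Coord.op (c : Coord g W U σ) (β : σ →₀ ℕ) : diffOp g U :=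
  ⟨c.opE β, (c.hasOrder_opE β).mem_diffOp⟩

lemma Coord.restr_self (c : Coord g W U σ) (h : U ≤ U) : c.restr c.affine h = c := by
  ext i
  exact resO_self h (c.x i)

lemma Coord.op_app (c : Coord g W U σ) (β : σ →₀ ℕ) {V : X.Opens} (hV : V ≤ U)
    (aV : IsAffineOpen V) (a : Γ(X, V)) :
    diffApply (c.op β) hV a = hasse (c.restr aV hV).taylor β a :=
  DFunLike.congr_fun (c.opE_app β hV aV) a

lemma Coord.op_app_self (c : Coord g W U σ) (β : σ →₀ ℕ) (a : Γ(X, U)) :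
    diffApply (c.op β) le_rfl a = hasse c.taylor β a := by
  rw [c.op_app β le_rfl c.affine, c.restr_self]

lemma diffOp_ext {U : X.Opens} {D D' : diffOp g U}
    (h : ∀ V (hV : V ≤ U), IsAffineOpen V → ∀ x, diffApply D hV x = diffApply D' hV x) : D = D' :=
  Subtype.ext (EndO.ext_affine h)

lemma Coord.restr_op (c : Coord g W U σ) (β : σ →₀ ℕ) {V : X.Opens} (hV : V ≤ U)
    (aV : IsAffineOpen V) : diffRestr g hV (c.op β) = (c.restr aV hV).op β := by
  refine diffOp_ext fun V' hV' aV' x ↦ ?_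
  rw [Coord.op_app _ _ _ aV', Coord.restr_restr]
  exact c.op_app β (hV'.trans hV) aV' x

/-- Expansion of a differential operator of bounded order in the coordinates. -/
lemma Coord.exists_expansion (c : Coord g W U σ) {n : ℕ} (D : diffOp g U)
    (hD : HasOrder g n U D.1) (P : (σ →₀ ℕ) → Prop) (hP : ∀ b b', b ≤ b' → P b' → P b)
    (hDP : ∀ b, P b → diffApply D le_rfl (∏ i, c.x i ^ b i) = 0) :
    ∃ a : (σ →₀ ℕ) → Γ(X, U), (∀ b, P b → a b = 0) ∧
      D = ∑ β ∈ indices σ n, diffMul g U (a β) * c.op β := by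
  obtain ⟨a, haP, ha⟩ := c.isTaylor.exists_approx (D.1.app U le_rfl) P hP hDP n
  refine ⟨a, haP, ?_⟩
  set D' : diffOp g U := ∑ β ∈ indices σ n, diffMul g U (a β) * c.op β with hD'
  have hord : HasOrder g n U D'.1 := by
    rw [hD', AddSubmonoidClass.coe_finsetSum]
    refine Finset.sum_induction _ (HasOrder g n U) (fun _ _ ↦ HasOrder.add) ?_ fun β hβ ↦ ?_
    · rw [← map_zero (EndO.mul g U)]
      exact hasOrder_mul g n U 0
    · have := (hasOrder_mul g 0 U (a β)).mul (c.hasOrder_opE β)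
      rw [zero_add] at this
      exact this.mono (mem_indices.mp hβ)
  have happ (x : Γ(X, U)) : diffApply D' le_rfl x =
      ∑ β ∈ indices σ n, a β * hasse c.taylor β x := by
    have key : ∀ s : Finset (σ →₀ ℕ),
        diffApply (∑ β ∈ s, diffMul g U (a β) * c.op β) le_rfl x =
          ∑ β ∈ s, a β * hasse c.taylor β x := by
      classical
      intro s
      induction s using Finset.induction_on with
      | empty => simp; rfl
      | insert β s hβ ih =>
        rw [Finset.sum_insert hβ, Finset.sum_insert hβ, ← ih, ← c.op_app_self]
        change resO _ (a β) * _ + _ = _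
        rw [resO_self]
        rfl
    exact key _
  -- Two operators of order at most `n` that agree on monomials of degree at most `n` agree on all
  -- monomials, and then, by linearity over the base and étaleness, on all functions on `U`.
  have hU : D.1.app U le_rfl - D'.1.app U le_rfl = 0 := by
    have hdiff := (hD.isDiff (le_refl U)).sub (hord.isDiff (le_refl U))
    have h0 := hdiff.monomial_eq_zero c.x fun b hb ↦ by
      rw [AddMonoidHom.sub_apply, ha b hb, ← happ]
      exact sub_self _
    refine hdiff.eq_zero_of_monomial _ _ c.etale.formallyUnramified fun r b ↦ ?_
    have h1 := D.1.app_linear U le_rfl W c.le r (∏ i, c.x i ^ b i)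
    have h2 := D'.1.app_linear U le_rfl W c.le r (∏ i, c.x i ^ b i)
    have h3 := h0 b
    rw [AddMonoidHom.sub_apply] at h3 ⊢
    rw [h1, h2, ← mul_sub, h3, mul_zero]
  refine diffOp_ext fun V hV aV x ↦ ?_
  -- On a smaller affine `V` the difference vanishes on functions restricted from `U`, and
  -- restriction is étale.
  have hdiff := ((hD.isDiff hV).sub (hord.isDiff hV)).eq_zero_of_comp (resO hV)
    (etale_resO c.affine aV hV).formallyUnramified fun r ↦ by
      rw [AddMonoidHom.sub_apply, D.1.app_res U V le_rfl hV, D'.1.app_res U V le_rfl hV, ← map_sub,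
        ← AddMonoidHom.sub_apply, hU, AddMonoidHom.zero_apply, map_zero]
  have := DFunLike.congr_fun hdiff x
  rwa [AddMonoidHom.sub_apply, AddMonoidHom.zero_apply, sub_eq_zero] at this

end Coord

end

/-! ### Coordinates in a tower of smooth morphisms -/

section

-- The map `R[s, t] → C[s]` is a base change of the étale map `R[t] → C`, and it is followed by the
-- étale map `C[s] → A`.
attribute [local instance] MvPolynomial.algebraMvPolynomial in
lemma etale_polyHom_sum {ρ σ : Type} {R C A : Type u} [CommRing R] [CommRing C] [CommRing A]
    {ι : R →+* C} {ιA : R →+* A} {θ : C →+* A} {t : σ → C} {s : ρ → A}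
    (hι : ∀ r, θ (ι r) = ιA r) (ht : (polyHom ι t).Etale) (hs : (polyHom θ s).Etale) :
    (polyHom ιA (Sum.elim s (fun i ↦ θ (t i)))).Etale := by
  have h1 : (MvPolynomial.map (σ := ρ) (polyHom ι t)).Etale := by
    algebraize [polyHom ι t]
    exact RingHom.Etale.isStableUnderBaseChange (MvPolynomial σ R) C
      (MvPolynomial ρ (MvPolynomial σ R)) (MvPolynomial ρ C) ht
  have h2 := RingHom.Etale.stableUnderComposition _ _ h1 hs
  have h3 := RingHom.Etale.stableUnderComposition _ _
    (RingHom.Etale.of_bijective (f := (MvPolynomial.sumRingEquiv R ρ σ).toRingHom)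
      (MvPolynomial.sumRingEquiv R ρ σ).bijective) h2
  convert h3 using 1
  refine MvPolynomial.ringHom_ext (fun r ↦ ?_) fun i ↦ ?_
  · simp [polyHom, hι]
  · rcases i with i | i <;> simp [polyHom]

section Tower

variable {R C A : Type*} {ρ σ : Type} [CommRing R] [CommRing C] [CommRing A] [Fintype ρ] [Fintype σ]
  {ι : R →+* C} {ιA : R →+* A} {θ : C →+* A} {t : σ → C} {s : ρ → A} {x : ρ ⊕ σ → A}
  {τC : C →+* MvPowerSeries σ C} {τ : A →+* MvPowerSeries (ρ ⊕ σ) A} {τs : A →+* MvPowerSeries ρ A}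

/-- This makes `D^(0,β)` in the joint coordinates a lift of `D^(β)` on the base; both sides are
compared on monomials in the base coordinates. -/
lemma hasse_baseHom (hι : ∀ r, θ (ι r) = ιA r) (ht : ∀ i, θ (t i) = x (.inr i))
    (hC : IsTaylor ι t τC) (hA : IsTaylor ιA x τ) (hu : (polyHom ι t).FormallyUnramified)
    (β : σ →₀ ℕ) (c : C) :
    hasse τ (Finsupp.sumElim 0 β) (θ c) = θ (hasse τC β c) := by
  have hd : (Finsupp.sumElim (0 : ρ →₀ ℕ) β).degree = β.degree := by
    rw [Finsupp.degree_eq_sum, Finsupp.degree_eq_sum, Fintype.sum_sum_type]; simp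
  have h1 : IsDiff θ β.degree ((hasse τ (Finsupp.sumElim 0 β)).comp θ.toAddMonoidHom -
      θ.toAddMonoidHom.comp (hasse τC β)) := by
    refine IsDiff.sub ?_ ?_
    · have := (hA.isDiff_hasse (Finsupp.sumElim 0 β)).comp_ringHom θ
      rwa [hd] at this
    · exact (hC.isDiff_hasse β).ringHom_comp θ
  have h2 := h1.eq_zero_of_monomial ι t hu fun r b ↦ ?_
  · have := DFunLike.congr_fun h2 c
    simpa [sub_eq_zero] using this
  · have h3 : θ (ι r * ∏ i, t i ^ b i) =
        ιA r * ∏ i, x i ^ (Finsupp.sumElim (0 : ρ →₀ ℕ) b) i := by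
      simp [hι, ht, Fintype.prod_sum_type]
    have h4 : θ (hasse τC β (ι r * ∏ i, t i ^ b i)) = ιA r *
        (((∏ i, (b i).choose (β i) : ℕ) : A) * ∏ i, x (.inr i) ^ (b i - β i)) := by
      rw [hC.hasse_const_mul, hC.hasse_monomial]
      simp [hι, ht]
    simp only [AddMonoidHom.sub_apply, AddMonoidHom.comp_apply, RingHom.toAddMonoidHom_eq_coe,
      AddMonoidHom.coe_coe]
    rw [h3, h4, hA.hasse_const_mul, hA.hasse_monomial, sub_eq_zero]
    simp [Fintype.prod_sum_type]

/-- Compared on joint monomials, where the base coordinates are constants for the relative Taylor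
expansion. -/
lemma hasse_inl (hι : ∀ r, θ (ι r) = ιA r) (ht : ∀ i, θ (t i) = x (.inr i))
    (hs : ∀ i, s i = x (.inl i)) (hA : IsTaylor ιA x τ) (hAs : IsTaylor θ s τs)
    (hu : (polyHom ιA x).FormallyUnramified) (α : ρ →₀ ℕ) (a : A) :
    hasse τ (Finsupp.sumElim α 0) a = hasse τs α a := by
  have hd : (Finsupp.sumElim α (0 : σ →₀ ℕ)).degree = α.degree := by
    rw [Finsupp.degree_eq_sum, Finsupp.degree_eq_sum, Fintype.sum_sum_type]; simp
  have h1 : IsDiff (RingHom.id A) α.degree (hasse τ (Finsupp.sumElim α 0) - hasse τs α) := by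
    refine IsDiff.sub ?_ (hAs.isDiff_hasse α)
    have := hA.isDiff_hasse (Finsupp.sumElim α 0)
    rwa [hd] at this
  have h2 := h1.eq_zero_of_monomial ιA x hu fun r b ↦ ?_
  · have := DFunLike.congr_fun h2 a
    simpa [sub_eq_zero] using this
  · have h3 : ιA r * ∏ i, x i ^ b i = θ (ι r * ∏ i, t i ^ b (.inr i)) *
        ∏ i, s i ^ (b.comapDomain Sum.inl Sum.inl_injective.injOn) i := by
      simp only [map_mul, hι, map_prod, map_pow, ht, hs, Fintype.prod_sum_type,
        Finsupp.comapDomain_apply]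
      ring
    rw [AddMonoidHom.sub_apply, hA.hasse_const_mul, hA.hasse_monomial, h3, hAs.hasse_const_mul,
      hAs.hasse_monomial, sub_eq_zero]
    simp only [map_mul, hι, map_prod, map_pow, ht, hs, Fintype.prod_sum_type,
        Finsupp.comapDomain_apply, Finsupp.sumElim_inl, Finsupp.sumElim_inr]
    simp
    ring

/-- The two multi-indices have disjoint supports, so every binomial coefficient in the composition
formula is `1`. -/
lemma hasse_sumElim (hA : IsTaylor ιA x τ) (hu : (polyHom ιA x).FormallyUnramified)
    (α : ρ →₀ ℕ) (β : σ →₀ ℕ) (a : A) :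
    hasse τ (Finsupp.sumElim α β) a =
      hasse τ (Finsupp.sumElim 0 β) (hasse τ (Finsupp.sumElim α 0) a) := by
  rw [hA.hasse_hasse hu]
  have h1 : (Finsupp.sumElim 0 β : ρ ⊕ σ →₀ ℕ) + Finsupp.sumElim α 0 = Finsupp.sumElim α β := by
    ext (i | i) <;> simp
  rw [h1, Fintype.prod_sum_type]
  simp

end Tower

variable {X S T : Scheme.{u}}

/-- A smooth morphism is locally standard smooth, and a standard smooth algebra is étale over a
polynomial ring. -/
lemma exists_coord (g : X ⟶ T) [Smooth g] {W : T.Opens} (hW : IsAffineOpen W) {V : X.Opens}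
    {x : X} (hx : x ∈ V) (hxW : g x ∈ W) :
    ∃ (U : X.Opens) (n : ℕ), U ≤ V ∧ x ∈ U ∧ Nonempty (Coord g W U (Fin n)) := by
  have hx' : x ∈ V ⊓ g ⁻¹ᵁ W := ⟨hx, hxW⟩
  obtain ⟨V₁, hV₁, hxV₁, aV₁⟩ := exists_affine hx'
  have hsm := g.smooth_appLE hW aV₁ (hV₁.trans inf_le_right)
  obtain ⟨s, hs, H⟩ := hsm.locally_isStandardSmooth
  rw [← aV₁.iSup_basicOpen_eq_self_iff] at hs
  have hxs := hxV₁
  rw [← hs] at hxs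
  obtain ⟨⟨t, ht⟩, hxt⟩ := Opens.mem_iSup.mp hxs
  have : IsLocalization.Away t Γ(X, X.basicOpen t) := aV₁.isLocalization_basicOpen t
  let e : Localization.Away t ≃ₐ[Γ(X, V₁)] Γ(X, X.basicOpen t) :=
    IsLocalization.algEquiv (.powers t) _ _
  have h1 := RingHom.isStandardSmooth_respectsIso.1 _ e.toRingEquiv (H t ht)
  have hle : X.basicOpen t ≤ g ⁻¹ᵁ W := (X.basicOpen_le t).trans (hV₁.trans inf_le_right)
  have h2 : (e.toRingEquiv.toRingHom.comp ((algebraMap Γ(X, V₁) (Localization.Away t)).comp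
      (g.appLE W V₁ (hV₁.trans inf_le_right)).hom)) = (g.appLE W (X.basicOpen t) hle).hom := by
    ext r
    have h3 : e (algebraMap _ _ ((g.appLE W V₁ (hV₁.trans inf_le_right)).hom r)) = _ :=
      e.commutes _
    refine h3.trans ?_
    exact resO_appLE g (X.basicOpen_le t) _ r
  rw [h2] at h1
  obtain ⟨n, φ, hφ, hφ'⟩ := h1.exists_etale_mvPolynomial
  refine ⟨X.basicOpen t, n, (X.basicOpen_le t).trans (hV₁.trans inf_le_left), hxt,
    ⟨⟨hW, aV₁.basicOpen t, hle, fun i ↦ φ (MvPolynomial.X i), ?_⟩⟩⟩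
  convert hφ' using 1
  refine MvPolynomial.ringHom_ext (fun r ↦ ?_) fun i ↦ ?_
  · simp [polyHom, ← hφ]
  · simp [polyHom]

/-! ### Operators in the joint coordinates of a composite -/

section Composite

variable {f : X ⟶ S} {q : S ⟶ T} {W₀ : T.Opens} {W : S.Opens} {U : X.Opens} {ρ σ : Type}

/-- Coordinates for a composite morphism. -/
def Coord.comp (cf : Coord f W U ρ) (cS : Coord q W₀ W σ) : Coord (f ≫ q) W₀ U (ρ ⊕ σ) where
  affine_base := cS.affine_base
  affine := cf.affine
  le := cf.le.trans (f.preimage_mono cS.le)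
  x := Sum.elim cf.x (fun i ↦ (f.appLE W U cf.le).hom (cS.x i))
  etale := by
    refine etale_polyHom_sum (fun r ↦ ?_) cS.etale cf.etale
    rw [← RingHom.comp_apply, ← CommRingCat.hom_comp, Scheme.Hom.appLE_comp_appLE]

lemma Coord.comp_restr (cf : Coord f W U ρ) (cS : Coord q W₀ W σ) {V : X.Opens}
    (aV : IsAffineOpen V) (h : V ≤ U) :
    (cf.comp cS).restr aV h = (cf.restr aV h).comp cS := by
  ext (i | i)
  · rfl
  · exact resO_appLE f h cf.le (cS.x i)

variable [Fintype ρ] [Fintype σ]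

lemma Coord.comp_const (cf : Coord f W U ρ) (cS : Coord q W₀ W σ) (r : Γ(T, W₀)) :
    (f.appLE W U cf.le).hom ((q.appLE W₀ W cS.le).hom r) =
      ((f ≫ q).appLE W₀ U (cf.comp cS).le).hom r := by
  rw [← RingHom.comp_apply, ← CommRingCat.hom_comp, Scheme.Hom.appLE_comp_appLE]

lemma Coord.diffIncl_op (cf : Coord f W U ρ) (cS : Coord q W₀ W σ) (α : ρ →₀ ℕ) :
    diffIncl f q U (cf.op α) = (cf.comp cS).op (Finsupp.sumElim α 0) := by
  refine diffOp_ext fun V hV aV a ↦ ?_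
  rw [Coord.op_app _ _ hV aV, Coord.comp_restr]
  refine (cf.op_app α hV aV a).trans ?_
  exact (hasse_inl (x := ((cf.restr aV hV).comp cS).x) ((cf.restr aV hV).comp_const cS)
    (fun i ↦ rfl) (fun i ↦ rfl) ((cf.restr aV hV).comp cS).isTaylor
    (cf.restr aV hV).isTaylor ((cf.restr aV hV).comp cS).etale.formallyUnramified α a).symm

/-- The relative factor stands on the right: it acts first, and for `α ≠ 0` it annihilates
relatively horizontal sections. -/
lemma Coord.op_sumElim (cf : Coord f W U ρ) (cS : Coord q W₀ W σ) (α : ρ →₀ ℕ) (β : σ →₀ ℕ) :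
    (cf.comp cS).op (Finsupp.sumElim α β) =
      (cf.comp cS).op (Finsupp.sumElim 0 β) * diffIncl f q U (cf.op α) := by
  rw [cf.diffIncl_op cS]
  refine diffOp_ext fun V hV aV a ↦ ?_
  have h := hasse_sumElim ((cf.comp cS).restr aV hV).isTaylor
    ((cf.comp cS).restr aV hV).etale.formallyUnramified α β a
  rw [Coord.op_app _ _ hV aV, h, ← Coord.op_app, ← Coord.op_app]
  rfl

lemma isLift_of_affine {W : S.Opens} {D' : diffOp q W} {U : X.Opens} {D : diffOp (f ≫ q) U}
    (H : ∀ (W' : S.Opens) (hW : W' ≤ W) (V : X.Opens) (hV : V ≤ U) (h : V ≤ f ⁻¹ᵁ W')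
      (a : Γ(S, W')), IsAffineOpen W' → IsAffineOpen V →
      diffApply D hV (f.appLE W' V h a) = f.appLE W' V h (diffApply D' hW a)) : IsLift D' D := by
  intro W' hW V hV h a
  refine eqO_of_local _ _ fun y hy ↦ ?_
  have hyW : f y ∈ W' := h hy
  obtain ⟨W'', hW'', hyW'', aW''⟩ := exists_affine hyW
  have hyV : y ∈ V ⊓ f ⁻¹ᵁ W'' := ⟨hy, hyW''⟩
  obtain ⟨V', hV', hyV', aV'⟩ := exists_affine hyV
  refine ⟨V', hV'.trans inf_le_left, hyV', ?_⟩
  have h1 (b : Γ(S, W')) : resO (hV'.trans inf_le_left) (f.appLE W' V h b) =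
      f.appLE W'' V' (hV'.trans inf_le_right) (resO hW'' b) := by
    rw [resO_appLE]
    simp only [resO, ← RingHom.comp_apply, ← CommRingCat.hom_comp, Scheme.Hom.map_appLE]
  have h2 := H W'' (hW''.trans hW) V' (hV'.trans (inf_le_left.trans hV))
    (hV'.trans inf_le_right) (resO hW'' a) aW'' aV'
  rw [h1]
  simp only [diffApply] at h2 ⊢
  rw [← D.1.app_res, h1, h2, D'.1.app_res]

lemma Coord.isLift_op (cf : Coord f W U ρ) (cS : Coord q W₀ W σ) (β : σ →₀ ℕ) :
    IsLift (cS.op β) ((cf.comp cS).op (Finsupp.sumElim 0 β)) := by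
  refine isLift_of_affine fun W' hW V hV h a aW' aV ↦ ?_
  rw [Coord.op_app _ _ hV aV, Coord.op_app _ _ hW aW']
  refine hasse_baseHom (θ := (f.appLE W' V h).hom) (fun r ↦ ?_) (fun i ↦ ?_) (cS.restr aW' hW).isTaylor
    ((cf.comp cS).restr aV hV).isTaylor (cS.restr aW' hW).etale.formallyUnramified β a
  · rw [← RingHom.comp_apply, ← CommRingCat.hom_comp, Scheme.Hom.appLE_comp_appLE]
  · change f.appLE W' V h (resO hW (cS.x i)) = resO hV (f.appLE W U cf.le (cS.x i))
    rw [resO_appLE]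
    simp only [resO, ← RingHom.comp_apply, ← CommRingCat.hom_comp, Scheme.Hom.map_appLE]

end Composite

end

section

variable {X S T : Scheme.{u}}

lemma appLE_resO (g : X ⟶ T) {W W' : T.Opens} (hW : W' ≤ W) {V : X.Opens} (h : V ≤ g ⁻¹ᵁ W')
    (a : Γ(T, W)) : g.appLE W' V h (resO hW a) = g.appLE W V (h.trans (g.preimage_mono hW)) a := by
  simp only [resO, ← RingHom.comp_apply, ← CommRingCat.hom_comp, Scheme.Hom.map_appLE]

section Apply

variable {g : X ⟶ T} {M : X.Modules} (N : Stratification g M) {U : X.Opens}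

lemma Stratification.apply_mul (D D' : diffOp g U) (e : Γ(M, U)) :
    N.apply (D * D') e = N.apply D (N.apply D' e) := by
  simp only [Stratification.apply, map_mul]
  rfl

lemma Stratification.apply_one (e : Γ(M, U)) : N.apply (1 : diffOp g U) e = e := by
  simp only [Stratification.apply, map_one]
  rfl

lemma Stratification.apply_add (D D' : diffOp g U) (e : Γ(M, U)) :
    N.apply (D + D') e = N.apply D e + N.apply D' e := by
  simp only [Stratification.apply, map_add]
  rfl

lemma Stratification.apply_sub (D D' : diffOp g U) (e : Γ(M, U)) :
    N.apply (D - D') e = N.apply D e - N.apply D' e := by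
  simp only [Stratification.apply, map_sub, EndM.sub_app]
  rfl

lemma Stratification.apply_zero (e : Γ(M, U)) : N.apply (0 : diffOp g U) e = 0 := by
  simp only [Stratification.apply, map_zero]
  rfl

lemma Stratification.apply_sum {ι : Type*} (s : Finset ι) (D : ι → diffOp g U) (e : Γ(M, U)) :
    N.apply (∑ i ∈ s, D i) e = ∑ i ∈ s, N.apply (D i) e := by
  classical
  induction s using Finset.induction_on with
  | empty => simp [N.apply_zero]
  | insert i s hi ih => rw [Finset.sum_insert hi, Finset.sum_insert hi, N.apply_add, ih]

lemma Stratification.apply_diffMul (a : Γ(X, U)) (e : Γ(M, U)) :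
    N.apply (diffMul g U a) e = a • e := by
  simp only [Stratification.apply, N.act_mul, EndM.mul_apply, resO_self]

lemma Stratification.apply_add_right (D : diffOp g U) (e e' : Γ(M, U)) :
    N.apply D (e + e') = N.apply D e + N.apply D e' := map_add _ _ _

lemma Stratification.apply_zero_right (D : diffOp g U) :
    N.apply D (0 : Γ(M, U)) = 0 := map_zero _

lemma diffApply_res (D : diffOp g U) {V V' : X.Opens} (hV : V ≤ U) (h : V' ≤ V) (a : Γ(X, V)) :
    resO h (diffApply D hV a) = diffApply D (h.trans hV) (resO h a) :=
  (D.1.app_res V V' hV h a).symm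

lemma diffApply_diffMul (a : Γ(X, U)) {V : X.Opens} (hV : V ≤ U) (b : Γ(X, V)) :
    diffApply (diffMul g U a) hV b = resO hV a * b := rfl

lemma diffApply_sum {ι : Type*} (s : Finset ι) (D : ι → diffOp g U) {V : X.Opens} (hV : V ≤ U)
    (b : Γ(X, V)) :
    diffApply (∑ i ∈ s, D i) hV b = ∑ i ∈ s, diffApply (D i) hV b := by
  classical
  induction s using Finset.induction_on with
  | empty => simp; rfl
  | insert i s hi ih =>
    rw [Finset.sum_insert hi, Finset.sum_insert hi, ← ih]
    rfl

end Apply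

/-! ### Lifts of operators and their action on horizontal sections -/

section Lift

variable {f : X ⟶ S} {q : S ⟶ T}

lemma IsLift.restr {W : S.Opens} {D' : diffOp q W} {U V : X.Opens} {D : diffOp (f ≫ q) U}
    (h : IsLift D' D) (hV : V ≤ U) : IsLift D' (diffRestr (f ≫ q) hV D) :=
  fun W' hW V' hV' h' a ↦ h W' hW V' (hV'.trans hV) h' a

lemma IsLift.restr_base {W W₁ : S.Opens} {D' : diffOp q W} {U : X.Opens} {D : diffOp (f ≫ q) U}
    (h : IsLift D' D) (hW₁ : W₁ ≤ W) : IsLift (diffRestr q hW₁ D') D :=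
  fun W' hW V' hV' h' a ↦ h W' (hW.trans hW₁) V' hV' h' a

/-- Lifts can be tested on a smaller open subset of the base over which everything lives. -/
lemma IsLift.of_restr_base {W W₁ : S.Opens} {D' : diffOp q W} {U : X.Opens}
    {D : diffOp (f ≫ q) U} (hW₁ : W₁ ≤ W) (hU : U ≤ f ⁻¹ᵁ W₁)
    (h : IsLift (diffRestr q hW₁ D') D) : IsLift D' D := by
  intro W' hW V hV hV' a
  have hle : V ≤ f ⁻¹ᵁ (W' ⊓ W₁) := fun y hy ↦ ⟨hV' hy, hU (hV hy)⟩
  have h1 (b : Γ(S, W')) : f.appLE W' V hV' b = f.appLE (W' ⊓ W₁) V hle (resO inf_le_left b) :=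
    (appLE_resO f inf_le_left hle b).symm
  rw [h1, h1, h (W' ⊓ W₁) inf_le_right V hV, diffApply_res]
  rfl

lemma IsLift.add {W : S.Opens} {D₁' D₂' : diffOp q W} {U : X.Opens} {D₁ D₂ : diffOp (f ≫ q) U}
    (h₁ : IsLift D₁' D₁) (h₂ : IsLift D₂' D₂) : IsLift (D₁' + D₂') (D₁ + D₂) := by
  intro W' hW V hV h a
  have e₁ := h₁ W' hW V hV h a
  have e₂ := h₂ W' hW V hV h a
  change diffApply D₁ hV _ + diffApply D₂ hV _ =
    f.appLE W' V h (diffApply D₁' hW a + diffApply D₂' hW a)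
  rw [e₁, e₂, map_add]

lemma isLift_zero (W : S.Opens) (U : X.Opens) :
    IsLift (0 : diffOp q W) (0 : diffOp (f ≫ q) U) := by
  intro W' hW V hV h a
  exact (map_zero (f.appLE W' V h).hom).symm

lemma IsLift.sub {W : S.Opens} {D₁' D₂' : diffOp q W} {U : X.Opens} {D₁ D₂ : diffOp (f ≫ q) U}
    (h₁ : IsLift D₁' D₁) (h₂ : IsLift D₂' D₂) : IsLift (D₁' - D₂') (D₁ - D₂) := by
  intro W' hW V hV h a
  have e₁ := h₁ W' hW V hV h a
  have e₂ := h₂ W' hW V hV h a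
  have e₃ : diffApply (D₁ - D₂) hV (f.appLE W' V h a) =
      diffApply D₁ hV (f.appLE W' V h a) - diffApply D₂ hV (f.appLE W' V h a) := by
    simp only [diffApply]; rw [← AddMonoidHom.sub_apply, ← EndO.sub_app]; rfl
  have e₄ : diffApply (D₁' - D₂') hW a = diffApply D₁' hW a - diffApply D₂' hW a := by
    simp only [diffApply]; rw [← AddMonoidHom.sub_apply, ← EndO.sub_app]; rfl
  rw [e₃, e₄, e₁, e₂, map_sub]

lemma IsLift.mul {W : S.Opens} {D₁' D₂' : diffOp q W} {U : X.Opens} {D₁ D₂ : diffOp (f ≫ q) U}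
    (h₁ : IsLift D₁' D₁) (h₂ : IsLift D₂' D₂) : IsLift (D₁' * D₂') (D₁ * D₂) := by
  intro W' hW V hV h a
  change diffApply D₁ hV (diffApply D₂ hV _) = f.appLE W' V h (diffApply D₁' hW (diffApply D₂' hW a))
  rw [h₂ W' hW V hV h a, h₁ W' hW V hV h]

lemma isLift_one (W : S.Opens) (U : X.Opens) :
    IsLift (1 : diffOp q W) (1 : diffOp (f ≫ q) U) := fun W' hW V hV h a ↦ rfl

lemma isLift_diffMul {W : S.Opens} {U : X.Opens} (hU : U ≤ f ⁻¹ᵁ W) (b : Γ(S, W)) :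
    IsLift (diffMul q W b) (diffMul (f ≫ q) U (f.appLE W U hU b)) := by
  intro W' hW V hV h a
  rw [diffApply_diffMul, diffApply_diffMul, map_mul, resO_appLE]
  congr 1
  simp only [resO, ← RingHom.comp_apply, ← CommRingCat.hom_comp, Scheme.Hom.map_appLE]

lemma IsLift.sum {ι : Type*} (s : Finset ι) {W : S.Opens} {D' : ι → diffOp q W} {U : X.Opens}
    {D : ι → diffOp (f ≫ q) U} (h : ∀ i ∈ s, IsLift (D' i) (D i)) :
    IsLift (∑ i ∈ s, D' i) (∑ i ∈ s, D i) := by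
  classical
  induction s using Finset.induction_on with
  | empty => exact isLift_zero W U
  | insert i s hi ih =>
    rw [Finset.sum_insert hi, Finset.sum_insert hi]
    exact (h i (Finset.mem_insert_self _ _)).add
      (ih fun j hj ↦ h j (Finset.mem_insert_of_mem hj))

variable [Smooth f] [Smooth q]

lemma exists_coord_tower (f : X ⟶ S) (q : S ⟶ T) [Smooth f] [Smooth q] {x : X} {V : X.Opens}
    (hx : x ∈ V) {W : S.Opens} (hxW : f x ∈ W) :
    ∃ (W₀ : T.Opens) (W₁ : S.Opens) (U : X.Opens) (m n : ℕ), W₁ ≤ W ∧ U ≤ V ∧ x ∈ U ∧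
      Nonempty (Coord q W₀ W₁ (Fin m)) ∧ Nonempty (Coord f W₁ U (Fin n)) := by
  obtain ⟨W₀, -, hxW₀, aW₀⟩ := exists_affine (show q (f x) ∈ (⊤ : T.Opens) from trivial)
  obtain ⟨W₁, m, hW₁, hxW₁, ⟨cS⟩⟩ := exists_coord q aW₀ hxW hxW₀
  obtain ⟨U, n, hU, hxU, ⟨cf⟩⟩ := exists_coord f cS.affine hx hxW₁
  exact ⟨W₀, W₁, U, m, n, hW₁, hU, hxU, ⟨cS⟩, ⟨cf⟩⟩

/-- Differential operators on the base lift locally. -/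
lemma exists_isLift {W : S.Opens} (D' : diffOp q W) {V : X.Opens} (hV : V ≤ f ⁻¹ᵁ W) {x : X}
    (hx : x ∈ V) : ∃ U ≤ V, x ∈ U ∧ ∃ D : diffOp (f ≫ q) U, IsLift D' D := by
  obtain ⟨W₁, hW₁, n, hxW₁, hn⟩ := D'.2 (f x) (hV hx)
  obtain ⟨W₀, W₂, U, m, l, hW₂, hU, hxU, ⟨cS⟩, ⟨cf⟩⟩ := exists_coord_tower f q hx hxW₁
  refine ⟨U, hU, hxU, ?_⟩
  -- The expansion of `D'` in base coordinates is lifted term by term. No coefficient is required to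
  -- vanish, hence the predicate `False`.
  obtain ⟨a, -, ha⟩ := cS.exists_expansion (diffRestr q (hW₂.trans hW₁) D') (hn.restr hW₂)
    (fun _ ↦ False) (fun _ _ _ ↦ id) (fun _ h ↦ h.elim)
  refine ⟨∑ β ∈ indices (Fin m) n, diffMul (f ≫ q) U (f.appLE W₂ U cf.le (a β)) *
    (cf.comp cS).op (Finsupp.sumElim 0 β), IsLift.of_restr_base (hW₂.trans hW₁) cf.le ?_⟩
  rw [ha]
  exact IsLift.sum _ fun β _ ↦ (isLift_diffMul cf.le (a β)).mul (cf.isLift_op cS β)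

variable {M : X.Modules} (N : Stratification (f ≫ q) M)

/-- Differential operators vanishing on the functions of the base annihilate relatively horizontal
sections. -/
lemma apply_eq_zero_of_isLift_zero {W : S.Opens} {U : X.Opens} (hU : U ≤ f ⁻¹ᵁ W)
    {D : diffOp (f ≫ q) U} (hD : IsLift (0 : diffOp q W) D) {e : Γ(M, U)}
    (he : N.relative.IsHorizontal e) : N.apply D e = 0 := by
  refine eqM_of_local M _ _ fun x hx ↦ ?_
  obtain ⟨U₁, hU₁, n, hxU₁, hn⟩ := D.2 x hx
  obtain ⟨W₀, W₁, U₂, m, l, hW₁, hU₂, hxU₂, ⟨cS⟩, ⟨cf⟩⟩ := exists_coord_tower f q hxU₁ (hU hx)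
  refine ⟨U₂, hU₂.trans hU₁, hxU₂, ?_⟩
  rw [map_zero, N.resM_apply]
  -- Monomials without relative coordinates are functions of the base, and `D` annihilates those. So
  -- no term with `α = 0` occurs, and every other term applies first a relative operator that kills
  -- `1`.
  obtain ⟨a, ha0, ha⟩ := (cf.comp cS).exists_expansion (diffRestr (f ≫ q) (hU₂.trans hU₁) D)
    (hn.restr hU₂) (fun b ↦ ∀ i, b (.inl i) = 0)
    (fun b b' hb h i ↦ Nat.le_zero.mp (h i ▸ hb (.inl i))) (fun b hb ↦ by
      have h1 : ∏ i, (cf.comp cS).x i ^ b i =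
          f.appLE W₁ U₂ cf.le (∏ i, cS.x i ^ b (.inr i)) := by
        rw [map_prod, Fintype.prod_sum_type]
        simp only [hb, pow_zero, Finset.prod_const_one, one_mul, map_pow]
        rfl
      rw [h1]
      refine (hD W₁ hW₁ U₂ (hU₂.trans hU₁) cf.le _).trans ?_
      exact map_zero (f.appLE W₁ U₂ cf.le).hom)
  rw [ha, N.apply_sum]
  refine Finset.sum_eq_zero fun γ _ ↦ ?_
  obtain ⟨⟨α, β⟩, rfl⟩ := Finsupp.sumFinsuppEquivProdFinsupp.symm.surjective γ
  change N.apply (diffMul (f ≫ q) U₂ (a (Finsupp.sumElim α β)) *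
    (cf.comp cS).op (Finsupp.sumElim α β)) _ = 0
  by_cases hα : α = 0
  · rw [ha0 _ (by simp [hα]), map_zero, zero_mul, N.apply_zero]
  · rw [cf.op_sumElim cS, N.apply_mul, N.apply_mul]
    have : N.apply (diffIncl f q U₂ (cf.op α)) (resM M (hU₂.trans hU₁) e) = 0 := by
      refine he U₂ (hU₂.trans hU₁) (cf.op α) ?_
      rw [cf.op_app_self, cf.isTaylor.hasse_one hα]
    rw [this, N.apply_zero_right, N.apply_zero_right]

lemma apply_eq_of_isLift {W : S.Opens} {D' : diffOp q W} {U : X.Opens} (hU : U ≤ f ⁻¹ᵁ W)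
    {D₁ D₂ : diffOp (f ≫ q) U} (h₁ : IsLift D' D₁) (h₂ : IsLift D' D₂) {e : Γ(M, U)}
    (he : N.relative.IsHorizontal e) : N.apply D₁ e = N.apply D₂ e := by
  rw [← sub_eq_zero, ← N.apply_sub]
  refine apply_eq_zero_of_isLift_zero N hU ?_ he
  have := h₁.sub h₂
  rwa [sub_self] at this

/-- The value through a lift is independent of the lift and lifts exist locally, so local values
glue. `Y` need not be a full preimage: the action is later used on the union of a `FibreCover`. -/
lemma exists_gaussManin {W : S.Opens} (D' : diffOp q W) {Y : X.Opens} (hY : Y ≤ f ⁻¹ᵁ W)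
    {e : Γ(M, Y)} (he : N.relative.IsHorizontal e) :
    ∃ s : Γ(M, Y), ∀ (U : X.Opens) (h : U ≤ Y) (D : diffOp (f ≫ q) U), IsLift D' D →
      resM M h s = N.apply D (resM M h e) := by
  obtain ⟨t, ht⟩ := exists_glueM M (V := Y) (fun U ↦ ∃ D : diffOp (f ≫ q) U, IsLift D' D)
    (fun V' hV' x hx ↦ exists_isLift D' (hV'.trans hY) hx)
    (fun U hU p ↦ N.apply p.choose (resM M hU e)) fun V' V'' h' p' h p'' ↦ by
      rw [N.resM_apply, resM_resM]
      exact apply_eq_of_isLift N ((h.trans h').trans hY) (p'.choose_spec.restr h) p''.choose_spec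
        (he.res _ _)
  refine ⟨t, fun U h D hD ↦ ?_⟩
  rw [ht U h ⟨D, hD⟩]
  exact apply_eq_of_isLift N (h.trans hY) (Exists.choose_spec _) hD (he.res _ _)

/-- The action of a differential operator of the base on a relatively horizontal section. -/
def gaussManin {W : S.Opens} (D' : diffOp q W) {Y : X.Opens} (hY : Y ≤ f ⁻¹ᵁ W)
    {e : Γ(M, Y)} (he : N.relative.IsHorizontal e) : Γ(M, Y) :=
  (exists_gaussManin N D' hY he).choose

lemma resM_gaussManin {W : S.Opens} (D' : diffOp q W) {Y : X.Opens} (hY : Y ≤ f ⁻¹ᵁ W)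
    {e : Γ(M, Y)} (he : N.relative.IsHorizontal e) {U : X.Opens} (h : U ≤ Y)
    {D : diffOp (f ≫ q) U} (hD : IsLift D' D) :
    resM M h (gaussManin N D' hY he) = N.apply D (resM M h e) :=
  (exists_gaussManin N D' hY he).choose_spec U h D hD

lemma eq_gaussManin {W : S.Opens} (D' : diffOp q W) {Y : X.Opens} (hY : Y ≤ f ⁻¹ᵁ W)
    {e : Γ(M, Y)} (he : N.relative.IsHorizontal e) {s : Γ(M, Y)}
    (hs : ∀ (U : X.Opens) (h : U ≤ Y) (D : diffOp (f ≫ q) U), IsLift D' D →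
      resM M h s = N.apply D (resM M h e)) : s = gaussManin N D' hY he := by
  refine eqM_of_local M _ _ fun x hx ↦ ?_
  obtain ⟨U, hU, hxU, D, hD⟩ := exists_isLift D' hY hx
  exact ⟨U, hU, hxU, by rw [hs U hU D hD, resM_gaussManin N D' hY he hU hD]⟩

/-- If `D` is relative with `D(1) = 0` and `D₁` lifts `D'`, then `D D₁` lifts zero, because
`D(f^*(D' a)) = f^*(D' a) D(1) = 0`. -/
lemma isHorizontal_gaussManin {W : S.Opens} (D' : diffOp q W) {Y : X.Opens} (hY : Y ≤ f ⁻¹ᵁ W)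
    {e : Γ(M, Y)} (he : N.relative.IsHorizontal e) :
    N.relative.IsHorizontal (gaussManin N D' hY he) := by
  intro V h D hD
  refine eqM_of_local M _ _ fun x hx ↦ ?_
  obtain ⟨U, hU, hxU, D₁, hD₁⟩ := exists_isLift D' (h.trans hY) hx
  refine ⟨U, hU, hxU, ?_⟩
  rw [map_zero, N.relative.resM_apply, resM_resM, resM_gaussManin N D' hY he _ hD₁]
  change N.apply (diffIncl f q U (diffRestr f hU D)) _ = 0
  rw [← N.apply_mul]
  refine apply_eq_zero_of_isLift_zero N ((hU.trans h).trans hY) (W := W) ?_ (he.res _ _)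
  intro W' hW V' hV' h' a
  change diffApply D _ (diffApply D₁ hV' _) = f.appLE W' V' h' 0
  rw [hD₁ W' hW V' hV' h', map_zero]
  have h1 := D.1.app_linear V' (hV'.trans hU) W' h' (diffApply D' hW a) 1
  rw [mul_one] at h1
  refine h1.trans ?_
  have h2 := diffApply_res D le_rfl (hV'.trans hU) 1
  rw [hD, map_zero, map_one] at h2
  rw [show D.1.app V' _ 1 = 0 from h2.symm, mul_zero]

/-- The action on horizontal sections is compatible with restriction. -/
lemma resM_gaussManin_eq {W W' : S.Opens} (D' : diffOp q W) {Y Y' : X.Opens} (hY : Y ≤ f ⁻¹ᵁ W)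
    {e : Γ(M, Y)} (he : N.relative.IsHorizontal e) (hW' : W' ≤ W) (h : Y' ≤ Y)
    (hY' : Y' ≤ f ⁻¹ᵁ W') :
    resM M h (gaussManin N D' hY he) =
      gaussManin N (diffRestr q hW' D') hY' (he.res N.relative h) := by
  refine eqM_of_local M _ _ fun x hx ↦ ?_
  obtain ⟨U, hU, hxU, D, hD⟩ := exists_isLift D' (h.trans hY) hx
  refine ⟨U, hU, hxU, ?_⟩
  rw [resM_resM, resM_gaussManin N D' hY he _ hD,
    resM_gaussManin N _ hY' _ hU (hD.restr_base hW'), resM_resM]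

lemma gaussManin_add {W : S.Opens} (D' : diffOp q W) {Y : X.Opens} (hY : Y ≤ f ⁻¹ᵁ W)
    {e e' : Γ(M, Y)} (he : N.relative.IsHorizontal e) (he' : N.relative.IsHorizontal e') :
    gaussManin N D' hY (he.add N.relative he') =
      gaussManin N D' hY he + gaussManin N D' hY he' := by
  refine (eq_gaussManin N D' hY _ fun U h D hD ↦ ?_).symm
  rw [map_add, map_add, resM_gaussManin N D' hY he h hD, resM_gaussManin N D' hY he' h hD,
    N.apply_add_right]

lemma gaussManin_zero {W : S.Opens} (D' : diffOp q W) {Y : X.Opens} (hY : Y ≤ f ⁻¹ᵁ W) :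
    gaussManin N D' hY (N.relative.isHorizontal_zero Y) = 0 := by
  refine (eq_gaussManin N D' hY _ fun U h D hD ↦ ?_).symm
  rw [map_zero, N.apply_zero_right]

lemma gaussManin_add_left {W : S.Opens} (D₁ D₂ : diffOp q W) {Y : X.Opens} (hY : Y ≤ f ⁻¹ᵁ W)
    {e : Γ(M, Y)} (he : N.relative.IsHorizontal e) :
    gaussManin N (D₁ + D₂) hY he = gaussManin N D₁ hY he + gaussManin N D₂ hY he := by
  refine eqM_of_local M _ _ fun x hx ↦ ?_
  obtain ⟨U₁, hU₁, hxU₁, L₁, hL₁⟩ := exists_isLift D₁ hY hx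
  obtain ⟨U, hU, hxU, L₂, hL₂⟩ := exists_isLift D₂ (hU₁.trans hY) hxU₁
  refine ⟨U, hU.trans hU₁, hxU, ?_⟩
  rw [map_add, resM_gaussManin N _ hY he _ ((hL₁.restr hU).add hL₂),
    resM_gaussManin N _ hY he _ (hL₁.restr hU), resM_gaussManin N _ hY he _ hL₂, N.apply_add]

lemma gaussManin_mul {W : S.Opens} (D₁ D₂ : diffOp q W) {Y : X.Opens} (hY : Y ≤ f ⁻¹ᵁ W)
    {e : Γ(M, Y)} (he : N.relative.IsHorizontal e) :
    gaussManin N (D₁ * D₂) hY he =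
      gaussManin N D₁ hY (isHorizontal_gaussManin N D₂ hY he) := by
  refine eqM_of_local M _ _ fun x hx ↦ ?_
  obtain ⟨U₁, hU₁, hxU₁, L₁, hL₁⟩ := exists_isLift D₁ hY hx
  obtain ⟨U, hU, hxU, L₂, hL₂⟩ := exists_isLift D₂ (hU₁.trans hY) hxU₁
  refine ⟨U, hU.trans hU₁, hxU, ?_⟩
  rw [resM_gaussManin N _ hY he _ ((hL₁.restr hU).mul hL₂),
    resM_gaussManin N _ hY _ _ (hL₁.restr hU), resM_gaussManin N _ hY he _ hL₂, N.apply_mul]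

lemma gaussManin_diffMul {W : S.Opens} (a : Γ(S, W)) {Y : X.Opens} (hY : Y ≤ f ⁻¹ᵁ W)
    {e : Γ(M, Y)} (he : N.relative.IsHorizontal e) :
    gaussManin N (diffMul q W a) hY he = f.appLE W Y hY a • e := by
  have := resM_gaussManin N _ hY he le_rfl (isLift_diffMul hY a)
  rwa [N.apply_diffMul, resM_self, resM_self] at this

lemma gaussManin_one {W : S.Opens} {Y : X.Opens} (hY : Y ≤ f ⁻¹ᵁ W)
    {e : Γ(M, Y)} (he : N.relative.IsHorizontal e) :
    gaussManin N (1 : diffOp q W) hY he = e := by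
  have := resM_gaussManin N _ hY he le_rfl (isLift_one W Y)
  rwa [N.apply_one, resM_self, resM_self] at this

end Lift

section Pushforward

variable {f : X ⟶ S} {M : X.Modules} (N : Stratification f M)

/-- A horizontal section over `f⁻¹(W)`, as a section of `f_*(M^∇)`. -/
def Stratification.ofSection {W : S.Opens} (e : Γ(M, f ⁻¹ᵁ W)) (he : N.IsHorizontal e) :
    Γ(N.pushforwardHorizontal, W) :=
  (⟨e, he⟩ : {e : Γ(M, f ⁻¹ᵁ W) // N.IsHorizontal e})

lemma Stratification.isHorizontal_toSection {W : S.Opens} (e : Γ(N.pushforwardHorizontal, W)) :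
    N.IsHorizontal (N.toSection e) :=
  Subtype.property (p := fun e ↦ N.IsHorizontal (U := f ⁻¹ᵁ W) e) e

lemma Stratification.toSection_injective {W : S.Opens} :
    Function.Injective (N.toSection (W := W)) :=
  Subtype.val_injective (p := fun e ↦ N.IsHorizontal (U := f ⁻¹ᵁ W) e)

lemma Stratification.toSection_add {W : S.Opens} (e e' : Γ(N.pushforwardHorizontal, W)) :
    N.toSection (e + e') = N.toSection e + N.toSection e' := rfl

lemma Stratification.toSection_smul {W : S.Opens} (a : Γ(S, W))
    (e : Γ(N.pushforwardHorizontal, W)) :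
    N.toSection (a • e) = f.appLE W (f ⁻¹ᵁ W) le_rfl a • N.toSection e := by
  rw [← Scheme.Hom.app_eq_appLE]
  rfl

lemma Stratification.toSection_resM {W W' : S.Opens} (h : W' ≤ W)
    (e : Γ(N.pushforwardHorizontal, W)) :
    N.toSection (resM _ h e) = resM M (f.preimage_mono h) (N.toSection e) := rfl

end Pushforward

section Induced

variable {f : X ⟶ S} {q : S ⟶ T} [Smooth f] [Smooth q] {M : X.Modules}
  (N : Stratification (f ≫ q) M)

/-- The action of a differential operator of the base on the pushforward of the relatively
horizontal sections. -/
def gaussManinHom {W : S.Opens} (D' : diffOp q W) :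
    Γ(N.relative.pushforwardHorizontal, W) →+ Γ(N.relative.pushforwardHorizontal, W) where
  toFun e := N.relative.ofSection
    (gaussManin N D' le_rfl (N.relative.isHorizontal_toSection e)) (isHorizontal_gaussManin N _ _ _)
  map_zero' := N.relative.toSection_injective (gaussManin_zero N D' le_rfl)
  map_add' e e' := N.relative.toSection_injective (gaussManin_add N D' le_rfl
    (N.relative.isHorizontal_toSection e) (N.relative.isHorizontal_toSection e'))

lemma toSection_gaussManinHom {W : S.Opens} (D' : diffOp q W)
    (e : Γ(N.relative.pushforwardHorizontal, W)) :
    N.relative.toSection (gaussManinHom N D' e) =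
      gaussManin N D' le_rfl (N.relative.isHorizontal_toSection e) := rfl

lemma gaussManinHom_one {W : S.Opens} :
    gaussManinHom N (1 : diffOp q W) = AddMonoidHom.id _ := by
  ext e
  refine N.relative.toSection_injective ?_
  rw [toSection_gaussManinHom, gaussManin_one]
  rfl

lemma gaussManinHom_mul {W : S.Opens} (D D' : diffOp q W) :
    gaussManinHom N (D * D') = (gaussManinHom N D).comp (gaussManinHom N D') := by
  ext e
  refine N.relative.toSection_injective ?_
  rw [AddMonoidHom.comp_apply, toSection_gaussManinHom, gaussManin_mul]
  rfl

lemma gaussManinHom_add {W : S.Opens} (D D' : diffOp q W) :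
    gaussManinHom N (D + D') = gaussManinHom N D + gaussManinHom N D' := by
  ext e
  refine N.relative.toSection_injective ?_
  rw [AddMonoidHom.add_apply, N.relative.toSection_add, toSection_gaussManinHom,
    gaussManin_add_left]
  rfl

lemma gaussManinHom_zero {W : S.Opens} : gaussManinHom N (0 : diffOp q W) = 0 := by
  have := gaussManinHom_add N (0 : diffOp q W) 0
  rw [add_zero] at this
  exact left_eq_add.mp this

lemma gaussManinHom_diffMul {W : S.Opens} (a : Γ(S, W))
    (e : Γ(N.relative.pushforwardHorizontal, W)) :
    gaussManinHom N (diffMul q W a) e = a • e := by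
  refine N.relative.toSection_injective ?_
  rw [toSection_gaussManinHom, gaussManin_diffMul, N.relative.toSection_smul]

lemma resM_gaussManinHom {V V' : S.Opens} (D' : diffOp q V) (h : V' ≤ V)
    (e : Γ(N.relative.pushforwardHorizontal, V)) :
    gaussManinHom N (diffRestr q h D') (resM _ h e) = resM _ h (gaussManinHom N D' e) := by
  refine N.relative.toSection_injective ?_
  exact (resM_gaussManin_eq N D' le_rfl (N.relative.isHorizontal_toSection e) h
    (f.preimage_mono h) le_rfl).symm

/-- Multiplication by a function of `T` is itself the action of an operator of order zero, and `D'`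
commutes with it. -/
lemma gaussManinHom_linear {V : S.Opens} (D' : diffOp q V) (W' : T.Opens) (h : V ≤ q ⁻¹ᵁ W')
    (a : Γ(T, W')) (e : Γ(N.relative.pushforwardHorizontal, V)) :
    gaussManinHom N D' (q.appLE W' V h a • e) = q.appLE W' V h a • gaussManinHom N D' e := by
  rw [← gaussManinHom_diffMul, ← gaussManinHom_diffMul, ← AddMonoidHom.comp_apply,
    ← AddMonoidHom.comp_apply, ← gaussManinHom_mul, ← gaussManinHom_mul]
  congr 2
  refine diffOp_ext fun V' hV' _ b ↦ ?_
  change D'.1.app V' hV' (resO hV' (q.appLE W' V h a) * b) =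
    resO hV' (q.appLE W' V h a) * D'.1.app V' hV' b
  rw [resO_appLE]
  exact D'.1.app_linear V' hV' W' _ a b

/-- The stratification of the relatively horizontal sections. -/
def gaussManinStratification : Stratification q N.relative.pushforwardHorizontal where
  act W :=
    { toFun := fun D' ↦
        { app := fun V hV ↦ gaussManinHom N (diffRestr q hV D')
          app_res := fun V V' hV h e ↦ resM_gaussManinHom N (diffRestr q hV D') h e
          app_linear := fun V hV W' h a e ↦ gaussManinHom_linear N _ W' h a e }
      map_one' := EndM.ext <| funext fun V ↦ funext fun hV ↦ by
        simp only [map_one]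
        exact gaussManinHom_one N
      map_mul' := fun D D' ↦ EndM.ext <| funext fun V ↦ funext fun hV ↦ by
        simp only [map_mul]
        exact gaussManinHom_mul N _ _
      map_zero' := EndM.ext <| funext fun V ↦ funext fun hV ↦ by
        simp only [map_zero]
        exact gaussManinHom_zero N
      map_add' := fun D D' ↦ EndM.ext <| funext fun V ↦ funext fun hV ↦ by
        simp only [map_add]
        exact gaussManinHom_add N _ _ }
  act_restr h D := rfl
  act_mul W a := EndM.ext <| funext fun V ↦ funext fun hV ↦ by
    ext e
    have h1 : diffRestr q hV (diffMul q W a) = diffMul q V (resO hV a) :=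
      Subtype.ext (EndO.restr_mul hV a)
    change gaussManinHom N (diffRestr q hV (diffMul q W a)) e = resO hV a • e
    rw [h1, gaussManinHom_diffMul]

lemma toSection_gaussManinStratification_apply {W : S.Opens} (D' : diffOp q W)
    (e : Γ(N.relative.pushforwardHorizontal, W)) :
    N.relative.toSection ((gaussManinStratification N).apply D' e) =
      gaussManin N D' le_rfl (N.relative.isHorizontal_toSection e) := rfl

/-- The relatively horizontal sections carry a unique induced stratification. -/
lemma existsUnique_isInduced :
    ∃! N' : Stratification q N.relative.pushforwardHorizontal, IsInduced N N' := by
  refine ⟨gaussManinStratification N, fun W D' e U h D hD ↦ ?_, fun N' hN' ↦ ?_⟩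
  · rw [toSection_gaussManinStratification_apply]
    exact resM_gaussManin N D' le_rfl _ h hD
  · refine Stratification.ext (funext fun W ↦ RingHom.ext fun D' ↦ EndM.ext ?_)
    funext V hV
    ext e
    rw [N'.act_apply, Stratification.act_apply]
    refine N.relative.toSection_injective ?_
    rw [toSection_gaussManinStratification_apply]
    exact eq_gaussManin N _ le_rfl _ fun U h D hD ↦ hN' V _ e U h D hD

end Induced

end

section

/-! ### Sheaves of modules with local bases -/

section FreeSheaf

universe u₁ v₁

variable {C : Type u₁} [Category.{v₁} C] {R : Cᵒᵖ ⥤ RingCat.{u}}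

/-- A morphism of presheaves of modules given by its values on a basis. -/
lemma exists_hom_of_basis (M N : PresheafOfModules.{u} R) {I : Type u} (s : I → M.sections)
    (hli : ∀ V, LinearIndependent (R.obj V) (fun i ↦ (s i).eval V))
    (hsp : ∀ V, ⊤ ≤ Submodule.span (R.obj V) (Set.range fun i ↦ (s i).eval V))
    (t : I → N.sections) :
    ∃ φ : M ⟶ N, ∀ i, PresheafOfModules.sectionsMap φ (s i) = t i := by
  let b (V) : Module.Basis I (R.obj V) (M.obj V) := .mk (hli V) (hsp V)
  have hb (V i) : b V i = (s i).eval V := Module.Basis.mk_apply _ _ _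
  let φ (V) : M.obj V →ₗ[R.obj V] N.obj V := (b V).constr ℤ fun i ↦ (t i).eval V
  have hφ (V i) : φ V ((s i).eval V) = (t i).eval V := by
    rw [← hb]; exact (b V).constr_basis ℤ _ i
  have hnat {V V' : Cᵒᵖ} (g : V ⟶ V') (m : M.obj V) :
      φ V' (M.map g m) = N.map g (φ V m) := by
    induction hsp V (Submodule.mem_top (x := m)) using Submodule.span_induction with
    | mem m hm =>
      obtain ⟨i, rfl⟩ := hm
      rw [hφ, PresheafOfModules.sections_property, PresheafOfModules.sections_property, hφ]
    | zero =>
      refine (congrArg (φ V') (map_zero (M.map g).hom)).trans ((map_zero (φ V')).trans ?_)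
      exact ((congrArg (N.map g) (map_zero (φ V))).trans (map_zero (N.map g).hom)).symm
    | add x y _ _ hx hy =>
      refine (congrArg (φ V') (map_add (M.map g).hom x y)).trans ((map_add (φ V') _ _).trans ?_)
      refine Eq.trans ?_
        ((congrArg (N.map g) (map_add (φ V) x y)).trans (map_add (N.map g).hom _ _)).symm
      exact congrArg₂ (fun a b : N.obj V' ↦ a + b) hx hy
    | smul a x _ hx =>
      refine (congrArg (φ V') (PresheafOfModules.map_smul M g a x)).trans
        ((map_smul (φ V') (R.map g a) _).trans ?_)
      refine Eq.trans ?_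
        ((congrArg (N.map g) (map_smul (φ V) a x)).trans (PresheafOfModules.map_smul N g a _)).symm
      exact congrArg (fun b : N.obj V' ↦ (R.map g a) • b) hx
  refine ⟨{ app := fun V ↦ ModuleCat.ofHom (φ V), naturality := fun {V V'} g ↦ ?_ }, fun i ↦ ?_⟩
  · ext m
    exact hnat g m
  · ext V
    exact hφ V i

lemma hom_ext_of_span {M N : PresheafOfModules.{u} R} {I : Type u} (s : I → M.sections)
    (hsp : ∀ V, ⊤ ≤ Submodule.span (R.obj V) (Set.range fun i ↦ (s i).eval V))
    {φ ψ : M ⟶ N}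
    (h : ∀ i, PresheafOfModules.sectionsMap φ (s i) = PresheafOfModules.sectionsMap ψ (s i)) :
    φ = ψ := by
  ext V m
  induction hsp V (Submodule.mem_top (x := m)) using Submodule.span_induction with
  | mem m hm =>
    obtain ⟨i, rfl⟩ := hm
    exact congrArg (fun s : N.sections ↦ s.eval V) (h i)
  | zero => simp
  | add x y _ _ hx hy => rw [map_add, map_add, hx, hy]
  | smul a x _ hx => rw [map_smul, map_smul, hx]

variable {J : GrothendieckTopology C} {R : Sheaf J RingCat.{u}}
  [HasWeakSheafify J AddCommGrpCat.{u}] [J.WEqualsLocallyBijective AddCommGrpCat.{u}]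

/-- The inverse is defined by sending the basis on every object to the free generators; both
composites are then compared on generating sections. -/
lemma isIso_freeHomEquiv_symm (M : SheafOfModules.{u} R) {I : Type u} (s : I → M.sections)
    (hli : ∀ V, LinearIndependent (R.obj.obj V) (fun i ↦ (s i).eval V))
    (hsp : ∀ V, ⊤ ≤ Submodule.span (R.obj.obj V) (Set.range fun i ↦ (s i).eval V)) :
    IsIso (M.freeHomEquiv.symm s) := by
  obtain ⟨ψ, hψ⟩ := exists_hom_of_basis M.val (SheafOfModules.free (R := R) I).val s hli hsp
    (fun i ↦ SheafOfModules.freeSection i)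
  let ψ' : M ⟶ SheafOfModules.free (R := R) I := ⟨ψ⟩
  refine ⟨ψ', ?_, ?_⟩
  · apply (SheafOfModules.free (R := R) I).freeHomEquiv.injective
    funext i
    rw [SheafOfModules.freeHomEquiv_comp_apply, Equiv.apply_symm_apply]
    exact hψ i
  · apply SheafOfModules.hom_ext
    refine hom_ext_of_span s hsp fun i ↦ ?_
    change SheafOfModules.sectionsMap (ψ' ≫ M.freeHomEquiv.symm s) (s i) = s i
    rw [SheafOfModules.sectionsMap_comp, show SheafOfModules.sectionsMap ψ' (s i) = _ from hψ i,
      SheafOfModules.sectionsMap_freeHomEquiv_symm_freeSection]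

end FreeSheaf

variable {X S : Scheme.{u}}

/-- The sections of the restriction of a sheaf of modules to an open subset. -/
def overSection (F : S.Modules) {W : S.Opens} (s : Γ(F, W)) :
    (SheafOfModules.over (R := S.ringCatSheaf) F W).sections :=
  PresheafOfModules.sectionsMk (fun V ↦ resM F V.unop.hom.le s) fun V V' g ↦
    resM_resM F V.unop.hom.le (g.unop.left.le) s

/-- A sheaf of modules which locally has a finite basis. -/
lemma isLocallyFree_of_basis (F : S.Modules)
    (H : ∀ x : S, ∃ W : S.Opens, x ∈ W ∧ ∃ (n : ℕ) (s : Fin n → Γ(F, W)), ∀ V (hV : V ≤ W),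
      LinearIndependent Γ(S, V) (fun i ↦ resM F hV (s i)) ∧
      ⊤ ≤ Submodule.span Γ(S, V) (Set.range fun i ↦ resM F hV (s i))) :
    F.IsLocallyFree ∧ F.IsFiniteType := by
  choose W hxW n s hs using H
  have hiso (x : S) : IsIso ((SheafOfModules.over (R := S.ringCatSheaf) F (W x)).freeHomEquiv.symm
      (fun i : ULift.{u} (Fin (n x)) ↦ overSection F (s x i.down))) := by
    refine isIso_freeHomEquiv_symm _ _ (fun V ↦ ?_) fun V ↦ ?_
    · exact ((hs x V.unop.left V.unop.hom.le).1).comp ULift.down ULift.down_injective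
    · have := (hs x V.unop.left V.unop.hom.le).2
      rwa [← ULift.down_surjective.range_comp] at this
  let D : SheafOfModules.LocalGeneratorsData.{u} (R := S.ringCatSheaf) F :=
    { I := S
      X := W
      coversTop := by
        rw [Opens.coversTop_iff, IsOpenCover, eq_top_iff]
        exact fun x _ ↦ Opens.mem_iSup.mpr ⟨x, hxW x⟩
      generators := fun x ↦
        { I := ULift.{u} (Fin (n x))
          s := fun i ↦ overSection F (s x i.down)
          epi := have := hiso x; inferInstance } }
  have h1 : D.IsLocallyFreeData := { isIso := fun x ↦ hiso x }
  have h3 (x : S) : (D.generators x).IsFiniteType :=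
    { finite := inferInstanceAs (Finite (ULift (Fin (n x)))) }
  have h2 : D.IsFiniteType := { isFiniteType := fun x ↦ h3 x }
  exact ⟨{ exists_isLocallyFreeData := ⟨D, h1⟩ }, { exists_localGeneratorsData := ⟨D, h2⟩ }⟩

end

/-! ### Quasi-coherent sheaves on affine open subsets -/

section

variable {X : Scheme.{u}}

lemma fromSpec_image_le {U : X.Opens} (hU : IsAffineOpen U) (V : (Spec Γ(X, U)).Opens) :
    hU.fromSpec ''ᵁ V ≤ U := by
  refine (Scheme.Hom.image_mono _ le_top).trans ?_
  rw [Scheme.Hom.image_top_eq_opensRange, hU.opensRange_fromSpec]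

lemma appIso_inv_fromSpec {U : X.Opens} (hU : IsAffineOpen U) (V : (Spec Γ(X, U)).Opens)
    (r : Γ(X, U)) :
    (hU.fromSpec.appIso V).inv ((Spec Γ(X, U)).presheaf.map V.leTop.op
      ((Scheme.ΓSpecIso Γ(X, U)).inv r)) = resO (fromSpec_image_le hU V) r := by
  have h : (Scheme.ΓSpecIso Γ(X, U)).inv ≫ (Spec Γ(X, U)).presheaf.map V.leTop.op ≫
      (hU.fromSpec.appIso V).inv = X.presheaf.map (homOfLE (fromSpec_image_le hU V)).op := by
    rw [← Category.assoc, Iso.comp_inv_eq, Scheme.Hom.appIso_hom', Scheme.Hom.map_appLE,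
      Scheme.Hom.appLE, hU.fromSpec_app_self]
    simp
    rfl
  exact ConcreteCategory.congr_hom h r

lemma smul_restrict_fromSpec (M : X.Modules) {U : X.Opens} (hU : IsAffineOpen U)
    (V : (Spec Γ(X, U)).Opens) (r : Γ(X, U)) (x : Γ(M.restrict hU.fromSpec, V)) :
    r • x = (resO (fromSpec_image_le hU V) r • (id x : Γ(M, hU.fromSpec ''ᵁ V)) :
      Γ(M, hU.fromSpec ''ᵁ V)) := by
  rw [← appIso_inv_fromSpec]
  rfl

/-- On an affine scheme a quasi-coherent sheaf is the tilde of its global sections. -/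
lemma isLocalizedModule_restrict (M : X.Modules) [M.IsQuasicoherent] {U : X.Opens}
    (hU : IsAffineOpen U) (a : Γ(X, U)) :
    IsLocalizedModule (.powers a) ((modulesSpecToSheaf.obj (M.restrict hU.fromSpec)).obj.map
      (PrimeSpectrum.basicOpen a).leTop.op).hom := by
  have : IsIso (M.restrict hU.fromSpec).fromTildeΓ := inferInstance
  exact (isIso_fromTildeΓ_iff_isLocalizing _).mp this a

/-- A section of a quasi-coherent sheaf over `D(a)` extends after multiplication by a power
of `a`. -/
lemma exists_pow_smul_resM (M : X.Modules) [M.IsQuasicoherent] {U : X.Opens}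
    (hU : IsAffineOpen U) (a : Γ(X, U)) (e : Γ(M, X.basicOpen a)) :
    ∃ (n : ℕ) (t : Γ(M, U)), resM M (X.basicOpen_le a) t = resO (X.basicOpen_le a) a ^ n • e := by
  have h1 : hU.fromSpec ''ᵁ PrimeSpectrum.basicOpen a = X.basicOpen a :=
    hU.fromSpec_image_basicOpen a
  have h2 : hU.fromSpec ''ᵁ ⊤ = U := by
    rw [Scheme.Hom.image_top_eq_opensRange, hU.opensRange_fromSpec]
  obtain ⟨⟨t, ⟨_, n, rfl⟩⟩, ht⟩ := (isLocalizedModule_restrict M hU a).surj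
    (id (resM M h1.le e) : Γ(M, hU.fromSpec ''ᵁ PrimeSpectrum.basicOpen a))
  let t' : Γ(M, hU.fromSpec ''ᵁ ⊤) := t
  refine ⟨n, resM M h2.ge t', ?_⟩
  have ht' : resO (fromSpec_image_le hU _) (a ^ n) • resM M h1.le e =
      resM M (Scheme.Hom.image_mono _ le_top) t' :=
    (smul_restrict_fromSpec M hU _ (a ^ n) _).symm.trans ht
  have := congrArg (resM M h1.ge) ht'
  rw [resM_smul, resM_resM, resM_resM, resM_self, resO_resO, map_pow] at this
  rw [this, resM_resM]

/-- A section of a quasi-coherent sheaf that vanishes on `D(a)` is annihilated by a power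
of `a`. -/
lemma exists_pow_smul_eq_zero (M : X.Modules) [M.IsQuasicoherent] {U : X.Opens}
    (hU : IsAffineOpen U) (a : Γ(X, U)) (t : Γ(M, U)) (ht : resM M (X.basicOpen_le a) t = 0) :
    ∃ n : ℕ, a ^ n • t = 0 := by
  have h1 : hU.fromSpec ''ᵁ PrimeSpectrum.basicOpen a = X.basicOpen a :=
    hU.fromSpec_image_basicOpen a
  have h2 : hU.fromSpec ''ᵁ ⊤ = U := by
    rw [Scheme.Hom.image_top_eq_opensRange, hU.opensRange_fromSpec]
  have := isLocalizedModule_restrict M hU a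
  obtain ⟨⟨_, n, rfl⟩, hn⟩ := (IsLocalizedModule.eq_zero_iff (.powers a)
    ((modulesSpecToSheaf.obj (M.restrict hU.fromSpec)).obj.map
      (PrimeSpectrum.basicOpen a).leTop.op).hom
    (m := (id (resM M h2.le t) : Γ(M, hU.fromSpec ''ᵁ ⊤)))).mp (by
      change resM M (Scheme.Hom.image_mono _ le_top) (resM M h2.le t) = 0
      rw [resM_resM, ← resM_resM M (X.basicOpen_le a) h1.le, ht, map_zero])
  refine ⟨n, ?_⟩
  have hn' : resO (fromSpec_image_le hU _) (a ^ n) • resM M h2.le t = 0 :=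
    (smul_restrict_fromSpec M hU _ (a ^ n) _).symm.trans hn
  have := congrArg (resM M h2.ge) hn'
  rwa [resM_smul, resM_resM, resM_self, resO_resO, resO_self, map_zero] at this

end

section

variable {X : Scheme.{u}}

/-- A finite free sheaf is the tilde of a finite free module. Since tilde is fully faithful, the
epimorphism onto `M` comes from a map of modules, and faithfulness reflects epimorphisms. -/
lemma finite_of_generatingSections {R : CommRingCat.{u}} (M : (Spec R).Modules)
    [M.IsQuasicoherent] (G : SheafOfModules.GeneratingSections.{u} (R := (Spec R).ringCatSheaf) M)
    [Finite G.I] :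
    Module.Finite R Γ(M, ⊤) := by
  let Q : ModuleCat R := (modulesSpecToSheaf.obj M).presheaf.obj (op ⊤)
  have : IsIso M.fromTildeΓ := inferInstance
  let p : SheafOfModules.free G.I ⟶ M := G.π
  have hp : Epi p := G.epi
  let r : M ⟶ (tilde.functor R).obj Q := @inv _ _ _ _ M.fromTildeΓ this
  have hr : Epi r := @IsIso.epi_of_iso _ _ _ _ r (@IsIso.inv_isIso _ _ _ _ M.fromTildeΓ this)
  let g := (tilde.functor R).preimage (X := ModuleCat.of R (G.I →₀ R)) (Y := Q)
    ((tildeFinsupp G.I).hom ≫ p ≫ r)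
  have hg : (tilde.functor R).map g = (tildeFinsupp G.I).hom ≫ p ≫ r :=
    (tilde.functor R).map_preimage _
  have h1 : Epi ((tilde.functor R).map g) := by
    rw [hg]
    exact epi_comp' (@IsIso.epi_of_iso _ _ _ _ _ (tildeFinsupp G.I).isIso_hom) (epi_comp' hp hr)
  have h2 : Epi g := (tilde.functor R).epi_of_epi_map h1
  exact Module.Finite.of_surjective g.hom ((ModuleCat.epi_iff_surjective g).mp h2)

/-- Generators over `W` pass to modules on the open subscheme `W` and then pull back along `Spec
Γ(X, U) → W`; these functors preserve colimits, hence generation. -/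
lemma exists_generatingSections (M : X.Modules) {U W : X.Opens} (hU : IsAffineOpen U) (h : U ≤ W)
    (G : (SheafOfModules.over (R := X.ringCatSheaf) M W).GeneratingSections) [Finite G.I] :
    ∃ G' : SheafOfModules.GeneratingSections.{u} (R := (Spec Γ(X, U)).ringCatSheaf)
      (M.restrict hU.fromSpec), Finite G'.I := by
  let v := hU.isoSpec.inv ≫ X.homOfLE h
  have hv : v ≫ W.ι = hU.fromSpec := by
    simp [v]
  have : Limits.PreservesColimitsOfSize.{u, u} (Scheme.Modules.restrictFunctor v) := inferInstance
  let F := (Scheme.Modules.overEquiv W).functor ⋙ Scheme.Modules.restrictFunctor v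
  let iso : SheafOfModules.overFunctor X.ringCatSheaf _ ⋙ F ≅
      Scheme.Modules.restrictFunctor hU.fromSpec := (Functor.associator _ _ _).symm ≪≫
        Functor.isoWhiskerRight (Scheme.Modules.overFunctorEquiv _) _ ≪≫
        (Scheme.Modules.restrictFunctorComp _ _).symm ≪≫ (Scheme.Modules.restrictFunctorCongr hv)
  have hF : Limits.PreservesColimitsOfSize.{u, u} F :=
    Limits.comp_preservesColimits _ _
  let G1 := @SheafOfModules.GeneratingSections.map _ _ _ _ _ _ _ _ _ _ _ _ _ G F hF
    (Scheme.Modules.restrictUnitIso _).symm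
  have hiso : Epi (iso.app M).hom := @IsIso.epi_of_iso _ _ _ _ _ (iso.app M).isIso_hom
  exact ⟨@SheafOfModules.GeneratingSections.ofEpi _ _ _ _ _ _ _ _ G1 (iso.app M).hom hiso, inferInstanceAs (Finite G.I)⟩

/-- A quasi-coherent sheaf of finite type has finitely generated sections over small affine
open subsets. -/
lemma exists_finite_sections (M : X.Modules) [M.IsQuasicoherent] (hM : M.IsFiniteType) (x : X) :
    ∃ W : X.Opens, x ∈ W ∧ ∀ U : X.Opens, IsAffineOpen U → U ≤ W →
      Module.Finite Γ(X, U) Γ(M, U) := by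
  obtain ⟨D, hD⟩ := SheafOfModules.IsFiniteType.exists_localGeneratorsData (M := M)
  have hc := D.coversTop
  rw [Opens.coversTop_iff, IsOpenCover] at hc
  obtain ⟨i, hi⟩ := Opens.mem_iSup.mp (hc.ge (Opens.mem_top x))
  refine ⟨D.X i, hi, fun U hU hUW ↦ ?_⟩
  have : Finite (D.generators i).I := (hD.isFiniteType i).finite
  obtain ⟨G, hG⟩ := exists_generatingSections M hU hUW (D.generators i)
  have := finite_of_generatingSections _ G
  have h2 : hU.fromSpec ''ᵁ ⊤ = U := by
    rw [Scheme.Hom.image_top_eq_opensRange, hU.opensRange_fromSpec]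
  let φ : Γ(M.restrict hU.fromSpec, ⊤) →ₗ[Γ(X, U)] Γ(M, U) :=
    { toFun := fun x ↦ resM M h2.ge (id x : Γ(M, hU.fromSpec ''ᵁ ⊤))
      map_add' := fun x y ↦ map_add (resM M h2.ge) x y
      map_smul' := fun r x ↦ by
        rw [smul_restrict_fromSpec]
        refine (resM_smul M h2.ge _ _).trans ?_
        rw [resO_resO, resO_self]
        rfl }
  refine Module.Finite.of_surjective φ fun y ↦ ⟨(resM M h2.le y :), ?_⟩
  change resM M h2.ge (resM M h2.le y) = y
  rw [resM_resM, resM_self]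

end

section

open TensorProduct

/-! ### Étale algebras over normal domains -/

section Normal

variable {P A : Type u} [CommRing P] [IsDomain P] [IsIntegrallyClosed P] [CommRing A] [Algebra P A]
  [Algebra.Etale P A]

/-- An étale algebra over a normal domain `P` is integrally closed in its localization
`A ⊗ Frac P`. -/
lemma exists_of_isIntegral_etale (z : A ⊗[P] FractionRing P) (hz : IsIntegral A z) :
    ∃ a : A, a ⊗ₜ 1 = z := by
  have : Algebra.Smooth P A := inferInstance
  -- Integral closure commutes with smooth base change, and `P` is its own integral closure in `Frac
  -- P`.
  obtain ⟨y, hy⟩ := (TensorProduct.toIntegralClosure_bijective_of_smooth (R := P) (S := A)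
    (B := FractionRing P)).2 ⟨z, hz⟩
  have hy' : Algebra.TensorProduct.map (.id A A) (integralClosure P (FractionRing P)).val y = z :=
    congrArg Subtype.val hy
  rw [← hy']
  clear hy hy'
  induction y with
  | zero => exact ⟨0, by simp⟩
  | add x y hx hy =>
    obtain ⟨a, ha⟩ := hx
    obtain ⟨b, hb⟩ := hy
    exact ⟨a + b, by rw [add_tmul, ha, hb, map_add]⟩
  | tmul a c =>
    obtain ⟨c', hc'⟩ := IsIntegrallyClosed.isIntegral_iff.mp c.2
    refine ⟨c' • a, ?_⟩
    rw [Algebra.TensorProduct.map_tmul]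
    change (c' • a) ⊗ₜ 1 = a ⊗ₜ c.1
    rw [← hc', TensorProduct.smul_tmul, Algebra.smul_def, mul_one]

lemma tmul_one_injective_etale :
    Function.Injective (fun a : A ↦ (a ⊗ₜ 1 : A ⊗[P] FractionRing P)) := by
  have : Module.Flat P A := inferInstance
  exact Algebra.TensorProduct.includeLeft_injective (S := P) (R := P) (A := A) (IsFractionRing.injective P (FractionRing P))

/-- The idempotents of an étale algebra over a normal domain separate its irreducible
components. -/
lemma exists_idempotent_etale {P A : Type u} [CommRing P] [IsDomain P] [IsIntegrallyClosed P]
    [CommRing A] {φ : P →+* A} (hφ : φ.Etale) (p : Ideal A) [p.IsPrime] :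
    ∃ e : A, e ∉ p ∧ e * e = e ∧ ∀ a b : A, e * a * b = 0 → e * a = 0 ∨ e * b = 0 := by
  classical
  algebraize [φ]
  let K := FractionRing P
  let L := A ⊗[P] K
  let e0 : K ⊗[P] A ≃ₐ[P] A ⊗[P] K := Algebra.TensorProduct.comm P K A
  obtain ⟨I, hI, Ai, _, _, e, -⟩ :=
    (Algebra.Etale.iff_exists_algEquiv_prod K (K ⊗[P] A)).mp inferInstance
  have := Fintype.ofFinite I
  let Φ : L ≃+* (∀ i, Ai i) := e0.symm.toRingEquiv.trans e.toRingEquiv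
  -- The idempotents of the finite product of fields `A ⊗ Frac P` are roots of `X ^ 2 - X`, hence
  -- integral over `A`, and so come from `A`.
  have hE (i : I) : ∃ a : A, a ⊗ₜ 1 = Φ.symm (Pi.single i 1) := by
    refine exists_of_isIntegral_etale _ ⟨Polynomial.X ^ 2 - Polynomial.X, ?_, ?_⟩
    · exact Polynomial.monic_X_pow_sub (Polynomial.degree_X_le.trans_lt (by norm_num))
    · rw [Polynomial.eval₂_sub, Polynomial.eval₂_X_pow, Polynomial.eval₂_X, ← map_pow, ← map_sub]
      rw [map_eq_zero_iff _ Φ.symm.injective, pow_two, ← Pi.single_mul, mul_one, sub_self]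
  choose ε hε using hE
  let j : A →+* (∀ i, Ai i) := Φ.toRingHom.comp
    (Algebra.TensorProduct.includeLeftRingHom : A →+* A ⊗[P] K)
  have hj : Function.Injective j := Φ.injective.comp tmul_one_injective_etale
  have hjε (i : I) : j (ε i) = Pi.single i 1 := by
    change Φ (ε i ⊗ₜ 1) = _
    rw [hε, RingEquiv.apply_symm_apply]
  have hsum : ∑ i, ε i = 1 := by
    apply hj
    rw [map_sum, map_one, Finset.sum_congr rfl fun i _ ↦ hjε i]
    exact Finset.univ_sum_single 1
  obtain ⟨i, hi⟩ : ∃ i, ε i ∉ p := by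
    by_contra! h
    exact (Ideal.ne_top_iff_one p).mp ‹p.IsPrime›.ne_top (hsum ▸ Ideal.sum_mem p fun i _ ↦ h i)
  refine ⟨ε i, hi, hj ?_, fun a b hab ↦ ?_⟩
  · rw [map_mul, hjε, ← Pi.single_mul, mul_one]
  · have h1 := congrFun (congrArg j hab) i
    rw [map_mul, map_mul, hjε, map_zero] at h1
    simp only [Pi.mul_apply, Pi.single_eq_same, one_mul, Pi.zero_apply, mul_eq_zero] at h1
    have key (c : A) (hc : j c i = 0) : ε i * c = 0 := by
      apply hj
      rw [map_mul, hjε, map_zero]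
      funext l
      by_cases hl : l = i
      · subst hl; simp [hc]
      · simp [Pi.single_eq_of_ne hl]
    exact h1.imp (key a) (key b)

/-- Every nonzero element of `A` divides the image of a nonzero element of `P`, so `A ⊗ Frac P` is
already the fraction field of `A`. -/
lemma isIntegrallyClosed_of_etale {P A : Type u} [CommRing P] [IsDomain P] [IsIntegrallyClosed P]
    [CommRing A] [IsDomain A] {φ : P →+* A} (hφ : φ.Etale) : IsIntegrallyClosed A := by
  algebraize [φ]
  have hinj : Function.Injective (algebraMap P A) :=
    injective_of_flat (RingHom.flat_algebraMap_iff.mpr inferInstance)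
  have halg : Algebra.IsAlgebraic P A := by
    refine ⟨fun a ↦ ?_⟩
    obtain ⟨p, hp, h⟩ := isAlgebraic_of_etale (φ := algebraMap P A)
      (RingHom.etale_algebraMap.mpr inferInstance) a
    exact ⟨p, hp, h⟩
  let L := A ⊗[P] FractionRing P
  have h1 : IsLocalization (Algebra.algebraMapSubmonoid A (nonZeroDivisors P)) L := inferInstance
  have h2 : IsFractionRing A L := by
    refine IsLocalization.of_le_of_exists_dvd (Algebra.algebraMapSubmonoid A (nonZeroDivisors P)) _
      ?_ ?_
    · rintro _ ⟨p, hp, rfl⟩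
      exact mem_nonZeroDivisors_of_ne_zero
        ((map_ne_zero_iff _ hinj).mpr (nonZeroDivisors.ne_zero hp))
    · intro a ha
      obtain ⟨p, hp, h⟩ := (halg.isAlgebraic a).exists_nonzero_dvd ha
      exact ⟨_, ⟨p, mem_nonZeroDivisors_of_ne_zero hp, rfl⟩, h⟩
  refine (isIntegrallyClosed_iff L).mpr fun {z} hz ↦ ?_
  exact exists_of_isIntegral_etale z hz

end Normal


/-! ### Smooth connected schemes over a field: integrality and normal charts -/

section Smooth

/-- Inverting an idempotent is passing to the factor `eA`, in which `H` excludes zero divisors. -/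
lemma isDomain_of_idempotent {A : Type*} [CommRing A] {e : A} (hee : e * e = e)
    (H : ∀ a b : A, e * a * b = 0 → e * a = 0 ∨ e * b = 0) (B : Type*) [CommRing B] [Algebra A B]
    [IsLocalization.Away e B] [Nontrivial B] : IsDomain B := by
  have he1 : algebraMap A B e = 1 := by
    have hu : IsUnit (algebraMap A B e) := IsLocalization.Away.algebraMap_isUnit e
    refine hu.mul_left_cancel ?_
    rw [← map_mul, hee, mul_one]
  have hpow (n : ℕ) : e * e ^ n = e := by
    induction n with
    | zero => simp
    | succ n ih => rw [pow_succ, ← mul_assoc, ih, hee]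
  have hsurj (y : B) : ∃ a, algebraMap A B a = y := by
    obtain ⟨n, a, ha⟩ := IsLocalization.Away.surj e y
    exact ⟨a, by rw [← ha, he1, one_pow, mul_one]⟩
  have hz (a : A) (ha : e * a = 0) : algebraMap A B a = 0 := by
    rw [← one_mul (algebraMap A B a), ← he1, ← map_mul, ha, map_zero]
  have hno : NoZeroDivisors B := by
    refine ⟨fun {x y} hxy ↦ ?_⟩
    obtain ⟨a, rfl⟩ := hsurj x
    obtain ⟨b, rfl⟩ := hsurj y
    rw [← map_mul] at hxy
    obtain ⟨⟨_, n, rfl⟩, hn⟩ := (IsLocalization.map_eq_zero_iff (.powers e) B _).mp hxy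
    refine (H a b ?_).imp (hz a) (hz b)
    have := congrArg (e * ·) hn
    simp only [mul_zero] at this
    rw [← mul_assoc, hpow] at this
    rw [mul_assoc, this]
  exact NoZeroDivisors.to_isDomain B

/-- The closure of an irreducible open `U` is open: an irreducible open `V` around a point of it
meets `U`, and `U ∩ V` is dense in `V`. Connectedness does the rest. -/
lemma isIrreducible_univ_of_connected {α : Type*} [TopologicalSpace α] [ConnectedSpace α]
    (h : ∀ x : α, ∃ U : Set α, IsOpen U ∧ x ∈ U ∧ IsIrreducible U) : IrreducibleSpace α := by
  obtain ⟨x⟩ := (inferInstance : Nonempty α)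
  obtain ⟨U, hU, hx, hi⟩ := h x
  have hc : IsClopen (closure U) := by
    refine ⟨isClosed_closure, isOpen_iff_forall_mem_open.mpr fun y hy ↦ ?_⟩
    obtain ⟨V, hV, hyV, hVi⟩ := h y
    refine ⟨V, ?_, hV, hyV⟩
    have h1 : (V ∩ U).Nonempty := mem_closure_iff.mp hy V hV hyV
    intro z hz
    refine mem_closure_iff.mpr fun O hO hzO ↦ ?_
    obtain ⟨w, hw1, hw2⟩ := hVi.2 O U hO hU ⟨z, hz, hzO⟩ h1
    exact ⟨w, hw2.1, hw2.2⟩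
  have hcl : closure U = Set.univ := hc.eq_univ ⟨x, subset_closure hx⟩
  have : IsIrreducible (Set.univ : Set α) := hcl ▸ hi.closure
  exact { isPreirreducible_univ := this.2, toNonempty := ⟨x⟩ }

variable {k : Type u} [Field k] {X : Scheme.{u}} (p : X ⟶ Spec (CommRingCat.of k))

lemma isField_globalSections (k : Type u) [Field k] :
    IsField Γ(Spec (CommRingCat.of k), ⊤) :=
  (Scheme.ΓSpecIso (CommRingCat.of k)).commRingCatIsoToRingEquiv.toMulEquiv.isField
    (Field.toIsField k)

variable {p}

lemma exists_absCoord [Smooth p] {V : X.Opens} {x : X} (hx : x ∈ V) :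
    ∃ U n, U ≤ V ∧ x ∈ U ∧ Nonempty (Coord p ⊤ U (Fin n)) :=
  exists_coord p (isAffineOpen_top _) hx (Opens.mem_top _)

variable {U : X.Opens} {σ : Type} [Finite σ]

lemma Coord.isNoetherianRing (c : Coord p ⊤ U σ) : IsNoetherianRing Γ(X, U) := by
  let _ := (isField_globalSections k).toField
  have h := c.etale
  algebraize [polyHom (p.appLE ⊤ U c.le).hom c.x]
  exact Algebra.FiniteType.isNoetherianRing (MvPolynomial σ Γ(Spec (CommRingCat.of k), ⊤)) _

lemma Coord.isIntegrallyClosed (c : Coord p ⊤ U σ) [IsDomain Γ(X, U)] :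
    IsIntegrallyClosed Γ(X, U) := by
  let _ := (isField_globalSections k).toField
  exact isIntegrallyClosed_of_etale c.etale

/-- A chart is étale over a polynomial ring over a field, which is a normal domain; an idempotent
not vanishing at `x` cuts out a component that is a domain. -/
lemma exists_isDomain_nhds [Smooth p] {V : X.Opens} {x : X} (hx : x ∈ V) :
    ∃ U ≤ V, x ∈ U ∧ IsAffineOpen U ∧ IsDomain Γ(X, U) := by
  obtain ⟨U, n, hUV, hxU, ⟨c⟩⟩ := exists_absCoord (p := p) hx
  let _ := (isField_globalSections k).toField
  obtain ⟨e, he, hee, H⟩ := exists_idempotent_etale c.etale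
    (c.affine.primeIdealOf ⟨x, hxU⟩).asIdeal
  have hxe : x ∈ X.basicOpen e := by
    have h2 : c.affine.primeIdealOf ⟨x, hxU⟩ ∈ PrimeSpectrum.basicOpen e := he
    rw [← c.affine.fromSpec_preimage_basicOpen] at h2
    have h3 : c.affine.fromSpec (c.affine.primeIdealOf ⟨x, hxU⟩) ∈ X.basicOpen e := h2
    rwa [c.affine.fromSpec_primeIdealOf ⟨x, hxU⟩] at h3
  refine ⟨X.basicOpen e, (X.basicOpen_le e).trans hUV, hxe, c.affine.basicOpen e, ?_⟩
  have hloc := c.affine.isLocalization_basicOpen e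
  have : Nonempty (X.basicOpen e) := ⟨⟨x, hxe⟩⟩
  have : Nontrivial Γ(X, X.basicOpen e) := inferInstance
  exact isDomain_of_idempotent hee H _

lemma isIntegral_of_smooth [Smooth p] [ConnectedSpace X] : IsIntegral X := by
  have hred : IsReduced X := by
    refine ⟨fun U ↦ ⟨fun s hs ↦ ?_⟩⟩
    refine eqO_of_local _ _ fun y hy ↦ ?_
    obtain ⟨V, hV, hyV, -, hd⟩ := exists_isDomain_nhds (p := p) hy
    refine ⟨V, hV, hyV, ?_⟩
    rw [map_zero]
    exact (hs.map (resO hV)).eq_zero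
  have : IrreducibleSpace X := by
    refine isIrreducible_univ_of_connected fun x ↦ ?_
    obtain ⟨V, -, hyV, haff, hd⟩ := exists_isDomain_nhds (p := p) (Opens.mem_top x)
    refine ⟨V, V.2, hyV, ?_⟩
    rw [← haff.range_fromSpec, ← Set.image_univ]
    have : IrreducibleSpace (Spec Γ(X, V)) := inferInstance
    exact (IrreducibleSpace.isIrreducible_univ _).image _ haff.fromSpec.continuous.continuousOn
  exact isIntegral_of_irreducibleSpace_of_isReduced X

end Smooth

end

section

variable {X T : Scheme.{u}}

/-! ### Stratified modules in coordinates and the identity theorem -/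

section Leibniz

variable {g : X ⟶ T} {W : T.Opens} {U : X.Opens} {σ : Type} [Fintype σ]

lemma diffApply_mul (D D' : diffOp g U) {V : X.Opens} (hV : V ≤ U) (b : Γ(X, V)) :
    diffApply (D * D') hV b = diffApply D hV (diffApply D' hV b) := rfl

lemma Coord.op_zero (c : Coord g W U σ) : c.op 0 = 1 :=
  diffOp_ext fun V hV aV x ↦ by
    rw [c.op_app 0 hV aV, (c.restr aV hV).isTaylor.hasse_zero]
    rfl

lemma Coord.op_mul_diffMul [DecidableEq σ] (c : Coord g W U σ) (β : σ →₀ ℕ) (a : Γ(X, U)) :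
    c.op β * diffMul g U a = ∑ p ∈ Finset.HasAntidiagonal.antidiagonal β,
      diffMul g U (hasse c.taylor p.1 a) * c.op p.2 :=
  diffOp_ext fun V hV aV x ↦ by
    rw [diffApply_mul, diffApply_diffMul, c.op_app β hV aV, hasse_mul, diffApply_sum]
    refine Finset.sum_congr rfl fun p _ ↦ ?_
    rw [diffApply_mul, diffApply_diffMul, c.op_app _ hV aV, c.hasse_res]

variable {M : X.Modules} (N : Stratification g M)

/-- The action of a differential operator on sections. -/
def Stratification.applyHom (D : diffOp g U) : Γ(M, U) →+ Γ(M, U) := (N.act U D).app U le_rfl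

lemma Stratification.applyHom_apply (D : diffOp g U) (e : Γ(M, U)) :
    N.applyHom D e = N.apply D e := rfl

lemma Stratification.isLeibniz (c : Coord g W U σ) :
    IsLeibniz c.taylor (fun β ↦ N.applyHom (c.op β)) where
  zero m := by rw [c.op_zero, N.applyHom_apply, N.apply_one]
  smul β a m := by
    simp only [N.applyHom_apply]
    rw [← N.apply_diffMul a m, ← N.apply_mul, c.op_mul_diffMul, N.apply_sum]
    refine Finset.sum_congr rfl fun p _ ↦ ?_
    rw [N.apply_mul, N.apply_diffMul]

lemma Stratification.IsHorizontal.apply_op {N : Stratification g M} (c : Coord g W U σ)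
    {e : Γ(M, U)} (he : N.IsHorizontal e) {β : σ →₀ ℕ} (hβ : β ≠ 0) : N.apply (c.op β) e = 0 := by
  have := he U le_rfl (c.op β) (by rw [c.op_app_self, c.isTaylor.hasse_one hβ])
  rwa [resM_self] at this

/-- All Leibniz terms that differentiate `e` vanish. Relations between horizontal sections can
therefore be differentiated coefficient by coefficient. -/
lemma Stratification.IsHorizontal.apply_op_smul {N : Stratification g M} (c : Coord g W U σ)
    {e : Γ(M, U)} (he : N.IsHorizontal e) (β : σ →₀ ℕ) (a : Γ(X, U)) :
    N.apply (c.op β) (a • e) = hasse c.taylor β a • e := by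
  classical
  rw [← N.applyHom_apply, (N.isLeibniz c).smul β a e,
    Finset.sum_eq_single_of_mem (β, 0) (by simp)]
  · rw [(N.isLeibniz c).zero]
  · rintro ⟨p, r⟩ h hne
    have hr : r ≠ 0 := by
      rintro rfl
      simp only [Finset.HasAntidiagonal.mem_antidiagonal, add_zero] at h
      exact hne (by rw [h])
    rw [N.applyHom_apply, he.apply_op c hr, smul_zero]

lemma resM_sum (M : X.Modules) {U V : X.Opens} (h : V ≤ U) {ι : Type*} (s : Finset ι)
    (e : ι → Γ(M, U)) : resM M h (∑ i ∈ s, e i) = ∑ i ∈ s, resM M h (e i) := map_sum _ _ _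

end Leibniz

section Identity

variable {k : Type u} [Field k] [IsIntegral X] {p : X ⟶ Spec (CommRingCat.of k)} {M : X.Modules}

lemma Coord.isSimple {U : X.Opens} {σ : Type} [Fintype σ] [Nonempty U] (c : Coord p ⊤ U σ) :
    IsSimple c.taylor := by
  let _ := (isField_globalSections k).toField
  exact c.isTaylor.isSimple c.etale

lemma smul_eq_zero_of_coord (N : Stratification p M) {U : X.Opens} {σ : Type} [Fintype σ] [Nonempty U]
    (c : Coord p ⊤ U σ) [Module.Finite Γ(X, U) Γ(M, U)] {a : Γ(X, U)} (ha : a ≠ 0)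
    {m : Γ(M, U)} (hm : a • m = 0) : m = 0 := by
  have := c.isNoetherianRing
  exact (N.isLeibniz c).smul_eq_zero c.isTaylor.hasse_zero c.isSimple ha hm

/-- A nonempty affine open subset with coordinates over the base field, on which the sections
of `M` are finitely generated. -/
structure IsSmall (p : X ⟶ Spec (CommRingCat.of k)) (M : X.Modules) (U : X.Opens) : Prop where
  affine : IsAffineOpen U
  nonempty : Nonempty U
  coord : ∃ n, Nonempty (Coord p ⊤ U (Fin n))
  finite : Module.Finite Γ(X, U) Γ(M, U)

lemma nonempty_inf {U V : X.Opens} (hU : Nonempty U) (hV : Nonempty V) :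
    ∃ x, x ∈ U ∧ x ∈ V := by
  obtain ⟨x, hx⟩ := hU
  obtain ⟨y, hy⟩ := hV
  obtain ⟨z, hz1, hz2⟩ := nonempty_preirreducible_inter U.2 V.2 ⟨x, hx⟩ ⟨y, hy⟩
  exact ⟨z, hz1, hz2⟩

lemma exists_isSmall [Smooth p] [M.IsQuasicoherent] (hM : M.IsFiniteType) {V : X.Opens} {x : X}
    (hx : x ∈ V) : ∃ U ≤ V, x ∈ U ∧ ∀ U' ≤ U, IsAffineOpen U' → Nonempty U' → IsSmall p M U' := by
  obtain ⟨W, hxW, hW⟩ := exists_finite_sections M hM x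
  obtain ⟨U, n, hU, hxU, ⟨c⟩⟩ := exists_absCoord (p := p) (V := V ⊓ W) ⟨hx, hxW⟩
  exact ⟨U, hU.trans inf_le_left, hxU, fun U' h a hn ↦
    ⟨a, hn, ⟨n, ⟨c.restr a h⟩⟩, hW U' a (h.trans (hU.trans inf_le_right))⟩⟩

lemma IsSmall.smul_eq_zero (N : Stratification p M) {U : X.Opens} (hU : IsSmall p M U)
    {a : Γ(X, U)} (ha : a ≠ 0) {m : Γ(M, U)} (hm : a • m = 0) : m = 0 := by
  obtain ⟨n, ⟨c⟩⟩ := hU.coord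
  have := hU.nonempty
  have := hU.finite
  exact smul_eq_zero_of_coord N c ha hm

lemma exists_basicOpen {U V : X.Opens} (hU : IsAffineOpen U) {x : X} (hxU : x ∈ U) (hxV : x ∈ V) :
    ∃ a : Γ(X, U), a ≠ 0 ∧ x ∈ X.basicOpen a ∧ X.basicOpen a ≤ V := by
  obtain ⟨a, ha, hxa⟩ := hU.exists_basicOpen_le (V := V) ⟨x, hxV⟩ hxU
  refine ⟨a, ?_, hxa, ha⟩
  rintro rfl
  rw [Scheme.basicOpen_zero] at hxa
  exact hxa

variable [Smooth p] [M.IsQuasicoherent]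

/-- A section of a stratified coherent sheaf which vanishes on a nonempty open subset is zero. -/
lemma eq_zero_of_resM_eq_zero (N : Stratification p M) (hM : M.IsFiniteType) {V V' : X.Opens} (h : V' ≤ V)
    (hV' : Nonempty V') {e : Γ(M, V)} (he : resM M h e = 0) : e = 0 := by
  refine eqM_of_local M _ _ fun y hy ↦ ?_
  obtain ⟨U, hUV, hyU, hU⟩ := exists_isSmall (p := p) hM hy
  obtain ⟨U', hU'U, hyU', aU'⟩ := exists_affine hyU
  have hs := hU U' hU'U aU' ⟨⟨y, hyU'⟩⟩
  refine ⟨U', hU'U.trans hUV, hyU', ?_⟩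
  obtain ⟨x, hxU, hxV⟩ := nonempty_inf hs.nonempty hV'
  obtain ⟨a, ha, -, haV⟩ := exists_basicOpen hs.affine hxU hxV
  -- By irreducibility the small affine open meets `V'`. The section vanishes on a basic open subset
  -- inside both, so a power of `a` kills it, and there is no torsion.
  obtain ⟨n, hn⟩ := exists_pow_smul_eq_zero M hs.affine a (resM M (hU'U.trans hUV) e) (by
    rw [resM_resM, ← resM_resM M h haV, he, map_zero])
  rw [map_zero]
  have := hs.nonempty
  exact hs.smul_eq_zero N (pow_ne_zero n ha) hn

lemma eq_of_resM_eq (N : Stratification p M) (hM : M.IsFiniteType) {V V' : X.Opens} (h : V' ≤ V)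
    (hV' : Nonempty V') {e e' : Γ(M, V)}
    (he : resM M h e = resM M h e') : e = e' := by
  rw [← sub_eq_zero]
  exact eq_zero_of_resM_eq_zero N hM h hV' (by rw [map_sub, he, sub_self])

end Identity

end

section

variable {X S : Scheme.{u}}

/-! ### Relative constants as fractions of base functions -/

section Const

variable {k : Type u} [Field k] [IsIntegral X] [IsIntegral S]
  {q : S ⟶ Spec (CommRingCat.of k)} {f : X ⟶ S}

lemma germ_resO {U V : X.Opens} [Nonempty U] [Nonempty V] (h : V ≤ U) (a : Γ(X, U)) :
    X.germToFunctionField V (resO h a) = X.germToFunctionField U a := by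
  simp only [resO, Scheme.germToFunctionField]
  exact TopCat.Presheaf.germ_res_apply X.presheaf (homOfLE h) _ _ a

/-- A function on a nonempty open subset of a smooth connected scheme which is integral over the
functions on a larger open subset extends to it. -/
lemma exists_extend_of_isIntegral (p : X ⟶ Spec (CommRingCat.of k)) [Smooth p] {Y U : X.Opens}
    [Nonempty U] (hU : U ≤ Y) {C : Type u} [CommRing C]
    (φ : C →+* Γ(X, Y)) {w : Γ(X, U)} (hw : ((resO hU).comp φ).IsIntegralElem w) :
    ∃ t : Γ(X, Y), resO hU t = w := by
  -- In the function field `w` is integral over each chart `Γ(X, V)`, which is normal, so it is a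
  -- section over `V`; these sections agree in the function field and glue.
  have key (V : X.Opens) (hV : V ≤ Y) [Nonempty V] (n : ℕ) (c : Coord p ⊤ V (Fin n)) :
      ∃ v : Γ(X, V), X.germToFunctionField V v = X.germToFunctionField U w := by
    have := c.isIntegrallyClosed
    have := functionField_isFractionRing_of_isAffineOpen X V c.affine
    obtain ⟨P, hP, hP0⟩ := hw
    refine IsIntegrallyClosed.algebraMap_eq_of_integral (R := Γ(X, V)) (K := X.functionField)
      ⟨P.map ((resO hV).comp φ), hP.map _, ?_⟩
    rw [Polynomial.eval₂_map]
    have h1 := congrArg (X.germToFunctionField U).hom hP0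
    rw [map_zero, Polynomial.hom_eval₂] at h1
    rw [← h1]
    have h2 : (algebraMap Γ(X, V) X.functionField).comp ((resO hV).comp φ) =
        (X.germToFunctionField U).hom.comp ((resO hU).comp φ) := by
      ext a
      have : Nonempty Y := ⟨⟨_, hU (Classical.arbitrary U).2⟩⟩
      exact (germ_resO hV (φ a)).trans (germ_resO hU (φ a)).symm
    rw [h2]
  let P : X.Opens → Prop := fun V ↦ Nonempty V ∧ ∃ n, Nonempty (Coord p ⊤ V (Fin n))
  have hP : ∀ V' ≤ Y, ∀ x ∈ V', ∃ V'' ≤ V', x ∈ V'' ∧ P V'' := by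
    intro V' hV' x hx
    obtain ⟨V'', n, hV'', hxV'', hc⟩ := exists_absCoord (p := p) hx
    exact ⟨V'', hV'', hxV'', ⟨⟨x, hxV''⟩⟩, n, hc⟩
  have hex (V : X.Opens) (hV : V ≤ Y) (hp : P V) :
      ∃ v : Γ(X, V), ∀ _ : Nonempty V, X.germToFunctionField V v = X.germToFunctionField U w := by
    obtain ⟨hn, n, ⟨c⟩⟩ := hp
    obtain ⟨v, hv⟩ := key V hV n c
    exact ⟨v, fun _ ↦ hv⟩
  choose s hs using hex
  obtain ⟨t, ht⟩ := exists_glueO P hP s fun V' V'' h' p' h p'' ↦ by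
    have := p'.1
    have := p''.1
    apply Scheme.germToFunctionField_injective X V''
    rw [germ_resO, hs, hs]
  refine ⟨t, ?_⟩
  obtain ⟨V, hV, hxV, hPV⟩ := hP U hU _ (Classical.arbitrary U).2
  have := hPV.1
  apply Scheme.germToFunctionField_injective X U
  rw [← germ_resO hV, resO_resO, ht V (hV.trans hU) hPV, hs]

/-- Functions annihilated by the relative derivations are fractions of functions on the base. -/
lemma exists_of_const (p : X ⟶ Spec (CommRingCat.of k)) [Smooth p]
    {W : S.Opens} [Nonempty W] (hf : IsIso (f.app W)) {U : X.Opens} [Nonempty U]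
    {σ : Type} [Fintype σ] (c : Coord f W U σ) {b : Γ(X, U)}
    (hb : ∀ β, β ≠ 0 → hasse c.taylor β b = 0) :
    ∃ a z : Γ(S, W), a ≠ 0 ∧ f.appLE W U c.le a * b = f.appLE W U c.le z := by
  obtain ⟨P, hP, hPb⟩ := c.isTaylor.isAlgebraic_of_const c.etale hb
  -- `b` is algebraic over the base, so its product with the leading coefficient is integral. That
  -- product extends to `f⁻¹(W)`, where every function comes from `W` by `hf`.
  have hbint := RingHom.isIntegralElem_leadingCoeff_mul (f := (f.appLE W U c.le).hom) P b hPb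
  have hcomp : (resO c.le).comp (f.app W).hom = (f.appLE W U c.le).hom := by
    ext a
    have := resO_appLE f c.le (le_refl (f ⁻¹ᵁ W)) a
    rw [← this, Scheme.Hom.app_eq_appLE]
    rfl
  rw [← hcomp] at hbint
  obtain ⟨t, ht⟩ := exists_extend_of_isIntegral p c.le (f.app W).hom hbint
  refine ⟨P.leadingCoeff, inv (f.app W) t, Polynomial.leadingCoeff_ne_zero.mpr hP, ?_⟩
  have h1 : f.appLE W U c.le (inv (f.app W) t) = resO c.le t := by
    have := DFunLike.congr_fun hcomp (inv (f.app W) t)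
    rw [RingHom.comp_apply] at this
    rw [← this]
    congr 1
    rw [← CommRingCat.comp_apply, IsIso.inv_hom_id]
    rfl
  rw [h1, ht, hcomp]

end Const

end

section

variable {X S T : Scheme.{u}}

/-! ### Horizontal sections as modules over the base -/

section Hor

variable {f : X ⟶ S} {M : X.Modules} (N : Stratification f M) {W : S.Opens} {Y : X.Opens}

lemma Stratification.IsHorizontal.neg {N : Stratification f M} {e : Γ(M, Y)}
    (he : N.IsHorizontal e) : N.IsHorizontal (-e) := by
  intro V h D hD
  have h1 := he V h D hD
  rw [← N.applyHom_apply] at h1 ⊢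
  rw [map_neg, map_neg, h1, neg_zero]

lemma Stratification.IsHorizontal.appLE_smul {N : Stratification f M} (hY : Y ≤ f ⁻¹ᵁ W)
    {e : Γ(M, Y)} (he : N.IsHorizontal e) (a : Γ(S, W)) :
    N.IsHorizontal (f.appLE W Y hY a • e) := by
  intro V h D hD
  have h1 := he V h D hD
  rw [Stratification.apply] at h1 ⊢
  rw [resM_smul, resO_appLE, EndM.app_linear, h1, smul_zero]

/-- The horizontal sections over `Y`. -/
def horSubgroup (Y : X.Opens) : AddSubgroup Γ(M, Y) where
  carrier := {e | N.IsHorizontal e}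
  add_mem' ha hb := ha.add N hb
  zero_mem' := N.isHorizontal_zero Y
  neg_mem' h := h.neg

/-- The horizontal sections over `Y ≤ f⁻¹(W)`, as a module over the functions on `W`. -/
def Hor (hY : Y ≤ f ⁻¹ᵁ W) : Type u := horSubgroup N Y

variable (hY : Y ≤ f ⁻¹ᵁ W)

instance : AddCommGroup (Hor N hY) := inferInstanceAs (AddCommGroup (horSubgroup N Y))

variable {N hY} in
/-- The underlying section. -/
def Hor.val (e : Hor N hY) : Γ(M, Y) := Subtype.val e

variable {N hY} in
lemma Hor.prop (e : Hor N hY) : N.IsHorizontal e.val := Subtype.prop e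

variable {N} in
/-- A horizontal section. -/
def Hor.mk (hY : Y ≤ f ⁻¹ᵁ W) (e : Γ(M, Y)) (he : N.IsHorizontal e) : Hor N hY := ⟨e, he⟩

@[simp] lemma Hor.val_mk (e : Γ(M, Y)) (he : N.IsHorizontal e) : (Hor.mk hY e he).val = e := rfl

variable {N hY} in
lemma Hor.ext {e e' : Hor N hY} (h : e.val = e'.val) : e = e' := Subtype.ext h

instance : Module Γ(S, W) (Hor N hY) where
  smul a e := Hor.mk hY (f.appLE W Y hY a • e.val) (e.prop.appLE_smul hY a)
  one_smul e := Hor.ext (by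
    change f.appLE W Y hY 1 • e.val = e.val
    rw [map_one, one_smul])
  mul_smul a b e := Hor.ext (by
    change f.appLE W Y hY (a * b) • e.val = f.appLE W Y hY a • f.appLE W Y hY b • e.val
    rw [map_mul, mul_smul])
  smul_zero a := Hor.ext (smul_zero (f.appLE W Y hY a))
  smul_add a e e' := Hor.ext (smul_add (f.appLE W Y hY a) e.val e'.val)
  add_smul a b e := Hor.ext (by
    change f.appLE W Y hY (a + b) • e.val = f.appLE W Y hY a • e.val + f.appLE W Y hY b • e.val
    rw [map_add, add_smul])
  zero_smul e := Hor.ext (by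
    change f.appLE W Y hY 0 • e.val = 0
    rw [map_zero, zero_smul])

variable {N hY}

@[simp] lemma Hor.val_add (e e' : Hor N hY) : (e + e').val = e.val + e'.val := rfl

@[simp] lemma Hor.val_zero : (0 : Hor N hY).val = 0 := rfl

@[simp] lemma Hor.val_smul (a : Γ(S, W)) (e : Hor N hY) :
    (a • e).val = f.appLE W Y hY a • e.val := rfl

lemma Hor.val_sum {ι : Type*} (s : Finset ι) (e : ι → Hor N hY) :
    (∑ i ∈ s, e i).val = ∑ i ∈ s, (e i).val :=
  map_sum (horSubgroup N Y).subtype e s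

end Hor

section GaussManin

variable {f : X ⟶ S} {q : S ⟶ T} [Smooth f] [Smooth q] {M : X.Modules}
  (N : Stratification (f ≫ q) M) {W : S.Opens} {Y : X.Opens} (hY : Y ≤ f ⁻¹ᵁ W)

/-- The action of the differential operators of the base on horizontal sections. -/
def horDelta (D : diffOp q W) : Hor N.relative hY →+ Hor N.relative hY where
  toFun e := Hor.mk hY (gaussManin N D hY e.prop) (isHorizontal_gaussManin N D hY e.prop)
  map_zero' := Hor.ext (gaussManin_zero N D hY)
  map_add' e e' := Hor.ext (gaussManin_add N D hY e.prop e'.prop)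

lemma horDelta_one : horDelta N hY (1 : diffOp q W) = AddMonoidHom.id _ := by
  ext e
  exact Hor.ext (gaussManin_one N hY e.prop)

lemma horDelta_mul (D D' : diffOp q W) (e : Hor N.relative hY) :
    horDelta N hY (D * D') e = horDelta N hY D (horDelta N hY D' e) :=
  Hor.ext (gaussManin_mul N D D' hY e.prop)

lemma horDelta_diffMul (a : Γ(S, W)) (e : Hor N.relative hY) :
    horDelta N hY (diffMul q W a) e = a • e :=
  Hor.ext (gaussManin_diffMul N a hY e.prop)

lemma horDelta_sum {ι : Type*} (s : Finset ι) (D : ι → diffOp q W) (e : Hor N.relative hY) :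
    horDelta N hY (∑ i ∈ s, D i) e = ∑ i ∈ s, horDelta N hY (D i) e := by
  classical
  induction s using Finset.induction_on with
  | empty =>
    rw [Finset.sum_empty, Finset.sum_empty, ← map_zero (diffMul q W), horDelta_diffMul, zero_smul]
  | insert i s hi ih =>
    rw [Finset.sum_insert hi, Finset.sum_insert hi, ← ih]
    exact Hor.ext (gaussManin_add_left N _ _ hY e.prop)

/-- Makes the stability arguments for the derivations of `S` available on horizontal sections over
any open subset of `f⁻¹(W)`. -/
lemma isLeibniz_horDelta {W₀ : T.Opens} {σ : Type} [Fintype σ] (c : Coord q W₀ W σ) :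
    IsLeibniz c.taylor (fun β ↦ horDelta N hY (c.op β)) where
  zero m := by rw [c.op_zero, horDelta_one]; rfl
  smul β a m := by
    rw [← horDelta_diffMul N hY a m, ← horDelta_mul, c.op_mul_diffMul, horDelta_sum]
    refine Finset.sum_congr rfl fun p _ ↦ ?_
    rw [horDelta_mul, horDelta_diffMul]

end GaussManin

section Extension

variable {k : Type u} [Field k] [IsIntegral X] [IsIntegral S]
  {q : S ⟶ Spec (CommRingCat.of k)} {f : X ⟶ S} [Smooth f] [Smooth q] [Smooth (f ≫ q)]
  {M : X.Modules} [M.IsQuasicoherent] (N : Stratification (f ≫ q) M)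

/-- The result of applying a relative operator that kills `1` vanishes on a nonempty open subset,
hence everywhere by the identity theorem. -/
lemma isHorizontal_of_resM (hM : M.IsFiniteType) {V V' : X.Opens} (h : V' ≤ V)
    (hV' : Nonempty V') {e : Γ(M, V)} (he : N.relative.IsHorizontal (resM M h e)) :
    N.relative.IsHorizontal e := by
  intro Z hZ D hD
  by_cases hn : Nonempty Z
  · obtain ⟨x, hxZ, hxV⟩ := nonempty_inf hn hV'
    refine eq_zero_of_resM_eq_zero N hM (inf_le_left : Z ⊓ V' ≤ Z) ⟨⟨x, hxZ, hxV⟩⟩ ?_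
    rw [N.relative.resM_apply, resM_resM]
    have := he (Z ⊓ V') inf_le_right (diffRestr f inf_le_left D) (by
      have h1 := diffApply_res D le_rfl (inf_le_left : Z ⊓ V' ≤ Z) 1
      rw [hD, map_zero, map_one] at h1
      exact h1.symm)
    rwa [resM_resM] at this
  · exact eqM_of_local M _ _ fun x hx ↦ (hn ⟨⟨x, hx⟩⟩).elim

/-- A horizontal section extends to any open subset with coordinates after multiplication by a
function on the base. -/
lemma exists_smul_extend (hM : M.IsFiniteType) {W : S.Opens} [Nonempty W] {Y U : X.Opens}
    (hY : Nonempty Y) (hU : Nonempty U) {σ : Type} [Fintype σ] (c : Coord f W U σ) {e : Γ(M, Y)}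
    (he : N.relative.IsHorizontal e) :
    ∃ a : Γ(S, W), a ≠ 0 ∧ ∃ m : Γ(M, U), resM M inf_le_left m =
      f.appLE W (U ⊓ Y) (inf_le_left.trans c.le) a • resM M (inf_le_right : U ⊓ Y ≤ Y) e := by
  obtain ⟨x, hxU, hxY⟩ := nonempty_inf hU hY
  obtain ⟨b, hb, hxb, hbY⟩ := exists_basicOpen c.affine hxU hxY
  have hbU := X.basicOpen_le b
  let c' := c.restr (c.affine.basicOpen b) hbU
  let e' := resM M hbY e
  have he' : N.relative.IsHorizontal e' := he.res N.relative hbY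
  -- The denominators `a` for which `a • e'` extends to `U` form an ideal. It is stable, since the
  -- relative derivations act on the extension and treat `e'` as a constant, and contains a power of
  -- `b` by quasi-coherence; so it contains a nonzero base function.
  let I : Ideal Γ(X, U) :=
    { carrier := {a | ∃ m : Γ(M, U), resM M hbU m = resO hbU a • e'}
      add_mem' := by
        rintro a a' ⟨m, hm⟩ ⟨m', hm'⟩
        exact ⟨m + m', by rw [map_add, hm, hm', map_add, add_smul]⟩
      zero_mem' := ⟨0, by rw [map_zero, map_zero, zero_smul]⟩
      smul_mem' := by
        rintro r a ⟨m, hm⟩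
        exact ⟨r • m, by rw [resM_smul, hm, smul_eq_mul, map_mul, mul_smul]⟩ }
  have hI : I ≠ ⊥ := by
    obtain ⟨n, t, ht⟩ := exists_pow_smul_resM M c.affine b e'
    refine (Submodule.ne_bot_iff _).mpr ⟨b ^ n, ⟨t, ?_⟩, pow_ne_zero n hb⟩
    rw [ht, map_pow]
  obtain ⟨a, ha, m, hm⟩ := c.isTaylor.exists_const_mem c.etale hI (by
    rintro β a ⟨m, hm⟩
    refine ⟨N.relative.apply (c.op β) m, ?_⟩
    rw [N.relative.resM_apply, hm, c.restr_op β hbU (c.affine.basicOpen b), he'.apply_op_smul,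
      c.hasse_res])
  refine ⟨a, ha, m, ?_⟩
  have hle : X.basicOpen b ≤ U ⊓ Y := le_inf hbU hbY
  refine eq_of_resM_eq N hM hle ⟨⟨x, hxb⟩⟩ ?_
  rw [resM_resM, hm, resM_smul, resM_resM]
  congr 1
  exact (resO_appLE f hbU c.le a).trans (resO_appLE f hle _ a).symm

end Extension

end

section

variable {X S : Scheme.{u}}

/-! ### Horizontal sections independent over the base stay independent on `X` -/

section Independence

variable {k : Type u} [Field k] [IsIntegral X] [IsIntegral S]
  {q : S ⟶ Spec (CommRingCat.of k)} {f : X ⟶ S} [Smooth f] [Smooth q] [Smooth (f ≫ q)]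
  {M : X.Modules} [M.IsQuasicoherent] (N : Stratification (f ≫ q) M)

lemma nonempty_basicOpen {U : X.Opens} {a : Γ(X, U)} (ha : a ≠ 0) : Nonempty (X.basicOpen a) := by
  by_contra h
  apply ha
  rw [← basicOpen_eq_bot_iff]
  ext x
  exact ⟨fun hx ↦ (h ⟨⟨x, hx⟩⟩).elim, fun hx ↦ hx.elim⟩

lemma Stratification.apply_finsetSum {T : Scheme.{u}} {g : X ⟶ T} (N : Stratification g M)
    {U : X.Opens} (D : diffOp g U) {ι : Type*} (s : Finset ι) (e : ι → Γ(M, U)) :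
    N.apply D (∑ i ∈ s, e i) = ∑ i ∈ s, N.apply D (e i) := map_sum (N.applyHom D) e s

/-- Horizontal sections which are linearly independent over the base are linearly
independent. -/
lemma eq_zero_of_sum_smul_eq_zero (hM : M.IsFiniteType) {W : S.Opens} [Nonempty W]
    (hf : IsIso (f.app W)) {Y : X.Opens} {hY : Y ≤ f ⁻¹ᵁ W} {ι : Type*}
    {h : ι → Hor N.relative hY} (hli : LinearIndependent Γ(S, W) h) (s : Finset ι) {U : X.Opens}
    (hU : U ≤ Y) (hUn : Nonempty U) {σ : Type} [Fintype σ] (c : Coord f W U σ) (a : ι → Γ(X, U))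
    (ha : ∑ i ∈ s, a i • resM M hU (h i).val = 0) : ∀ i ∈ s, a i = 0 := by
  classical
  induction s using Finset.induction_on generalizing U with
  | empty => simp
  | insert j s hj ih =>
    rw [Finset.sum_insert hj] at ha
    by_cases haj : a j = 0
    · rw [haj, zero_smul, zero_add] at ha
      intro i hi
      rcases Finset.mem_insert.mp hi with rfl | hi
      · exact haj
      · exact ih hU hUn c a ha i hi
    exfalso
    -- Where `a j` is invertible, `h j` is a combination of the others with coefficients `g i`.
    -- Differentiating gives relations over the smaller set `s`, so by induction the `g i` are
    -- relative constants, hence fractions of base functions; this contradicts independence over the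
    -- base.
    let U' := X.basicOpen (a j)
    have hU' : U' ≤ U := X.basicOpen_le _
    have hn : Nonempty U' := nonempty_basicOpen haj
    have aU' : IsAffineOpen U' := c.affine.basicOpen _
    let c' := c.restr aU' hU'
    obtain ⟨v, hv⟩ : ∃ v, v * resO hU' (a j) = 1 :=
      (X.toRingedSpace.isUnit_res_basicOpen (a j)).exists_left_inv
    let g (i : ι) : Γ(X, U') := -(v * resO hU' (a i))
    have hg : resM M (hU'.trans hU) (h j).val = ∑ i ∈ s, g i • resM M (hU'.trans hU) (h i).val := by
      have h1 := congrArg (fun m ↦ v • resM M hU' m) ha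
      simp only [map_zero, smul_zero, map_add, resM_smul, smul_add, ← mul_smul, hv, one_smul,
        resM_resM, map_sum, Finset.smul_sum] at h1
      rw [eq_neg_of_add_eq_zero_left h1, ← Finset.sum_neg_distrib]
      simp only [g, neg_smul]
    have hc (i : ι) (hi : i ∈ s) (β) (hβ : β ≠ 0) : hasse c'.taylor β (g i) = 0 := by
      refine ih (hU'.trans hU) hn c' (fun i ↦ hasse c'.taylor β (g i)) ?_ i hi
      have h1 := congrArg (N.relative.apply (c'.op β)) hg
      rw [((h j).prop.res N.relative _).apply_op c' hβ, N.relative.apply_finsetSum] at h1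
      rw [h1]
      refine Finset.sum_congr rfl fun i _ ↦ ?_
      rw [((h i).prop.res N.relative _).apply_op_smul c']
    have hex (i : ι) : ∃ b z : Γ(S, W), b ≠ 0 ∧
        (i ∈ s → f.appLE W U' c'.le b * g i = f.appLE W U' c'.le z) := by
      by_cases hi : i ∈ s
      · obtain ⟨b, z, hb, hz⟩ := exists_of_const (f ≫ q) hf c' (hc i hi)
        exact ⟨b, z, hb, fun _ ↦ hz⟩
      · exact ⟨1, 0, one_ne_zero, fun h ↦ (hi h).elim⟩
    choose b z hb hz using hex
    let d := ∏ i ∈ s, b i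
    have hd : d ≠ 0 := Finset.prod_ne_zero_iff.mpr fun i _ ↦ hb i
    let z' (i : ι) := (∏ l ∈ s.erase i, b l) * z i
    have key : d • h j = ∑ i ∈ s, z' i • h i := by
      apply Hor.ext
      refine eq_of_resM_eq N hM (hU'.trans hU) hn ?_
      rw [Hor.val_smul, resM_smul, hg, Hor.val_sum, resM_sum, Finset.smul_sum]
      refine Finset.sum_congr rfl fun i hi ↦ ?_
      rw [Hor.val_smul, resM_smul, ← mul_smul, resO_appLE, resO_appLE]
      congr 1
      simp only [d, z']
      rw [← Finset.prod_erase_mul s b hi, map_mul, map_mul, mul_assoc]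
      congr 1
      exact hz i hi
    apply hd
    refine hli.eq_zero_of_smul_mem_span j d ?_
    rw [key]
    refine Submodule.sum_mem _ fun i hi ↦ Submodule.smul_mem _ _ (Submodule.subset_span ⟨i, ?_, rfl⟩)
    refine ⟨trivial, ?_⟩
    rintro rfl
    exact hj hi

end Independence

end

section

/-! ### Dual families, flat descent of divisibility, local bases -/

section Algebra

/-- A linearly independent family in a finite module over a domain has, up to a common
denominator, a dual family of functionals. -/
lemma exists_dual_family {A : Type*} [CommRing A] [IsDomain A] {M : Type*} [AddCommGroup M]
    [Module A M] [Module.Finite A M] {ι : Type*} [Finite ι] {h : ι → M}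
    (hli : LinearIndependent A h) :
    ∃ (d : A) (φ : ι → M →ₗ[A] A), d ≠ 0 ∧ (∀ i, φ i (h i) = d) ∧
      ∀ i j, i ≠ j → φ i (h j) = 0 := by
  classical
  let K := FractionRing A
  let V := LocalizedModule (nonZeroDivisors A) M
  let mk := LocalizedModule.mkLinearMap (nonZeroDivisors A) M
  have hv : LinearIndependent K (mk ∘ h) :=
    hli.of_isLocalizedModule K (nonZeroDivisors A) mk
  -- Over the fraction field the family has a left inverse. Its coordinate functionals become
  -- integral after multiplication by a common denominator on finitely many generators.
  obtain ⟨g, hg⟩ := LinearMap.exists_leftInverse_of_injective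
    (Finsupp.linearCombination K (mk ∘ h)) (LinearMap.ker_eq_bot.mpr hv)
  let ψ (i : ι) : M →ₗ[A] K := ((Finsupp.lapply i ∘ₗ g).restrictScalars A) ∘ₗ mk
  have hψ (i j : ι) : ψ i (h j) = Finsupp.single j (1 : K) i := by
    have := LinearMap.congr_fun hg (Finsupp.single j 1)
    simp only [LinearMap.comp_apply, Finsupp.linearCombination_single, one_smul,
      LinearMap.id_apply, Function.comp_apply] at this
    change (g (mk (h j))) i = _
    rw [this]
  obtain ⟨G, hG⟩ := (inferInstance : Module.Finite A M).fg_top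
  obtain ⟨b, hb⟩ := IsLocalization.exist_integer_multiples_of_finite (nonZeroDivisors A)
    (fun p : ι × G ↦ ψ p.1 p.2)
  have hinj : Function.Injective (Algebra.linearMap A K) := IsFractionRing.injective A K
  have hmem (i : ι) (m : M) : (b.1 • ψ i) m ∈ LinearMap.range (Algebra.linearMap A K) := by
    have hm : m ∈ Submodule.span A (G : Set M) := hG ▸ Submodule.mem_top
    induction hm using Submodule.span_induction with
    | mem m hm =>
      obtain ⟨a, ha⟩ := hb (i, ⟨m, hm⟩)
      exact ⟨a, ha⟩
    | zero => rw [map_zero]; exact Submodule.zero_mem _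
    | add x y _ _ hx hy => rw [map_add]; exact Submodule.add_mem _ hx hy
    | smul a x _ hx => rw [map_smul]; exact Submodule.smul_mem _ a hx
  let φ (i : ι) : M →ₗ[A] A := (LinearEquiv.ofInjective _ hinj).symm.toLinearMap ∘ₗ
    LinearMap.codRestrict _ (b.1 • ψ i) (hmem i)
  have hφ (i : ι) (m : M) : algebraMap A K (φ i m) = b.1 • ψ i m := by
    have := LinearEquiv.apply_symm_apply (LinearEquiv.ofInjective _ hinj)
      ⟨(b.1 • ψ i) m, hmem i m⟩
    exact congrArg Subtype.val this
  refine ⟨b.1, φ, nonZeroDivisors.ne_zero b.2, fun i ↦ hinj ?_, fun i j hij ↦ hinj ?_⟩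
  · refine (hφ i (h i)).trans ?_
    rw [hψ, Finsupp.single_eq_same, Algebra.smul_def, mul_one]
    rfl
  · refine (hφ i (h j)).trans ?_
    rw [hψ, Finsupp.single_eq_of_ne hij, smul_zero]
    exact (map_zero _).symm

/-- Colon ideals are compatible with flat base change. -/
lemma exists_dvd_mul_of_flat {C A : Type*} [CommRing C] [CommRing A] {φ : C →+* A} (h : φ.Flat)
    {a b : C} (hab : φ b ∣ φ a) :
    ∃ (n : ℕ) (c : Fin n → C) (y : Fin n → A), (∀ i, b ∣ c i * a) ∧ 1 = ∑ i, φ (c i) * y i := by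
  algebraize [φ]
  obtain ⟨z, hz⟩ := hab
  -- The equational criterion for flatness, applied to the relation `a • 1 - b • z = 0`.
  obtain ⟨n, c, y, h1, h2⟩ := Module.Flat.isTrivialRelation_of_sum_smul_eq_zero (R := C) (M := A)
    (f := ![a, -b]) (x := ![1, z]) (by
      simp only [Fin.sum_univ_two, Matrix.cons_val_zero, Matrix.cons_val_one, Algebra.smul_def,
        RingHom.algebraMap_toAlgebra]
      rw [mul_one, hz, map_neg, neg_mul, add_neg_cancel])
  refine ⟨n, c 0, y, fun i ↦ ⟨c 1 i, ?_⟩, ?_⟩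
  · have := h2 i
    simp only [Fin.sum_univ_two, Matrix.cons_val_zero, Matrix.cons_val_one] at this
    linear_combination this
  · have := h1 0
    simpa [Algebra.smul_def, RingHom.algebraMap_toAlgebra] using this

/-- The local basis of a finite module with a free localization. -/
lemma exists_local_basis {C : Type*} [CommRing C] [IsDomain C] [IsNoetherianRing C] {Q : Type*}
    [AddCommGroup Q] [Module C Q] [Module.Finite C Q] (p : Ideal C) [p.IsPrime]
    (hfree : Module.Free (Localization.AtPrime p) (LocalizedModule p.primeCompl Q)) :
    ∃ b ∉ p, ∃ (n : ℕ) (s : Fin n → Q), LinearIndependent C s ∧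
      ∀ t : Q, ∃ m : ℕ, b ^ m • t ∈ Submodule.span C (Set.range s) := by
  have : Module.FinitePresentation C Q := Module.finitePresentation_of_finite C Q
  obtain ⟨b, hb, hf, -⟩ := Module.FinitePresentation.exists_free_localizedModule_powers
    p.primeCompl (LocalizedModule.mkLinearMap p.primeCompl Q) (Localization.AtPrime p)
  let L := Localization (.powers b)
  let QL := LocalizedModule (.powers b) Q
  let mk := LocalizedModule.mkLinearMap (.powers b) Q
  have hb0 : b ≠ 0 := fun h ↦ hb (h ▸ p.zero_mem)
  have hbL : IsUnit (algebraMap C L b) := IsLocalization.map_units L ⟨b, Submonoid.mem_powers b⟩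
  have hfin : Module.Finite L QL := inferInstance
  have hinjL : Function.Injective (algebraMap C L) :=
    IsLocalization.injective L (M := .powers b) (by
      rintro _ ⟨n, rfl⟩
      exact mem_nonZeroDivisors_of_ne_zero (pow_ne_zero n hb0))
  have hnt : Nontrivial L := hinjL.nontrivial
  let B := Module.finBasis L QL
  have hex (i) : ∃ (s : Q) (m : ℕ), mk s = b ^ m • B i := by
    obtain ⟨⟨s, ⟨_, m, rfl⟩⟩, hs⟩ := IsLocalizedModule.surj (.powers b) mk (B i)
    exact ⟨s, m, hs.symm⟩
  choose s m hs using hex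
  have hu (i) : IsUnit (algebraMap C L (b ^ m i)) := by rw [map_pow]; exact hbL.pow _
  let B' := B.isUnitSMul hu
  have hB' (i) : B' i = mk (s i) := by
    rw [hs, Module.Basis.isUnitSMul_apply, algebraMap_smul]
  refine ⟨b, hb, _, s, ?_, fun t ↦ ?_⟩
  · have h1 : LinearIndependent L (mk ∘ s) := by
      have := B'.linearIndependent
      rwa [show (B' : _ → QL) = mk ∘ s from funext hB'] at this
    have h2 : LinearIndependent C (mk ∘ s) := by
      refine h1.restrict_scalars ?_
      intro x y hxy
      apply hinjL
      simpa [Algebra.smul_def] using hxy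
    exact h2.of_comp mk
  · have ht : mk t = ∑ i, B'.repr (mk t) i • mk (s i) := by
      conv_lhs => rw [← B'.sum_repr (mk t)]
      simp only [hB']
    obtain ⟨⟨_, r, rfl⟩, hr⟩ := IsLocalization.exist_integer_multiples_of_finite (.powers b)
      (fun i ↦ B'.repr (mk t) i)
    choose z hz using hr
    have h3 : mk (b ^ r • t) = mk (∑ i, z i • s i) := by
      rw [map_smul, ht, Finset.smul_sum, map_sum]
      refine Finset.sum_congr rfl fun i _ ↦ ?_
      rw [map_smul, ← smul_assoc, ← algebraMap_smul L (z i) (mk (s i)), hz]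
    obtain ⟨⟨_, l, rfl⟩, hl⟩ := (IsLocalizedModule.eq_iff_exists (.powers b) mk).mp h3
    refine ⟨l + r, ?_⟩
    rw [pow_add, mul_smul]
    have h4 : b ^ l • b ^ r • t = b ^ l • ∑ i, z i • s i := hl
    rw [h4]
    exact Submodule.smul_mem _ _ (Submodule.sum_mem _ fun i _ ↦ Submodule.smul_mem _ _
      (Submodule.subset_span ⟨i, rfl⟩))

end Algebra

end

section

variable {X S : Scheme.{u}}

/-! ### Finite families of charts meeting every fibre -/

section Cover

variable {k : Type u} [Field k] [IsIntegral X] [IsIntegral S]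
  {q : S ⟶ Spec (CommRingCat.of k)} {f : X ⟶ S} [Smooth f]

lemma appLE_injective {W : S.Opens} [Nonempty W] (hW : IsAffineOpen W) {V : X.Opens} [Nonempty V]
    (hV : V ≤ f ⁻¹ᵁ W) : Function.Injective (f.appLE W V hV) := by
  obtain ⟨V', hV', hxV', aV'⟩ := exists_affine (Classical.arbitrary V).2
  have : Nonempty V' := ⟨⟨_, hxV'⟩⟩
  have h1 : Function.Injective (f.appLE W V' (hV'.trans hV)).hom :=
    injective_of_flat (f.flat_appLE hW aV' _)
  intro a b hab
  apply h1
  have := congrArg (resO hV') hab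
  rwa [resO_appLE, resO_appLE] at this

/-- By flatness the colon ideal `(b : a)` generates the unit ideal of `Γ(X, U)`, so one of its
elements does not vanish at `f y`. -/
lemma exists_dvd_mul_mem_basicOpen {W : S.Opens} (hW : IsAffineOpen W) {U : X.Opens}
    (hU : IsAffineOpen U) (hUW : U ≤ f ⁻¹ᵁ W) {a b : Γ(S, W)}
    (hab : f.appLE W U hUW b ∣ f.appLE W U hUW a) {y : X} (hy : y ∈ U) :
    ∃ c : Γ(S, W), b ∣ c * a ∧ f y ∈ S.basicOpen c := by
  obtain ⟨n, c, z, hc, h1⟩ := exists_dvd_mul_of_flat (f.flat_appLE hW hU hUW) hab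
  by_contra! H
  have h2 (i : Fin n) : X.presheaf.germ U y hy (f.appLE W U hUW (c i)) ∈
      IsLocalRing.maximalIdeal (X.presheaf.stalk y) := by
    rw [IsLocalRing.mem_maximalIdeal, mem_nonunits_iff]
    intro hu
    refine H (c i) (hc i) ?_
    have h3 : y ∈ X.basicOpen (f.appLE W U hUW (c i)) := (X.mem_basicOpen _ y hy).mpr hu
    have h4 : X.basicOpen (f.appLE W U hUW (c i)) ≤ f ⁻¹ᵁ S.basicOpen (c i) := by
      rw [Scheme.basicOpen_appLE]
      exact inf_le_right
    exact h4 h3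
  have h3 := congrArg (X.presheaf.germ U y hy) h1
  rw [map_one, map_sum] at h3
  have h4 : (1 : X.presheaf.stalk y) ∈ IsLocalRing.maximalIdeal (X.presheaf.stalk y) := by
    rw [h3]
    refine Ideal.sum_mem _ fun i _ ↦ ?_
    rw [map_mul]
    exact Ideal.mul_mem_right _ _ (h2 i)
  exact (Ideal.ne_top_iff_one _).mp (IsLocalRing.maximalIdeal.isMaximal _).ne_top h4

variable (q f) in
/-- Finitely many small open subsets of `f⁻¹(W)` with coordinates relative to `W`, whose images
cover the image of `f⁻¹(W)`. -/
structure FibreCover (M : X.Modules) (W : S.Opens) where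
  /-- The number of open subsets. -/
  card : ℕ
  /-- The open subsets. -/
  U : Fin card → X.Opens
  small (j : Fin card) : IsSmall (f ≫ q) M (U j)
  /-- The relative dimension. -/
  dim : Fin card → ℕ
  /-- The coordinates. -/
  coord (j : Fin card) : Coord f W (U j) (Fin (dim j))
  surj (x : X) (hx : f x ∈ W) : ∃ j, ∃ y ∈ U j, f y = f x

/-- The union of the open subsets. -/
def FibreCover.union {M : X.Modules} {W : S.Opens} (F : FibreCover q f M W) : X.Opens := ⨆ j, F.U j

lemma FibreCover.le_union {M : X.Modules} {W : S.Opens} (F : FibreCover q f M W) (j) :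
    F.U j ≤ F.union := le_iSup F.U j

lemma FibreCover.union_le {M : X.Modules} {W : S.Opens} (F : FibreCover q f M W) :
    F.union ≤ f ⁻¹ᵁ W := iSup_le fun j ↦ (F.coord j).le

/-- Divisibility of functions on the base can be checked on the images of the members of
the cover. -/
lemma FibreCover.dvd {M : X.Modules} {W : S.Opens} [Nonempty W] (hW : IsAffineOpen W)
    (F : FibreCover q f M W) (hf : IsIso (f.app W)) {a b : Γ(S, W)} (hb : b ≠ 0)
    (h : ∀ j, f.appLE W (F.U j) (F.coord j).le b ∣ f.appLE W (F.U j) (F.coord j).le a) :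
    b ∣ a := by
  -- A point `y` of the cover in the fibre of `x` supplies `c` with `b ∣ c * a` and `c` invertible
  -- at `f x`. On `f⁻¹(D(c))`, which contains `x`, the factor `c` is a unit and can be dropped.
  have hloc (x : X) (hx : f x ∈ W) : ∃ (V : X.Opens) (hV : V ≤ f ⁻¹ᵁ W), x ∈ V ∧
      f.appLE W V hV b ∣ f.appLE W V hV a := by
    obtain ⟨j, y, hy, hyx⟩ := F.surj x hx
    obtain ⟨c, hc, hyc⟩ := exists_dvd_mul_mem_basicOpen hW (F.coord j).affine (F.coord j).le
      (h j) hy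
    refine ⟨f ⁻¹ᵁ S.basicOpen c, f.preimage_mono (S.basicOpen_le c),
      (show f x ∈ S.basicOpen c from hyx ▸ hyc), ?_⟩
    have h1 := map_dvd (f.appLE W (f ⁻¹ᵁ S.basicOpen c)
      (f.preimage_mono (S.basicOpen_le c))).hom hc
    rw [map_mul] at h1
    refine (IsUnit.dvd_mul_left ?_).mp h1
    have h2 : IsUnit (resO (S.basicOpen_le c) c) := S.toRingedSpace.isUnit_res_basicOpen c
    have h3 := h2.map (f.appLE (S.basicOpen c) (f ⁻¹ᵁ S.basicOpen c) le_rfl).hom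
    have h4 := appLE_resO f (S.basicOpen_le c) (le_refl (f ⁻¹ᵁ S.basicOpen c)) c
    exact h4 ▸ h3
  let P : X.Opens → Prop := fun V ↦ Nonempty V ∧
    ∃ hV : V ≤ f ⁻¹ᵁ W, f.appLE W V hV b ∣ f.appLE W V hV a
  have hP : ∀ V' ≤ f ⁻¹ᵁ W, ∀ x ∈ V', ∃ V'' ≤ V', x ∈ V'' ∧ P V'' := by
    intro V' hV' x hx
    obtain ⟨V, hV, hxV, hd⟩ := hloc x (hV' hx)
    refine ⟨V ⊓ V', inf_le_right, ⟨hxV, hx⟩, ⟨⟨x, hxV, hx⟩⟩, inf_le_left.trans hV, ?_⟩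
    have := map_dvd (resO (inf_le_left : V ⊓ V' ≤ V)) hd
    rwa [resO_appLE, resO_appLE] at this
  have hex (V : X.Opens) (hV : V ≤ f ⁻¹ᵁ W) (hp : P V) :
      ∃ z, f.appLE W V hV a = f.appLE W V hV b * z := hp.2.2
  choose s hs using hex
  obtain ⟨t, ht⟩ := exists_glueO P hP s fun V' V'' h' p' h p'' ↦ by
    have := p''.1
    have hb' : f.appLE W V'' (h.trans h') b ≠ 0 := by
      rw [← map_zero (f.appLE W V'' (h.trans h')).hom]
      exact (appLE_injective hW _).ne hb
    apply mul_left_cancel₀ hb'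
    rw [← hs, ← resO_appLE f h h' b, ← map_mul, ← hs, resO_appLE]
  have hab : f.app W a = f.app W b * t := by
    refine eqO_of_local _ _ fun x hx ↦ ?_
    obtain ⟨V, hV, hxV, hPV⟩ := hP _ le_rfl x hx
    refine ⟨V, hV, hxV, ?_⟩
    rw [map_mul, ht V hV hPV, Scheme.Hom.app_eq_appLE, resO_appLE, resO_appLE, hs]
  refine ⟨inv (f.app W) t, ?_⟩
  have h1 : Function.Injective (f.app W) := (ConcreteCategory.bijective_of_isIso (f.app W)).1
  apply h1
  rw [map_mul, hab]
  congr 1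
  rw [← CommRingCat.comp_apply, IsIso.inv_hom_id]
  rfl

end Cover

end

section

variable {X S : Scheme.{u}}

/-! ### Finiteness of horizontal sections on the union of a cover -/

section Finite

variable {k : Type u} [Field k] [IsIntegral X] [IsIntegral S]
  {q : S ⟶ Spec (CommRingCat.of k)} {f : X ⟶ S} [Smooth f] [Smooth q] [Smooth (f ≫ q)]
  {M : X.Modules} [M.IsQuasicoherent] (N : Stratification (f ≫ q) M)

lemma nonempty_preimage {W : S.Opens} [Nonempty W] (hf : IsIso (f.app W)) :
    Nonempty (f ⁻¹ᵁ W : X.Opens) := by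
  by_contra h
  have h1 : (0 : Γ(X, f ⁻¹ᵁ W)) = 1 :=
    eqO_of_local _ _ fun x hx ↦ (h ⟨⟨x, hx⟩⟩).elim
  have h2 : Function.Injective (f.app W) := (ConcreteCategory.bijective_of_isIso (f.app W)).1
  refine zero_ne_one (α := Γ(S, W)) (h2 ?_)
  rw [map_zero, map_one, h1]

lemma FibreCover.nonempty_index {W : S.Opens} [hWn : Nonempty W] (F : FibreCover q f M W)
    (hf : IsIso (f.app W)) : Nonempty (Fin F.card) := by
  obtain ⟨⟨x, hx⟩⟩ := nonempty_preimage hf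
  obtain ⟨j, -⟩ := F.surj x hx
  exact ⟨j⟩

lemma Hor.smul_eq_zero (hM : M.IsFiniteType) {W : S.Opens} [Nonempty W] (hW : IsAffineOpen W)
    {Y : X.Opens} {hY : Y ≤ f ⁻¹ᵁ W} (hYn : Nonempty Y) {a : Γ(S, W)} (ha : a ≠ 0)
    {e : Hor N.relative hY} (he : a • e = 0) : e = 0 := by
  obtain ⟨⟨x, hx⟩⟩ := hYn
  obtain ⟨U, hU, hxU, hs⟩ := exists_isSmall (p := f ≫ q) hM hx
  obtain ⟨U', hU', hxU', aU'⟩ := exists_affine hxU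
  have hn : Nonempty U' := ⟨⟨x, hxU'⟩⟩
  apply Hor.ext
  refine eq_zero_of_resM_eq_zero N hM (hU'.trans hU) hn ?_
  have h1 := congrArg (fun e : Hor N.relative hY ↦ resM M (hU'.trans hU) e.val) he
  simp only [Hor.val_smul, resM_smul, Hor.val_zero, map_zero, resO_appLE] at h1
  refine (hs U' hU' aU' hn).smul_eq_zero N ?_ h1
  rw [← map_zero (f.appLE W U' ((hU'.trans hU).trans hY)).hom]
  exact (appLE_injective hW _).ne ha

/-- The common denominators of the functions with a given denominator are defined over the
base. -/
lemma exists_base_denominator {W : S.Opens} [Nonempty W] {U : X.Opens} [Nonempty U] {σ : Type}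
    [Fintype σ] (c : Coord f W U σ) {d : Γ(X, U)} (hd : d ≠ 0) :
    ∃ a : Γ(S, W), a ≠ 0 ∧ ∀ b x : Γ(S, W), f.appLE W U c.le b ∣ d * f.appLE W U c.le x →
      f.appLE W U c.le b ∣ f.appLE W U c.le (a * x) := by
  let φ := (f.appLE W U c.le).hom
  -- Pulled-back functions are constants for the relative derivations, so a divisibility can be
  -- differentiated: the universal denominators form a stable ideal, which contains a nonzero base
  -- function.
  let I : Ideal Γ(X, U) :=
    { carrier := {a | ∀ b x : Γ(S, W), φ b ∣ d * φ x → φ b ∣ a * φ x}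
      add_mem' := fun {a a'} h h' b x hbx ↦ by
        rw [add_mul]
        exact dvd_add (h b x hbx) (h' b x hbx)
      zero_mem' := fun b x _ ↦ by rw [zero_mul]; exact dvd_zero _
      smul_mem' := fun r a h b x hbx ↦ by
        rw [smul_eq_mul, mul_assoc]
        exact (h b x hbx).mul_left r }
  obtain ⟨a, ha, haI⟩ := c.isTaylor.exists_const_mem c.etale (I := I)
    ((Submodule.ne_bot_iff _).mpr ⟨d, fun b x h ↦ h, hd⟩) (by
      intro β a h b x hbx
      obtain ⟨y, hy⟩ := h b x hbx
      refine ⟨hasse c.taylor β y, ?_⟩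
      have h1 := congrArg (hasse c.taylor β) hy
      rw [mul_comm, c.isTaylor.hasse_const_mul, c.isTaylor.hasse_const_mul] at h1
      rw [mul_comm, h1])
  refine ⟨a, ha, fun b x h ↦ ?_⟩
  rw [map_mul]
  exact haI b x h

/-- The horizontal sections on the union of a cover are a finite module over the base. -/
lemma FibreCover.finite_hor (hM : M.IsFiniteType) {W : S.Opens} [Nonempty W]
    (hW : IsAffineOpen W) [IsNoetherianRing Γ(S, W)] (hf : IsIso (f.app W))
    (F : FibreCover q f M W) : Module.Finite Γ(S, W) (Hor N.relative F.union_le) := by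
  classical
  let C := Γ(S, W)
  let Q := Hor N.relative F.union_le
  obtain ⟨j₀⟩ := F.nonempty_index hf
  have hn (j) : Nonempty (F.U j) := (F.small j).nonempty
  have hYn : Nonempty F.union := ⟨⟨_, F.le_union j₀ (Classical.arbitrary (F.U j₀)).2⟩⟩
  -- A maximal independent family over the base stays independent on a chart, where `M` is a finite
  -- module over a noetherian ring; so the family is finite.
  obtain ⟨I, hI, hImax⟩ := exists_maximal_linearIndepOn C (id : Q → Q)
  have hli : LinearIndependent C (fun i : I ↦ (i : Q)) := hI
  have hliU (j) : LinearIndependent Γ(X, F.U j)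
      (fun i : I ↦ resM M (F.le_union j) (i : Q).val) := by
    rw [linearIndependent_iff']
    exact fun s a ha ↦ eq_zero_of_sum_smul_eq_zero N hM hf hli s (F.le_union j) (hn j)
      (F.coord j) a ha
  have hfin : Finite I := by
    obtain ⟨n, ⟨c⟩⟩ := (F.small j₀).coord
    have := c.isNoetherianRing
    have := (F.small j₀).finite
    exact (hliU j₀).finite_of_isNoetherian
  have := Fintype.ofFinite I
  have hexp (e : Q) : ∃ (b : C) (x : I → C), b ≠ 0 ∧ b • e = ∑ i, x i • (i : Q) := by
    have key : ∃ b : C, b ≠ 0 ∧ b • e ∈ Submodule.span C (Set.range fun i : I ↦ (i : Q)) := by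
      by_cases he : e ∈ I
      · exact ⟨1, one_ne_zero, by rw [one_smul]; exact Submodule.subset_span ⟨⟨e, he⟩, rfl⟩⟩
      · obtain ⟨b, hb, h⟩ := hImax e he
        refine ⟨b, hb, ?_⟩
        rw [Subtype.range_coe]
        simpa using h
    obtain ⟨b, hb, h⟩ := key
    obtain ⟨x, hx⟩ := (Submodule.mem_span_range_iff_exists_fun C).mp h
    exact ⟨b, x, hb, hx.symm⟩
  -- The coordinates of `e` in the family are the fractions `x i / b`. Dual functionals on the chart
  -- bound their denominators by a function on the chart, and then by a base function independent of
  -- `e`.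
  have hden (j) : ∃ a : C, a ≠ 0 ∧ ∀ (e : Q) (b : C) (x : I → C), b • e = ∑ i, x i • (i : Q) →
      ∀ i, f.appLE W (F.U j) (F.coord j).le b ∣ f.appLE W (F.U j) (F.coord j).le (a * x i) := by
    have := (F.small j).finite
    obtain ⟨d, φ, hd, hφ, hφ'⟩ := exists_dual_family (hliU j)
    obtain ⟨a, ha, h⟩ := exists_base_denominator (F.coord j) hd
    refine ⟨a, ha, fun e b x hx i ↦ h _ _ ⟨φ i (resM M (F.le_union j) e.val), ?_⟩⟩
    have hv : f.appLE W F.union F.union_le b • Hor.val e =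
        ∑ l : I, f.appLE W F.union F.union_le (x l) • Hor.val (l : Q) :=
      (congrArg Hor.val hx).trans (Hor.val_sum _ _)
    have h1 := congrArg (fun m ↦ φ i (resM M (F.le_union j) m)) hv
    simp only [resM_smul, resO_appLE, map_smul, map_sum, smul_eq_mul] at h1
    rw [h1, Finset.sum_eq_single i, hφ, mul_comm]
    · intro l _ hl
      rw [hφ' i l hl.symm, mul_zero]
    · simp
  choose a ha hda using hden
  let d := ∏ j, a j
  have hd : d ≠ 0 := Finset.prod_ne_zero_iff.mpr fun j _ ↦ ha j
  -- With `d` the product of these bounds, `b` divides `d * x i` on every chart, hence over `W`. So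
  -- multiplication by `d` maps all horizontal sections into one finitely generated module.
  have hmem (e : Q) : d • e ∈ Submodule.span C (Set.range fun i : I ↦ (i : Q)) := by
    obtain ⟨b, x, hb, hx⟩ := hexp e
    have hdvd (i : I) : b ∣ d * x i := by
      refine F.dvd hW hf hb fun j ↦ ?_
      have h1 := hda j e b x hx i
      have h2 : d * x i = (∏ l ∈ Finset.univ.erase j, a l) * (a j * x i) := by
        rw [← mul_assoc, Finset.prod_erase_mul _ _ (Finset.mem_univ j)]
      rw [h2, map_mul]
      exact h1.mul_left _
    choose z hz using hdvd
    have h3 : d • e = ∑ i, z i • (i : Q) := by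
      rw [← sub_eq_zero]
      refine Hor.smul_eq_zero N hM hW hYn hb ?_
      rw [smul_sub, smul_comm, hx, Finset.smul_sum, Finset.smul_sum, sub_eq_zero]
      refine Finset.sum_congr rfl fun i _ ↦ ?_
      rw [← mul_smul, ← mul_smul, hz]
    rw [h3]
    exact Submodule.sum_mem _ fun i _ ↦ Submodule.smul_mem _ _ (Submodule.subset_span ⟨i, rfl⟩)
  have hfs : Module.Finite C (Submodule.span C (Set.range fun i : I ↦ (i : Q))) :=
    Module.Finite.span_of_finite C (Set.finite_range _)
  refine Module.Finite.of_injective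
    (LinearMap.codRestrict (Submodule.span C (Set.range fun i : I ↦ (i : Q)))
      (LinearMap.lsmul C Q d) hmem) fun e e' h ↦ ?_
  have h1 : d • e = d • e' := congrArg Subtype.val h
  rw [← sub_eq_zero, ← smul_sub] at h1
  exact sub_eq_zero.mp (Hor.smul_eq_zero N hM hW hYn hd h1)

end Finite

end

section

variable {X S : Scheme.{u}}

/-! ### Extension of horizontal sections to the full preimage -/

section ModuleTheory

/-- In a finite module with a Leibniz action of the derivations of a simple ring, a stable
submodule with torsion quotient is everything. -/
lemma IsLeibniz.mem_of_exists_smul_mem {A σ M : Type*} [CommRing A] [IsDomain A] [Fintype σ]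
    {τ : A →+* MvPowerSeries σ A} [AddCommGroup M] [Module A M] [Module.Finite A M]
    {δ : (σ →₀ ℕ) → M →+ M} (hδ : IsLeibniz τ δ) (hs : IsSimple τ) (M' : Submodule A M)
    (hM' : ∀ β, ∀ m ∈ M', δ β m ∈ M') (h : ∀ m, ∃ a : A, a ≠ 0 ∧ a • m ∈ M') (m : M) :
    m ∈ M' := by
  classical
  -- The conductor of `M` into `M'` is stable, and nonzero because `M` is finitely generated.
  let I : Ideal A :=
    { carrier := {a | ∀ m ∈ (⊤ : Submodule A M), a • m ∈ M'}
      add_mem' := fun {a b} ha hb m hm ↦ by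
        rw [add_smul]; exact M'.add_mem (ha m hm) (hb m hm)
      zero_mem' := fun m _ ↦ by rw [zero_smul]; exact M'.zero_mem
      smul_mem' := fun c a ha m hm ↦ by
        rw [smul_eq_mul, mul_smul]; exact M'.smul_mem c (ha m hm) }
  obtain ⟨s, hsp⟩ := Module.Finite.fg_top (R := A) (M := M)
  choose a ha ham using h
  have hI : (∏ m ∈ s, a m) ∈ I := by
    intro m hm
    rw [← hsp] at hm
    induction hm using Submodule.span_induction with
    | mem m hm =>
      rw [← Finset.prod_erase_mul s a (Finset.mem_coe.mp hm), mul_smul]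
      exact M'.smul_mem _ (ham m)
    | zero => rw [smul_zero]; exact M'.zero_mem
    | add x y _ _ hx hy => rw [smul_add]; exact M'.add_mem hx hy
    | smul c x _ hx => rw [smul_comm]; exact M'.smul_mem c hx
  rcases hs I fun β a ha ↦ hδ.colon_stable ⊤ M' (fun _ _ _ ↦ Submodule.mem_top) hM' β a ha
    with h | h
  · rw [h, Submodule.mem_bot] at hI
    exact absurd hI (Finset.prod_ne_zero_iff.mpr fun m _ ↦ ha m)
  · have h1 : (1 : A) ∈ I := h ▸ Submodule.mem_top
    simpa using h1 m Submodule.mem_top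

end ModuleTheory

section Extension

variable {k : Type u} [Field k] [IsIntegral X] [IsIntegral S]
  {q : S ⟶ Spec (CommRingCat.of k)} {f : X ⟶ S} [Smooth f] [Smooth q] [Smooth (f ≫ q)]
  {M : X.Modules} [M.IsQuasicoherent] (N : Stratification (f ≫ q) M)

-- Quasi-compactness of `f` is not needed: `f` is open and the image of `f⁻¹(W)` is compact, as a
-- subset of a noetherian space, so finitely many charts have images covering it.
variable (q f) in
lemma exists_fibreCover (hM : M.IsFiniteType) {W : S.Opens} (hW : IsAffineOpen W)
    [IsNoetherianRing Γ(S, W)] : Nonempty (FibreCover q f M W) := by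
  have hcov (x : (f ⁻¹ᵁ W : X.Opens)) : ∃ (U : X.Opens) (n : ℕ), x.1 ∈ U ∧
      IsSmall (f ≫ q) M U ∧ Nonempty (Coord f W U (Fin n)) := by
    obtain ⟨V, hV, hxV, hs⟩ := exists_isSmall (p := f ≫ q) hM x.2
    obtain ⟨U, n, hU, hxU, ⟨c⟩⟩ := exists_coord f hW hxV x.2
    exact ⟨U, n, hxU, hs U hU c.affine ⟨⟨_, hxU⟩⟩, ⟨c⟩⟩
  choose U n hxU hs hc using hcov
  let K : Set S := f '' (f ⁻¹ᵁ W : X.Opens)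
  have hK : IsCompact K := by
    have h1 : K = hW.fromSpec '' (hW.fromSpec ⁻¹' K) := by
      rw [Set.image_preimage_eq_inter_range, hW.range_fromSpec, Set.inter_eq_left.mpr]
      rintro _ ⟨x, hx, rfl⟩
      exact hx
    rw [h1]
    have : NoetherianSpace (Spec Γ(S, W)) :=
      inferInstanceAs (NoetherianSpace (PrimeSpectrum Γ(S, W)))
    exact (NoetherianSpace.isCompact _).image hW.fromSpec.continuous
  obtain ⟨t, ht⟩ := hK.elim_finite_subcover (fun x ↦ f '' (U x))
    (fun x ↦ f.isOpenMap _ (U x).isOpen) (by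
      rintro _ ⟨x, hx, rfl⟩
      exact Set.mem_iUnion.mpr ⟨⟨x, hx⟩, x, hxU ⟨x, hx⟩, rfl⟩)
  let i (j : Fin t.card) : (f ⁻¹ᵁ W : X.Opens) := (t.equivFin.symm j).1
  refine ⟨⟨t.card, fun j ↦ U (i j), fun j ↦ hs _, fun j ↦ n (i j), fun j ↦ (hc _).some, ?_⟩⟩
  intro x hx
  obtain ⟨z, hz⟩ := Set.mem_iUnion.mp (ht ⟨x, hx, rfl⟩)
  obtain ⟨hzt, y, hy, hyx⟩ := Set.mem_iUnion.mp hz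
  refine ⟨t.equivFin ⟨z, hzt⟩, y, ?_, hyx⟩
  simpa [i] using hy

/-- If the horizontal sections over `Y` are a finite module over the base, they extend to any open
subset with coordinates. -/
lemma exists_extend_coord (hM : M.IsFiniteType) {W : S.Opens} [Nonempty W] {Y U : X.Opens}
    (hY : Y ≤ f ⁻¹ᵁ W) [Module.Finite Γ(S, W) (Hor N.relative hY)]
    (hYn : Nonempty Y) (hUn : Nonempty U) {ρ σ : Type} [Fintype ρ] [Fintype σ]
    (cS : Coord q ⊤ W σ) (c : Coord f W U ρ) (e : Hor N.relative hY) :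
    ∃ m : Γ(M, U), resM M inf_le_left m = resM M (inf_le_right : U ⊓ Y ≤ Y) e.val := by
  have hn : Nonempty (U ⊓ Y : X.Opens) := by
    obtain ⟨x, hx⟩ := nonempty_inf hUn hYn
    exact ⟨⟨x, hx⟩⟩
  let Q : Submodule Γ(S, W) (Hor N.relative hY) :=
    { carrier := {e | ∃ m : Γ(M, U),
        resM M inf_le_left m = resM M (inf_le_right : U ⊓ Y ≤ Y) e.val}
      add_mem' := by
        rintro e e' ⟨m, hm⟩ ⟨m', hm'⟩
        exact ⟨m + m', by rw [map_add, hm, hm', Hor.val_add, map_add]⟩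
      zero_mem' := ⟨0, by rw [map_zero, Hor.val_zero, map_zero]⟩
      smul_mem' := by
        rintro a e ⟨m, hm⟩
        refine ⟨f.appLE W U c.le a • m, ?_⟩
        rw [resM_smul, hm, Hor.val_smul, resM_smul, resO_appLE, resO_appLE] }
  -- The extendable sections are stable because the action of the derivations of the base commutes
  -- with restriction, and `exists_smul_extend` makes the quotient torsion.
  refine (isLeibniz_horDelta N hY cS).mem_of_exists_smul_mem cS.isSimple Q ?_ ?_ e
  · rintro β e ⟨m, hm⟩
    have hhor : N.relative.IsHorizontal m := by
      refine isHorizontal_of_resM N hM (inf_le_left : U ⊓ Y ≤ U) hn ?_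
      rw [hm]
      exact e.prop.res N.relative _
    refine ⟨gaussManin N (cS.op β) c.le hhor, ?_⟩
    refine (resM_gaussManin_eq N (cS.op β) c.le hhor le_rfl inf_le_left
      (inf_le_left.trans c.le)).trans ?_
    refine Eq.trans ?_ (resM_gaussManin_eq N (cS.op β) hY e.prop le_rfl inf_le_right
      (inf_le_left.trans c.le)).symm
    congr 1
  · intro e
    obtain ⟨a, ha, m, hm⟩ := exists_smul_extend N hM hYn hUn c e.prop
    refine ⟨a, ha, m, ?_⟩
    rw [hm, Hor.val_smul, resM_smul, resO_appLE]

/-- If the horizontal sections over `Y` are a finite module over the base, they extend to the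
preimage of the base. -/
lemma exists_extend_preimage (hM : M.IsFiniteType) {W : S.Opens} [Nonempty W] {Y : X.Opens}
    (hY : Y ≤ f ⁻¹ᵁ W) [Module.Finite Γ(S, W) (Hor N.relative hY)]
    (hYn : Nonempty Y) {σ : Type} [Fintype σ]
    (cS : Coord q ⊤ W σ) (e : Hor N.relative hY) :
    ∃ t : Hor N.relative (le_refl (f ⁻¹ᵁ W)), resM M hY t.val = e.val := by
  let P : X.Opens → Prop := fun U ↦ Nonempty U ∧ ∃ n, Nonempty (Coord f W U (Fin n))
  have hP : ∀ V' ≤ f ⁻¹ᵁ W, ∀ x ∈ V', ∃ V'' ≤ V', x ∈ V'' ∧ P V'' := by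
    intro V' hV' x hx
    obtain ⟨U, n, hU, hxU, hc⟩ := exists_coord f cS.affine hx (hV' hx)
    exact ⟨U, hU, hxU, ⟨⟨x, hxU⟩⟩, n, hc⟩
  have hex (U : X.Opens) (hU : U ≤ f ⁻¹ᵁ W) (p : P U) :
      ∃ m : Γ(M, U), resM M inf_le_left m = resM M (inf_le_right : U ⊓ Y ≤ Y) e.val := by
    obtain ⟨hn, n, ⟨c⟩⟩ := p
    exact exists_extend_coord N hM hY hYn hn cS c e
  choose s hs using hex
  have hne {U : X.Opens} (hU : Nonempty U) : Nonempty (U ⊓ Y : X.Opens) := by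
    obtain ⟨x, hx⟩ := nonempty_inf hU hYn
    exact ⟨⟨x, hx⟩⟩
  obtain ⟨t, ht⟩ := exists_glueM M P hP s fun V' V'' h' p' h p'' ↦ by
    refine eq_of_resM_eq N hM (inf_le_left : V'' ⊓ Y ≤ V'') (hne p''.1) ?_
    rw [hs, resM_resM, ← resM_resM M (inf_le_left : V' ⊓ Y ≤ V') (inf_le_inf_right Y h), hs,
      resM_resM]
  obtain ⟨⟨x, hx⟩⟩ := hYn
  obtain ⟨U, hU, hxU, p⟩ := hP (f ⁻¹ᵁ W) le_rfl x (hY hx)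
  have hres : resM M hY t = e.val := by
    refine eq_of_resM_eq N hM (inf_le_right : U ⊓ Y ≤ Y) ⟨⟨x, hxU, hx⟩⟩ ?_
    rw [← hs U hU p, resM_resM, ← resM_resM M hU inf_le_left, ht U hU p]
  refine ⟨Hor.mk _ t (isHorizontal_of_resM N hM hY ⟨⟨x, hx⟩⟩ ?_), hres⟩
  rw [hres]
  exact e.prop

/-- The horizontal sections over the preimage of an open subset with coordinates are a finite
module. -/
lemma finite_hor_preimage (hM : M.IsFiniteType) {W : S.Opens} [Nonempty W]
    {σ : Type} [Fintype σ] (cS : Coord q ⊤ W σ) (hf : IsIso (f.app W)) :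
    Module.Finite Γ(S, W) (Hor N.relative (le_refl (f ⁻¹ᵁ W))) := by
  have := cS.isNoetherianRing
  obtain ⟨F⟩ := exists_fibreCover q f hM cS.affine
  have := F.finite_hor N hM cS.affine hf
  obtain ⟨j⟩ := F.nonempty_index hf
  obtain ⟨⟨x, hx⟩⟩ := (F.small j).nonempty
  -- Restriction to the union of the cover is injective by the identity theorem, and its target is a
  -- finite module over a noetherian ring.
  let φ : Hor N.relative (le_refl (f ⁻¹ᵁ W)) →ₗ[Γ(S, W)] Hor N.relative F.union_le :=
    { toFun := fun e ↦ Hor.mk _ (resM M F.union_le e.val) (e.prop.res N.relative _)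
      map_add' := fun e e' ↦ Hor.ext (map_add (resM M F.union_le) e.val e'.val)
      map_smul' := fun a e ↦ Hor.ext (by
        change resM M F.union_le (f.appLE W _ le_rfl a • e.val) = _
        rw [resM_smul, resO_appLE]
        rfl) }
  refine Module.Finite.of_injective φ fun e e' h ↦ Hor.ext ?_
  exact eq_of_resM_eq N hM F.union_le ⟨⟨x, F.le_union j hx⟩⟩ (congrArg Hor.val h)

/-- A horizontal section over the preimage of a basic open subset extends after multiplication by
a power of the function. -/
lemma exists_pow_smul_extend (hM : M.IsFiniteType) {W : S.Opens} [Nonempty W]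
    {σ : Type} [Fintype σ] (cS : Coord q ⊤ W σ) (hf : IsIso (f.app W)) {b : Γ(S, W)}
    {h : f ⁻¹ᵁ (S.basicOpen b) ≤ f ⁻¹ᵁ W} (hn : Nonempty (f ⁻¹ᵁ S.basicOpen b : X.Opens))
    (e : Hor N.relative h) :
    ∃ (n : ℕ) (t : Hor N.relative (le_refl (f ⁻¹ᵁ W))), resM M h t.val = (b ^ n • e).val := by
  have := cS.isNoetherianRing
  obtain ⟨F⟩ := exists_fibreCover q f hM cS.affine
  have := F.finite_hor N hM cS.affine hf
  obtain ⟨j₀⟩ := F.nonempty_index hf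
  have hFn : Nonempty F.union := by
    obtain ⟨⟨x, hx⟩⟩ := (F.small j₀).nonempty
    exact ⟨⟨x, F.le_union j₀ hx⟩⟩
  have hne {U : X.Opens} (hU : Nonempty U) : Nonempty (U ⊓ f ⁻¹ᵁ S.basicOpen b : X.Opens) := by
    obtain ⟨x, hx⟩ := nonempty_inf hU hn
    exact ⟨⟨x, hx⟩⟩
  have hle {U : X.Opens} : U ⊓ f ⁻¹ᵁ S.basicOpen b ≤ f ⁻¹ᵁ W := inf_le_right.trans h
  have hloc (j) : ∃ (n : ℕ) (t : Γ(M, F.U j)), resM M inf_le_left t =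
      f.appLE W (F.U j ⊓ f ⁻¹ᵁ S.basicOpen b) hle b ^ n • resM M inf_le_right e.val := by
    have hb : X.basicOpen (f.appLE W (F.U j) (F.coord j).le b) = F.U j ⊓ f ⁻¹ᵁ S.basicOpen b :=
      Scheme.basicOpen_appLE _ _ _ _ _
    have key (V : X.Opens) (hV : V = F.U j ⊓ f ⁻¹ᵁ S.basicOpen b) (hVU : V ≤ F.U j)
        (hVb : V ≤ f ⁻¹ᵁ S.basicOpen b)
        (n : ℕ) (t : Γ(M, F.U j)) (ht : resM M hVU t =
          resO hVU (f.appLE W (F.U j) (F.coord j).le b) ^ n • resM M hVb e.val) :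
        resM M inf_le_left t =
          f.appLE W (F.U j ⊓ f ⁻¹ᵁ S.basicOpen b) hle b ^ n • resM M inf_le_right e.val := by
      subst hV
      rw [ht, resO_appLE]
    obtain ⟨n, t, ht⟩ := exists_pow_smul_resM M (F.coord j).affine
      (f.appLE W (F.U j) (F.coord j).le b) (resM M (hb.le.trans inf_le_right) e.val)
    exact ⟨n, t, key _ hb _ _ n t ht⟩
  choose n t ht using hloc
  let m := ∑ j, n j
  have hloc' (j) : ∃ t : Γ(M, F.U j), resM M inf_le_left t =
      f.appLE W (F.U j ⊓ f ⁻¹ᵁ S.basicOpen b) hle b ^ m • resM M inf_le_right e.val := by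
    have hnm : n j ≤ m := Finset.single_le_sum (fun _ _ ↦ Nat.zero_le _) (Finset.mem_univ j)
    refine ⟨f.appLE W (F.U j) (F.coord j).le b ^ (m - n j) • t j, ?_⟩
    rw [resM_smul, ht, map_pow, resO_appLE, ← mul_smul, ← pow_add, Nat.sub_add_cancel hnm]
  let P : X.Opens → Prop := fun V ↦ Nonempty V ∧ ∃ j, V ≤ F.U j
  have hP : ∀ V' ≤ F.union, ∀ x ∈ V', ∃ V'' ≤ V', x ∈ V'' ∧ P V'' := by
    intro V' hV' x hx
    obtain ⟨j, hj⟩ := Opens.mem_iSup.mp (hV' hx)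
    exact ⟨V' ⊓ F.U j, inf_le_left, ⟨hx, hj⟩, ⟨⟨x, hx, hj⟩⟩, j, inf_le_right⟩
  have hex (V : X.Opens) (hV : V ≤ F.union) (p : P V) : ∃ t : Γ(M, V), resM M inf_le_left t =
      f.appLE W (V ⊓ f ⁻¹ᵁ S.basicOpen b) hle b ^ m • resM M inf_le_right e.val := by
    obtain ⟨hVn, j, hj⟩ := p
    obtain ⟨t, ht⟩ := hloc' j
    refine ⟨resM M hj t, ?_⟩
    rw [resM_resM, ← resM_resM M (inf_le_left : F.U j ⊓ f ⁻¹ᵁ S.basicOpen b ≤ F.U j)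
      (inf_le_inf_right _ hj), ht, resM_smul, map_pow, resO_appLE, resM_resM]
  choose s hs using hex
  obtain ⟨r, hr⟩ := exists_glueM M P hP s fun V' V'' h' p' h p'' ↦ by
    refine eq_of_resM_eq N hM (inf_le_left : V'' ⊓ f ⁻¹ᵁ S.basicOpen b ≤ V'') (hne p''.1) ?_
    rw [hs, resM_resM, ← resM_resM M (inf_le_left : V' ⊓ f ⁻¹ᵁ S.basicOpen b ≤ V')
      (inf_le_inf_right _ h), hs, resM_smul, map_pow, resO_appLE, resM_resM]
  obtain ⟨⟨x, hx⟩⟩ := hFn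
  obtain ⟨U, hU, hxU, p⟩ := hP F.union le_rfl x hx
  have hUn := hne p.1
  have hrU : resM M (inf_le_left.trans hU : U ⊓ f ⁻¹ᵁ S.basicOpen b ≤ F.union) r =
      resM M inf_le_right (b ^ m • e).val := by
    rw [← resM_resM M hU inf_le_left, hr U hU p, hs, Hor.val_smul, resM_smul, resO_appLE, map_pow]
  have hrh : N.relative.IsHorizontal r := by
    refine isHorizontal_of_resM N hM
      (inf_le_left.trans hU : U ⊓ f ⁻¹ᵁ S.basicOpen b ≤ F.union) hUn ?_
    rw [hrU]
    exact (b ^ m • e).prop.res N.relative _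
  obtain ⟨z, hz⟩ := exists_extend_preimage N hM F.union_le ⟨⟨x, hx⟩⟩ cS (Hor.mk _ r hrh)
  refine ⟨m, z, eq_of_resM_eq N hM (inf_le_right : U ⊓ f ⁻¹ᵁ S.basicOpen b ≤ _) hUn ?_⟩
  rw [← hrU, resM_resM, ← resM_resM M F.union_le (inf_le_left.trans hU), hz, Hor.val_mk]

end Extension

end

section

variable {X S : Scheme.{u}}

/-! ### Local bases and local freeness of the pushforward -/

section LocalBasis

variable {W : S.Opens} {F : S.Modules} {n : ℕ} {s : Fin n → Γ(F, W)}

/-- On a basic open subset the coefficients of a relation come from `W` after multiplication by a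
power of `d`; injectivity of restriction returns the relation to `W`. -/
lemma linearIndependent_resM (hW : IsAffineOpen W)
    (hinj : ∀ (V : S.Opens) (hV : V ≤ W), Nonempty V → Function.Injective (resM F hV))
    (hs : LinearIndependent Γ(S, W) s) (V : S.Opens) (hV : V ≤ W) :
    LinearIndependent Γ(S, V) (fun i ↦ resM F hV (s i)) := by
  rw [Fintype.linearIndependent_iff]
  intro a ha i
  refine eqO_of_local _ _ fun x hx ↦ ?_
  obtain ⟨d, hdV, hxd⟩ := hW.exists_basicOpen_le ⟨x, hx⟩ (hV hx)
  have hn : Nonempty (S.basicOpen d) := ⟨⟨x, hxd⟩⟩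
  refine ⟨S.basicOpen d, hdV, hxd, ?_⟩
  rw [map_zero]
  have := hW.isLocalization_basicOpen d
  obtain ⟨c, hc⟩ := IsLocalization.exist_integer_multiples_of_finite (Submonoid.powers d)
    (fun i ↦ resO hdV (a i))
  choose z hz using hc
  have hz' (i) : resO (S.basicOpen_le d) (z i) =
      resO (S.basicOpen_le d) c * resO hdV (a i) := (hz i).trans (Algebra.smul_def _ _)
  have h1 : ∑ i, z i • s i = 0 := by
    refine hinj _ (S.basicOpen_le d) hn ?_
    rw [resM_sum, map_zero]
    have h2 := congrArg (resM F hdV) ha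
    rw [resM_sum, map_zero] at h2
    rw [← smul_zero (resO (S.basicOpen_le d) (c : Γ(S, W))), ← h2, Finset.smul_sum]
    refine Finset.sum_congr rfl fun i _ ↦ ?_
    rw [resM_smul, hz', mul_smul, resM_smul, resM_resM]
  have h2 := hz' i
  rw [Fintype.linearIndependent_iff.mp hs z h1 i, map_zero] at h2
  have hu : IsUnit (resO (S.basicOpen_le d) (c : Γ(S, W))) := by
    obtain ⟨m, hm⟩ := c.2
    rw [← hm, map_pow]
    exact (S.toRingedSpace.isUnit_res_basicOpen d).pow m
  exact (hu.mul_right_eq_zero.mp h2.symm)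

/-- Both `b` and `d` are units on `D(d)`, so the powers spent on extending `e` and on reaching the
span can be inverted. -/
lemma exists_sum_resM_eq {b : Γ(S, W)}
    (hs : ∀ t : Γ(F, W), ∃ m : ℕ, b ^ m • t ∈ Submodule.span Γ(S, W) (Set.range s))
    {d : Γ(S, W)} (hd : S.basicOpen d ≤ S.basicOpen b) (e : Γ(F, S.basicOpen d))
    (hext : ∃ (m : ℕ) (t : Γ(F, W)), resM F (S.basicOpen_le d) t =
      resO (S.basicOpen_le d) d ^ m • e) :
    ∃ a : Fin n → Γ(S, S.basicOpen d), ∑ i, a i • resM F (S.basicOpen_le d) (s i) = e := by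
  obtain ⟨m, t, ht⟩ := hext
  obtain ⟨l, hl⟩ := hs t
  obtain ⟨c, hc⟩ := (Submodule.mem_span_range_iff_exists_fun _).mp hl
  have hu : IsUnit (resO (S.basicOpen_le d) b ^ l * resO (S.basicOpen_le d) d ^ m) := by
    refine IsUnit.mul (IsUnit.pow _ ?_) (IsUnit.pow _ (S.toRingedSpace.isUnit_res_basicOpen d))
    rw [← resO_resO (S.basicOpen_le b) hd]
    exact (S.toRingedSpace.isUnit_res_basicOpen b).map (resO hd)
  obtain ⟨v, hv⟩ := hu.exists_left_inv
  refine ⟨fun i ↦ v * resO (S.basicOpen_le d) (c i), ?_⟩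
  have h1 := congrArg (resM F (S.basicOpen_le d)) hc
  rw [resM_sum, resM_smul, ht, map_pow, ← mul_smul] at h1
  simp only [mul_smul, ← Finset.smul_sum, ← resM_smul]
  rw [h1, ← mul_smul, hv, one_smul]

/-- Coordinates of a section exist on basic open subsets; independence makes them unique, so they
glue. -/
lemma span_resM_eq_top (hW : IsAffineOpen W)
    (hinj : ∀ (V : S.Opens) (hV : V ≤ W), Nonempty V → Function.Injective (resM F hV))
    (hext : ∀ (d : Γ(S, W)) (e : Γ(F, S.basicOpen d)), Nonempty (S.basicOpen d) →
      ∃ (m : ℕ) (t : Γ(F, W)), resM F (S.basicOpen_le d) t = resO (S.basicOpen_le d) d ^ m • e)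
    (hli : LinearIndependent Γ(S, W) s) {b : Γ(S, W)}
    (hs : ∀ t : Γ(F, W), ∃ m : ℕ, b ^ m • t ∈ Submodule.span Γ(S, W) (Set.range s))
    (V : S.Opens) (hV : V ≤ S.basicOpen b) :
    ⊤ ≤ Submodule.span Γ(S, V)
      (Set.range fun i ↦ resM F (hV.trans (S.basicOpen_le b)) (s i)) := by
  intro e _
  let P : S.Opens → Prop := fun V ↦ Nonempty V ∧ ∃ d : Γ(S, W), V = S.basicOpen d
  have hVW := hV.trans (S.basicOpen_le b)
  have hP : ∀ V' ≤ V, ∀ x ∈ V', ∃ V'' ≤ V', x ∈ V'' ∧ P V'' := by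
    intro V' hV' x hx
    obtain ⟨d, hd, hxd⟩ := hW.exists_basicOpen_le ⟨x, hx⟩ (hVW (hV' hx))
    exact ⟨S.basicOpen d, hd, hxd, ⟨⟨x, hxd⟩⟩, d, rfl⟩
  have hex (V' : S.Opens) (hV' : V' ≤ V) (p : P V') :
      ∃ a : Fin n → Γ(S, V'), ∑ i, a i • resM F (hV'.trans hVW) (s i) = resM F hV' e := by
    obtain ⟨hn, d, rfl⟩ := p
    exact exists_sum_resM_eq hs (hV'.trans hV) _ (hext d _ hn)
  choose a ha using hex
  have hglue (i) := exists_glueO P hP (fun V' h p ↦ a V' h p i) fun V' V'' h' p' h p'' ↦ by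
    have h1 := linearIndependent_resM hW hinj hli V'' ((h.trans h').trans hVW)
    rw [Fintype.linearIndependent_iff] at h1
    refine sub_eq_zero.mp (h1 (fun i ↦ resO h (a V' h' p' i) - a V'' (h.trans h') p'' i) ?_ i)
    have h2 := congrArg (resM F h) (ha V' h' p')
    rw [resM_sum, resM_resM] at h2
    simp only [sub_smul, Finset.sum_sub_distrib]
    rw [ha, ← h2, sub_eq_zero]
    refine Finset.sum_congr rfl fun i _ ↦ ?_
    rw [resM_smul, resM_resM]
  choose t ht using hglue
  refine (Submodule.mem_span_range_iff_exists_fun _).mpr ⟨t, eqM_of_local F _ _ fun x hx ↦ ?_⟩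
  obtain ⟨V', hV', hxV', p⟩ := hP V le_rfl x hx
  refine ⟨V', hV', hxV', ?_⟩
  rw [resM_sum, ← ha V' hV' p]
  refine Finset.sum_congr rfl fun i _ ↦ ?_
  rw [resM_smul, resM_resM, ht i V' hV' p]

end LocalBasis

section LocallyFree

variable {k : Type u} [Field k] [IsIntegral X] [IsIntegral S]
  {q : S ⟶ Spec (CommRingCat.of k)} {f : X ⟶ S} [Smooth f] [Smooth q] [Smooth (f ≫ q)]
  {M : X.Modules} [M.IsQuasicoherent] (N : Stratification (f ≫ q) M)

/-- The horizontal sections of the pushforward over `W` are the horizontal sections over `f⁻¹(W)`. -/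
def sectionEquiv (W : S.Opens) : Γ(N.relative.pushforwardHorizontal, W) ≃ₗ[Γ(S, W)]
    Hor N.relative (le_refl (f ⁻¹ᵁ W)) where
  toFun e := Hor.mk _ (N.relative.toSection e) (N.relative.isHorizontal_toSection e)
  invFun e := N.relative.ofSection e.val e.prop
  map_add' e e' := rfl
  map_smul' a e := Hor.ext (by
    change N.relative.toSection (a • e) = f.appLE W _ le_rfl a • N.relative.toSection e
    rw [N.relative.toSection_smul])
  left_inv e := rfl
  right_inv e := rfl

/-- The sections over a chart `W` are a finite module with a Leibniz action of a simple ring, so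
they are free at the prime of `x`. A basis there spreads out to some `D(b)`, and extension up to
powers makes it a basis over every smaller open subset. -/
theorem isLocallyFree_pushforwardHorizontal (hM : M.IsFiniteType)
    (hf : ∀ W : S.Opens, IsIso (f.app W)) :
    N.relative.pushforwardHorizontal.IsLocallyFree ∧
      N.relative.pushforwardHorizontal.IsFiniteType := by
  refine isLocallyFree_of_basis _ fun x ↦ ?_
  obtain ⟨W, m, -, hxW, ⟨cS⟩⟩ := exists_absCoord (p := q) (show x ∈ (⊤ : S.Opens) from trivial)
  have hWn : Nonempty W := ⟨⟨x, hxW⟩⟩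
  have hW := cS.affine
  have := cS.isNoetherianRing
  have := finite_hor_preimage N hM cS (hf W)
  have hfin : Module.Finite Γ(S, W) Γ(N.relative.pushforwardHorizontal, W) :=
    Module.Finite.equiv (sectionEquiv N W).symm
  let p : Ideal Γ(S, W) :=
    (IsLocalRing.maximalIdeal (S.presheaf.stalk x)).comap (S.presheaf.germ W x hxW).hom
  have hfree := ((gaussManinStratification N).isLeibniz cS).free_localization
    cS.isTaylor.hasse_zero cS.isSimple
    (fun β γ a ↦ ⟨_, cS.isTaylor.hasse_hasse cS.etale.formallyUnramified β γ a⟩) p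
  obtain ⟨b, hb, n, s, hli, hs⟩ := exists_local_basis p hfree
  have hxb : x ∈ S.basicOpen b := by
    rw [S.mem_basicOpen b x hxW]
    by_contra h
    exact hb (Ideal.mem_comap.mpr ((IsLocalRing.mem_maximalIdeal _).mpr h))
  have hinj (V : S.Opens) (hV : V ≤ W) (hn : Nonempty V) :
      Function.Injective (resM N.relative.pushforwardHorizontal hV) := by
    intro e e' h
    apply N.relative.toSection_injective
    have h1 := congrArg N.relative.toSection h
    rw [N.relative.toSection_resM, N.relative.toSection_resM] at h1
    exact eq_of_resM_eq N hM _ (nonempty_preimage (hf V)) h1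
  have hext (d : Γ(S, W)) (e : Γ(N.relative.pushforwardHorizontal, S.basicOpen d))
      (hn : Nonempty (S.basicOpen d)) : ∃ (m : ℕ) (t : Γ(N.relative.pushforwardHorizontal, W)),
      resM _ (S.basicOpen_le d) t = resO (S.basicOpen_le d) d ^ m • e := by
    have hle : f ⁻¹ᵁ S.basicOpen d ≤ f ⁻¹ᵁ W := f.preimage_mono (S.basicOpen_le d)
    obtain ⟨m, t, ht⟩ := exists_pow_smul_extend N hM cS (hf W) (h := hle)
      (nonempty_preimage (hf _)) (Hor.mk hle _ (N.relative.isHorizontal_toSection e))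
    refine ⟨m, (sectionEquiv N W).symm t, N.relative.toSection_injective ?_⟩
    rw [N.relative.toSection_resM, N.relative.toSection_smul]
    refine ht.trans ?_
    rw [Hor.val_smul, Hor.val_mk, map_pow, map_pow, appLE_resO]
  refine ⟨S.basicOpen b, hxb, n, fun i ↦ resM _ (S.basicOpen_le b) (s i), fun V hV ↦ ?_⟩
  simp only [resM_resM]
  exact ⟨linearIndependent_resM hW hinj hli V _, span_resM_eq_top hW hinj hext hli hs V hV⟩

end LocallyFree

end

end Strat

end

theorem theorem2p2 {k : Type u} [Field k] {X S : Scheme.{u}} [ConnectedSpace X] [ConnectedSpace S]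
    (q : S ⟶ Spec (CommRingCat.of k)) (f : X ⟶ S) [Smooth (f ≫ q)] [Smooth q] [Smooth f]
    (E : X.Modules) [E.IsQuasicoherent] (N : Strat.Stratification (f ≫ q) E) :
    (∃! N' : Strat.Stratification q N.relative.pushforwardHorizontal, Strat.IsInduced N N') ∧
    ((∀ W : S.Opens, IsIso (f.app W)) → E.IsFiniteType →
      N.relative.pushforwardHorizontal.IsLocallyFree ∧
        N.relative.pushforwardHorizontal.IsFiniteType) := by
  refine ⟨Strat.existsUnique_isInduced N, fun hf hE ↦ ?_⟩
  -- Connectedness enters only here: with smoothness it gives the integrality on which the identity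
  -- theorem depends.
  have : IsIntegral X := Strat.isIntegral_of_smooth (p := f ≫ q)
  have : IsIntegral S := Strat.isIntegral_of_smooth (p := q)
  exact Strat.isLocallyFree_pushforwardHorizontal N hE hf
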